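/- Let $I$ and $O$ be finite sets, let $h:I\to O$ be surjective, and let $\Lambda=(\lambda_{ij})_{i,j\in I}$ be a rate transition matrix, i.e. a real matrix with $\lambda_{ij}\ge 0$ for $i\ne j$ and $\sum_{j}\lambda_{ij}=0$ for every $i$. Let $\Omega$ be the set of cadlag functions $\omega:\mathbb R_+\to I$ ($I$ discrete), $X_t(\omega)=\omega(t)$, $\mathcal F^0_t=\sigma(X_s: s\le t)$, $\mathcal F^0=\sigma(X_s:s\ge 0)$, $Y_t=h(X_t)$ and $\mathcal Y^0_t=\sigma(Y_s:s\le t)$. Let $\Delta$ be the set of probability measures on $I$, written as row vectors $(\mu(i))_{i\in I}\in\mathbb R^I$; let $\Delta_a$ be the set of those supported in $h^{-1}(a)$, and let $\Delta_e=\bigcup_{a\in O}\Delta_a$ (the effective simplex), with its Borel $\sigma$-algebra $\mathcal B(\Delta_e)$. For $\mu\in\Delta$ let $P_\mu$ be the unique probability measure on $(\Omega,\mathcal F^0)$ under which $(X_t)$ is a Markov process with generator $\Lambda$ and initial distribution $\mu$, i.e. $P_\mu(X_0=i)=\mu(i)$ for $i\in I$ and, for all $t,s\ge 0$ and $f:I\to\mathbb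 R$, $E_\mu[f(X_{t+s})\mid\mathcal F^0_t]=(e^{s\Lambda}f)(X_t)$ $P_\mu$-a.s. For each $a\in O$ fix an arbitrary $\nu_a\in\Delta_a$. For $\mu\in\mathbb R^I$ put $H_a[\mu]=\frac{1}{\mu 1_{h^{-1}(a)}}\,1_{h^{-1}(a)}*\mu$ if $\mu 1_{h^{-1}(a)}:=\sum_{j\in h^{-1}(a)}\mu(j)\neq 0$, and $H_a[\mu]=\nu_a$ otherwise, where $*$ is the componentwise product. For $\mu\in\Delta$ and $\omega\in\Omega$, with $T_1<T_2<\dots$ the jump times of the trajectory $Y(\omega)$, let $t\mapsto\Pi^\mu_t(\omega)$ be the unique cadlag solution with values in $\mathbb R^I$ of $$\Pi^\mu_t=H_{Y_0}[\mu]+\int_0^t\Big\{1_{h^{-1}(Y_s)}*(\Pi^\mu_s\Lambda)-(\Pi^\mu_s\Lambda 1_{h^{-1}(Y_s)})\,\Pi^\mu_s\Big\}ds+\sum_{0<T_n\le t}\Big\{H_{Y_{T_n}}[\Pi^\mu_{T_n-}\Lambda]-\Pi^\mu_{T_n-}\Big\},\qquad t\ge 0.$$ For $t\ge0$, $\nu\in\Delta_e$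 and $A\in\mathcal B(\Delta_e)$ set $R_t(\nu,A)=P_\nu(\Pi^\nu_t\in A)$. Then $(R_t)_{t\ge0}$ is a Markov transition function on $(\Delta_e,\mathcal B(\Delta_e))$: each $R_t$ is a Markov kernel, $R_0(\nu,\cdot)$ is the unit mass at $\nu$, and $R_{s+t}(\nu,A)=\int_{\Delta_e}R_t(\rho,A)\,R_s(\nu,d\rho)$. Moreover, for every $\mu\in\Delta$ the process $(\Pi^\mu_t)$ on $(\Omega,\mathcal F^0,P_\mu)$ is a Markov process with respect to $(\mathcal Y^0_t)$ with values in $\Delta_e$ and transition function $(R_t)$: it takes values in $\Delta_e$, it is $(\mathcal Y^0_t)$-adapted, and for all $t,s\ge 0$ and $A\in\mathcal B(\Delta_e)$ $$P_\mu(\Pi^\mu_{t+s}\in A\mid\mathcal Y^0_t)=R_s(\Pi^\mu_t,A),\qquad P_\mu\text{-a.s.}$$ -/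

import Mathlib

open MeasureTheory ProbabilityTheory Filter Topology Matrix
open scoped NNReal ENNReal

namespace NoiseFreeFilter

/-! ### Finite-state data -/

/-- `Λ` is a rate transition matrix (a `Q`-matrix) on the finite set `I`. -/
structure IsRateMatrix {I : Type*} [Fintype I] (Λ : Matrix I I ℝ) : Prop where
  offDiag_nonneg : ∀ i j, i ≠ j → 0 ≤ Λ i j
  row_sum : ∀ i, ∑ j, Λ i j = 0

/-- The face `Δ_a` of the simplex of probability vectors on `I`: those supported in
the level set `h⁻¹(a)`. -/
def face {I O : Type*} [Fintype I] (h : I → O) (a : O) : Set (I → ℝ) :=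
  {ν | ν ∈ stdSimplex ℝ I ∧ ∀ i, h i ≠ a → ν i = 0}

/-- The effective simplex `Δ_e = ⋃ a, Δ_a`. As a type it carries the subspace `σ`-algebra of
`I → ℝ`, which is its Borel `σ`-algebra. -/
def effectiveSimplex {I O : Type*} [Fintype I] (h : I → O) : Set (I → ℝ) :=
  ⋃ a, face h a

/-- The indicator function of the level set `h⁻¹(a)`, as a vector. -/
def levelInd {I O : Type*} [DecidableEq O] (h : I → O) (a : O) : I → ℝ :=
  fun i => if h i = a then 1 else 0

/-- The operator `H_a`: restriction of the vector `μ` to `h⁻¹(a)` followed by normalization, with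
the value `d a` if the total mass of `h⁻¹(a)` is zero. -/
noncomputable def condOp {I O : Type*} [Fintype I] [DecidableEq O] (h : I → O)
    (d : O → I → ℝ) (a : O) (μ : I → ℝ) : I → ℝ :=
  if μ ⬝ᵥ levelInd h a ≠ 0 then (μ ⬝ᵥ levelInd h a)⁻¹ • (levelInd h a * μ) else d a

/-- The vector field `F_a(y) = 1_{h⁻¹(a)} * (y Λ) - (y Λ 1_{h⁻¹(a)}) y`. -/
def vecField {I O : Type*} [Fintype I] [DecidableEq O] (Λ : Matrix I I ℝ) (h : I → O)
    (a : O) (y : I → ℝ) : I → ℝ :=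
  levelInd h a * (y ᵥ* Λ) - ((y ᵥ* Λ) ⬝ᵥ levelInd h a) • y

/-! ### The canonical path space -/

/-- The set `Ω` of cadlag functions `ℝ₊ → I`, for the discrete topology on `I`: at each time the
path is constant on a right neighbourhood and eventually constant from the left (the latter is
void at time `0`). -/
def Path (I : Type*) : Type _ :=
  {ω : ℝ≥0 → I // ∀ t, (∀ᶠ s in 𝓝[>] t, ω s = ω t) ∧ ∃ i, ∀ᶠ s in 𝓝[<] t, ω s = i}

/-- The canonical process `X_t(ω) = ω(t)`. -/
def X {I : Type*} (t : ℝ≥0) (ω : Path I) : I := ω.1 t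

/-- The `σ`-algebra `ℱ⁰ = σ(X_s : s ≥ 0)`. -/
instance {I : Type*} : MeasurableSpace (Path I) :=
  ⨆ s : ℝ≥0, MeasurableSpace.comap (X s) ⊤

/-- The natural filtration `ℱ⁰_t = σ(X_s : s ≤ t)` of the canonical process. -/
def stateFiltration (I : Type*) :
    Filtration ℝ≥0 (inferInstance : MeasurableSpace (Path I)) where
  seq t := ⨆ s ≤ t, MeasurableSpace.comap (X s) ⊤
  mono' _ _ hst := biSup_mono fun _ hr => hr.trans hst
  le' _ := iSup₂_le fun s _ => le_iSup (fun s : ℝ≥0 => MeasurableSpace.comap (X s) ⊤) s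

/-- The observation process `Y_t = h(X_t)`. -/
def Y {I O : Type*} (h : I → O) (t : ℝ≥0) (ω : Path I) : O := h (X t ω)

/-- The natural filtration `𝒴⁰_t = σ(Y_s : s ≤ t)` of the observation process. -/
def obsFiltration {I O : Type*} (h : I → O) :
    Filtration ℝ≥0 (inferInstance : MeasurableSpace (Path I)) where
  seq t := ⨆ s ≤ t, MeasurableSpace.comap (Y h s) ⊤
  mono' _ _ hst := biSup_mono fun _ hr => hr.trans hst
  le' _ := iSup₂_le fun s _ => by
    refine le_trans ?_ (le_iSup (fun s : ℝ≥0 => MeasurableSpace.comap (X (I := I) s) ⊤) s)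
    rintro _ ⟨B, -, rfl⟩
    exact ⟨h ⁻¹' B, trivial, rfl⟩

/-- `P` is the law `P_μ` on `(Ω, ℱ⁰)`: the probability measure under which the canonical process is
a Markov process with generator `Λ` and initial distribution `μ`. -/
structure IsChainLaw {I : Type*} [Fintype I] [DecidableEq I] (Λ : Matrix I I ℝ) (μ : I → ℝ)
    (P : Measure (Path I)) : Prop where
  isProbabilityMeasure : IsProbabilityMeasure P
  initial : ∀ i, P {ω | X 0 ω = i} = ENNReal.ofReal (μ i)
  markov : ∀ (t s : ℝ≥0) (f : I → ℝ),
    P[fun ω => f (X (t + s) ω) | stateFiltration I t]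
      =ᵐ[P] fun ω => (NormedSpace.exp ((s : ℝ) • Λ) *ᵥ f) (X t ω)

/-! ### The filtering equation -/

/-- The set of jump times of the observed trajectory `Y(ω)` in `(0, t]`. -/
def jumpTimes {I O : Type*} (h : I → O) (ω : Path I) (t : ℝ≥0) : Set ℝ≥0 :=
  {s | 0 < s ∧ s ≤ t ∧ ¬ ∀ᶠ r in 𝓝[<] s, Y h r ω = Y h s ω}

theorem jumpTimes_finite {I O : Type*} (h : I → O) (ω : Path I) (t : ℝ≥0) :
    (jumpTimes h ω t).Finite := by
  have key : (Set.Icc 0 t ∩ jumpTimes h ω t).Finite := by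
    refine isCompact_Icc.induction_on (p := fun S => (S ∩ jumpTimes h ω t).Finite) (by simp)
      (fun S T hST hT => hT.subset (Set.inter_subset_inter_left _ hST))
      (fun S T hS hT => by rw [Set.union_inter_distrib_right]; exact hS.union hT) ?_
    intro x _
    obtain ⟨hr, i, hl⟩ := ω.2 x
    have hr' : ∀ᶠ y in 𝓝[>] x, ∀ᶠ s in 𝓝 y, ω.1 s = ω.1 x := by
      have := eventually_eventually_nhdsWithin.2 hr
      filter_upwards [this, self_mem_nhdsWithin] with y hy hxy
      rwa [isOpen_Ioi.nhdsWithin_eq hxy] at hy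
    have hl' : ∀ᶠ y in 𝓝[<] x, ∀ᶠ s in 𝓝 y, ω.1 s = i := by
      have := eventually_eventually_nhdsWithin.2 hl
      filter_upwards [this, self_mem_nhdsWithin] with y hy hxy
      rwa [isOpen_Iio.nhdsWithin_eq hxy] at hy
    have hno : ∀ y, ∀ j, (∀ᶠ s in 𝓝 y, ω.1 s = j) → y ∉ jumpTimes h ω t := by
      intro y j hy hJ
      refine hJ.2.2 ?_
      filter_upwards [hy.filter_mono nhdsWithin_le_nhds] with r hr
      simp only [Y, X, hr, hy.self_of_nhds]
    have hne : ∀ᶠ y in 𝓝[≠] x, y ∉ jumpTimes h ω t := by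
      rw [← Set.Iio_union_Ioi, nhdsWithin_union, eventually_sup]
      exact ⟨hl'.mono fun y hy => hno y _ hy, hr'.mono fun y hy => hno y _ hy⟩
    rw [eventually_nhdsWithin_iff] at hne
    refine ⟨_, mem_nhdsWithin_of_mem_nhds hne, (Set.finite_singleton x).subset ?_⟩
    rintro y ⟨hy, hyJ⟩
    by_contra hyx
    exact hy hyx hyJ
  refine key.subset fun s hs => ⟨⟨zero_le, hs.2.1⟩, hs⟩

/-- The trajectory `p : ℝ₊ → ℝ^I` is a cadlag solution, along the path `ω`, of the filtering
equation with starting point `x`: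
`p_t = x + ∫₀ᵗ F_{Y_s}(p_s) ds + ∑_{0 < T_n ≤ t} (H_{Y_{T_n}}[p_{T_n-} Λ] - p_{T_n-})`,
where the `T_n` are the jump times of `Y(ω)`. -/
structure IsFilterSolution {I O : Type*} [Fintype I] [DecidableEq O] (Λ : Matrix I I ℝ)
    (h : I → O) (d : O → I → ℝ) (x : I → ℝ) (ω : Path I) (p : ℝ≥0 → I → ℝ) : Prop where
  right_cont : ∀ t, ContinuousWithinAt p (Set.Ioi t) t
  left_lim : ∀ t, ∃ l, Tendsto p (𝓝[<] t) (𝓝 l)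
  intervalIntegrable : ∀ t : ℝ≥0, IntervalIntegrable
    (fun s : ℝ => vecField Λ h (Y h s.toNNReal ω) (p s.toNNReal)) volume 0 t
  equation : ∀ t : ℝ≥0,
    p t = x + (∫ s in (0 : ℝ)..t, vecField Λ h (Y h s.toNNReal ω) (p s.toNNReal))
      + ∑ s ∈ (jumpTimes_finite h ω t).toFinset,
          (condOp h d (Y h s ω) (Function.leftLim p s ᵥ* Λ) - Function.leftLim p s)

/-- The filtering process `Π^μ_t(ω)`: the (unique) solution of the filtering equation along `ω`
with starting point `H_{Y_0(ω)}[μ]`. -/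
noncomputable def filterProcess {I O : Type*} [Fintype I] [DecidableEq O] (Λ : Matrix I I ℝ)
    (h : I → O) (d : O → I → ℝ) (μ : I → ℝ) (t : ℝ≥0) (ω : Path I) : I → ℝ :=
  Classical.epsilon (IsFilterSolution Λ h d (condOp h d (Y h 0 ω) μ) ω) t

/-- `R_t(ν, A) = P_ν(Π^ν_t ∈ A)` for `ν ∈ Δ_e` and `A ⊆ Δ_e`. -/
noncomputable def filterTransition {I O : Type*} [Fintype I] [DecidableEq O] (Λ : Matrix I I ℝ)
    (h : I → O) (d : O → I → ℝ) (P : (I → ℝ) → Measure (Path I)) (t : ℝ≥0)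
    (ν : effectiveSimplex h) (A : Set (effectiveSimplex h)) : ℝ≥0∞ :=
  P ν {ω | filterProcess Λ h d ν t ω ∈ Subtype.val '' A}

/-- `(R_t)` is a Markov transition function on `E`: each `R_t` is a Markov kernel,
`R_0(x, ·)` is the unit mass at `x`, and the Chapman-Kolmogorov equation
`R_{s+t}(x, A) = ∫ R_t(y, A) R_s(x, dy)` holds. -/
def IsMarkovTransitionFunction {E : Type*} [MeasurableSpace E]
    (R : ℝ≥0 → E → Set E → ℝ≥0∞) : Prop :=
  ∃ κ : ℝ≥0 → Kernel E E,
    (∀ t, IsMarkovKernel (κ t)) ∧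
    (∀ t x A, MeasurableSet A → κ t x A = R t x A) ∧
    (∀ x, κ 0 x = Measure.dirac x) ∧
    ∀ s t x A, MeasurableSet A → κ (s + t) x A = ∫⁻ y, κ t y A ∂(κ s x)

end NoiseFreeFilter

/-!
The filtering equation is solved explicitly. While the observed path stays in a level `a`, the
solution follows the normalized semigroup of the rate matrix killed outside of `h⁻¹(a)` (`flow`);
at an observed jump into `b` it is replaced by `condOp h d b` of its left limit times `Λ`. Both
rules together are `stepMap`, and a trajectory that obeys them is a "piecewise flow" of the observed
path. Existence, uniqueness, and dependence on the past of the path alone are proved by propagation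
along intervals `[u, s)` on which the path is constant (`Path.induction`). A piecewise flow solves
the equation (`IsPiecewiseFlow.isFilterSolution`), and the local Lipschitz property of the vector
fields makes solutions in `ℝ^I` unique (`IsFilterSolution.eq`). So `filterProcess` is the piecewise
flow `pathFilter`; it takes values in the effective simplex, it is jointly measurable in the initial
law and the path (`measurable_pathFilter`), and it restarts from its current value
(`pathFilter_add`).

That the solution is the conditional law of the chain given the observations is obtained by
discretization. Given the observations on a grid of mesh `t / (n + 1)`, the conditional law is the
normalized product of transition matrices restricted to the observed levels
(`IsMarkovMeasure.setIntegral_gridFilter`). Along a path these products converge, in direction, to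
the piecewise flow (`tendsto_gridFilter`): on intervals without observed jump by Euler's formula for
the exponential of the killed rate matrix, and at an observed jump since the restricted transition
matrix is `δ Λ + o(δ)` between different levels. This requires that the unnormalized limit does not
vanish, which holds for paths that start in the support of `μ` and make only jumps of positive rate,
hence almost surely (`IsMarkovMeasure.ae_rate_pos`). Dominated convergence and a `π`-system
argument give `IsChainLaw.setLIntegral_filter`.

The law of the chain is determined by its transition probabilities and its initial law
(`IsMarkovMeasure.ext`), so that it is linear in the initial law, and the path after time `t` is a
chain started from `X t`, independently of the past. With the filtering property, the future after
`t`, given the observed past, is a chain whose initial law is the filter at time `t`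
(`map_filterVar_shift_eq`). Inserting the restart property yields
`P_μ(Π_{t+s} ∈ A, C) = ∫_C R_s(Π_t, A) dP_μ` for observed events `C` (`measure_filterVar_add`), which
is the Markov property and, for `C` the whole space, the Chapman-Kolmogorov equation.
-/

namespace NoiseFreeFilter

/-! ### Exponentials of matrices -/

section MatrixExp

attribute [local instance] Matrix.linftyOpNormedRing Matrix.linftyOpNormedAlgebra

variable {I : Type*} [Fintype I] [DecidableEq I]

theorem continuous_exp_smul (A : Matrix I I ℝ) :
    Continuous fun u : ℝ => NormedSpace.exp (u • A) :=
  continuous_iff_continuousAt.2 fun u => (hasDerivAt_exp_smul_const A u).continuousAt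

theorem hasDerivAt_vecMul_exp (A : Matrix I I ℝ) (x : I → ℝ) (u : ℝ) :
    HasDerivAt (fun u : ℝ => x ᵥ* NormedSpace.exp (u • A))
      ((x ᵥ* NormedSpace.exp (u • A)) ᵥ* A) u := by
  rw [vecMul_vecMul]
  have := (hasDerivAt_exp_smul_const A u)
  let φ : Matrix I I ℝ →L[ℝ] (I → ℝ) := LinearMap.toContinuousLinearMap
    { toFun := fun B => x ᵥ* B
      map_add' := fun B C => vecMul_add B C x
      map_smul' := fun c B => by simp [vecMul_smul] }
  exact φ.hasFDerivAt.comp_hasDerivAt u this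

theorem exp_add_smul (A : Matrix I I ℝ) (u v : ℝ) :
    NormedSpace.exp ((u + v) • A) = NormedSpace.exp (u • A) * NormedSpace.exp (v • A) := by
  rw [add_smul]
  exact Matrix.exp_add_of_commute _ _ (((Commute.refl A).smul_left u).smul_right v)

/-- If `A * B = 0`, only the zeroth term of the exponential series survives multiplication
by `B`. -/
theorem exp_mul_of_mul_eq_zero {A B : Matrix I I ℝ} (hAB : A * B = 0) :
    NormedSpace.exp A * B = B := by
  have h1 := (NormedSpace.exp_series_hasSum_exp' (𝕂 := ℝ) A).mul_right B
  have h2 : HasSum (fun n : ℕ => ((n.factorial : ℝ)⁻¹ • A ^ n) * B) B := by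
    have := hasSum_single (f := fun n : ℕ => ((n.factorial : ℝ)⁻¹ • A ^ n) * B) 0 ?_
    · simpa using this
    · intro n hn
      obtain ⟨m, rfl⟩ := Nat.exists_eq_succ_of_ne_zero hn
      simp [pow_succ, mul_assoc, hAB]
  exact h1.unique h2

theorem pow_entry_nonneg {B : Matrix I I ℝ} (hB : ∀ i j, 0 ≤ B i j) (n : ℕ) (i j : I) :
    0 ≤ (B ^ n) i j := by
  induction n generalizing i j with
  | zero => rw [pow_zero, one_apply]; positivity
  | succ n ih =>
    rw [pow_succ, mul_apply]
    exact Finset.sum_nonneg fun k _ => mul_nonneg (ih i k) (hB k j)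

theorem term_le_exp_entry {B : Matrix I I ℝ} (hB : ∀ i j, 0 ≤ B i j) (n : ℕ) (i j : I) :
    (n.factorial : ℝ)⁻¹ * (B ^ n) i j ≤ NormedSpace.exp B i j := by
  have h1 := NormedSpace.exp_series_hasSum_exp' (𝕂 := ℝ) B
  have h2 : HasSum (fun n : ℕ => (n.factorial : ℝ)⁻¹ * (B ^ n) i j) (NormedSpace.exp B i j) := by
    exact Pi.hasSum.1 (Pi.hasSum.1 h1 i) j
  exact le_hasSum h2 n fun k _ => mul_nonneg (by positivity) (pow_entry_nonneg hB k i j)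

/-- Adding a large multiple of the identity makes a matrix with nonnegative off-diagonal entries
nonnegative, and changes its exponential by a positive scalar factor. -/
theorem exists_exp_smul_eq {A : Matrix I I ℝ} (hA : ∀ i j, i ≠ j → 0 ≤ A i j) :
    ∃ c : ℝ, (∀ i j, 0 ≤ (A + c • (1 : Matrix I I ℝ)) i j) ∧ ∀ u : ℝ,
      NormedSpace.exp (u • A) =
        Real.exp (-(u * c)) • NormedSpace.exp (u • (A + c • (1 : Matrix I I ℝ))) := by
  refine ⟨∑ i, |A i i|, fun i j => ?_, fun u => ?_⟩
  · by_cases hij : i = j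
    · subst hij
      have := Finset.single_le_sum (f := fun i => |A i i|) (fun i _ => abs_nonneg _)
        (Finset.mem_univ i)
      simp only [Matrix.add_apply, Matrix.smul_apply, one_apply_eq, smul_eq_mul, mul_one]
      linarith [neg_abs_le (A i i)]
    · simpa [one_apply_ne hij] using hA i j hij
  · set c := ∑ i, |A i i|
    have h1 : u • A = (-(u * c)) • (1 : Matrix I I ℝ) + u • (A + c • (1 : Matrix I I ℝ)) := by
      rw [smul_add, smul_smul, neg_smul]; abel
    rw [h1, Matrix.exp_add_of_commute _ _ ((Commute.one_left _).smul_left _)]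
    have h2 : NormedSpace.exp ((-(u * c)) • (1 : Matrix I I ℝ))
        = Real.exp (-(u * c)) • (1 : Matrix I I ℝ) := by
      rw [← Algebra.algebraMap_eq_smul_one, ← Algebra.algebraMap_eq_smul_one,
        Real.exp_eq_exp_ℝ, NormedSpace.algebraMap_exp_comm]
      rfl
    rw [h2, smul_one_mul]

theorem exp_entry_nonneg {A : Matrix I I ℝ} (hA : ∀ i j, i ≠ j → 0 ≤ A i j) {u : ℝ}
    (hu : 0 ≤ u) (i j : I) : 0 ≤ NormedSpace.exp (u • A) i j := by
  obtain ⟨c, hc, he⟩ := exists_exp_smul_eq hA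
  have hB : ∀ i j, 0 ≤ (u • (A + c • (1 : Matrix I I ℝ))) i j := fun i j => mul_nonneg hu (hc i j)
  rw [he]
  refine mul_nonneg (Real.exp_nonneg _) (le_trans ?_ (term_le_exp_entry hB 0 i j))
  exact mul_nonneg (by positivity) (pow_entry_nonneg hB 0 i j)

theorem exp_diag_pos {A : Matrix I I ℝ} (hA : ∀ i j, i ≠ j → 0 ≤ A i j) {u : ℝ}
    (hu : 0 ≤ u) (i : I) : 0 < NormedSpace.exp (u • A) i i := by
  obtain ⟨c, hc, he⟩ := exists_exp_smul_eq hA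
  have hB : ∀ i j, 0 ≤ (u • (A + c • (1 : Matrix I I ℝ))) i j := fun i j => mul_nonneg hu (hc i j)
  rw [he]
  refine mul_pos (Real.exp_pos _) (lt_of_lt_of_le ?_ (term_le_exp_entry hB 0 i i))
  simp

theorem exp_entry_pos {A : Matrix I I ℝ} (hA : ∀ i j, i ≠ j → 0 ≤ A i j) {u : ℝ}
    (hu : 0 < u) {i j : I} (hij : i ≠ j) (h : 0 < A i j) :
    0 < NormedSpace.exp (u • A) i j := by
  obtain ⟨c, hc, he⟩ := exists_exp_smul_eq hA
  have hB : ∀ i j, 0 ≤ (u • (A + c • (1 : Matrix I I ℝ))) i j :=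
    fun i j => mul_nonneg hu.le (hc i j)
  rw [he]
  refine mul_pos (Real.exp_pos _) (lt_of_lt_of_le ?_ (term_le_exp_entry hB 1 i j))
  have : 0 < u * A i j := mul_pos hu h
  simpa [one_apply_ne hij] using this

end MatrixExp

section PowLimit

variable {𝔸 : Type*} [NormedRing 𝔸] [NormOneClass 𝔸]

theorem norm_pow_sub_pow_le {x y : 𝔸} {M : ℝ} (hM : 1 ≤ M) (hx : ‖x‖ ≤ M) (hy : ‖y‖ ≤ M) (n : ℕ) :
    ‖x ^ n - y ^ n‖ ≤ n * ‖x - y‖ * M ^ n := by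
  induction n with
  | zero => simp
  | succ n ih =>
    have h1 : x ^ (n + 1) - y ^ (n + 1) = (x ^ n - y ^ n) * x + y ^ n * (x - y) := by
      rw [pow_succ, pow_succ]; noncomm_ring
    have hyn : ‖y ^ n‖ ≤ M ^ n := (norm_pow_le y n).trans (by gcongr)
    have h0 : 0 ≤ ‖x - y‖ := norm_nonneg _
    calc ‖x ^ (n + 1) - y ^ (n + 1)‖ ≤ ‖x ^ n - y ^ n‖ * ‖x‖ + ‖y ^ n‖ * ‖x - y‖ := by
          rw [h1]
          exact (norm_add_le _ _).trans (add_le_add (norm_mul_le _ _) (norm_mul_le _ _))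
      _ ≤ (n * ‖x - y‖ * M ^ n) * M + M ^ n * ‖x - y‖ := by gcongr
      _ ≤ (n * ‖x - y‖ * M ^ n) * M + M ^ n * M * ‖x - y‖ := by
          gcongr; exact le_mul_of_one_le_right (by positivity) hM
      _ = (n + 1 : ℕ) * ‖x - y‖ * M ^ (n + 1) := by push_cast; ring

/-- Factors with the same first-order expansion `1 + δ A + o(δ)` have asymptotically equal powers, as
long as the total time `N n * δ n` stays bounded. -/
theorem tendsto_pow_sub_pow [NormedAlgebra ℝ 𝔸] {E F : ℕ → 𝔸} {A : 𝔸} {δ : ℕ → ℝ} {N : ℕ → ℕ}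
    {w : ℝ} (hδ : ∀ᶠ n in atTop, 0 < δ n)
    (hE : Tendsto (fun n => (δ n)⁻¹ • (E n - 1)) atTop (𝓝 A))
    (hF : Tendsto (fun n => (δ n)⁻¹ • (F n - 1)) atTop (𝓝 A))
    (hN : Tendsto (fun n => N n * δ n) atTop (𝓝 w)) :
    Tendsto (fun n => E n ^ N n - F n ^ N n) atTop (𝓝 0) := by
  have key : ∀ {G : ℕ → 𝔸}, Tendsto (fun n => (δ n)⁻¹ • (G n - 1)) atTop (𝓝 A) →
      ∀ᶠ n in atTop, ‖G n‖ ≤ Real.exp ((‖A‖ + 1) * δ n) := by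
    intro G hG
    filter_upwards [hδ, hG.norm.eventually_lt_const (lt_add_one ‖A‖)] with n hn h
    rw [norm_smul, norm_inv, Real.norm_of_nonneg hn.le, inv_mul_lt_iff₀ hn] at h
    calc ‖G n‖ = ‖1 + (G n - 1)‖ := by congr 1; abel
      _ ≤ 1 + ‖G n - 1‖ := (norm_add_le _ _).trans (by rw [norm_one])
      _ ≤ (‖A‖ + 1) * δ n + 1 := by linarith
      _ ≤ _ := Real.add_one_le_exp _
  have hdiff : Tendsto (fun n => (δ n)⁻¹ • (E n - F n)) atTop (𝓝 0) := by
    have := hE.sub hF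
    rw [sub_self] at this
    refine this.congr fun n => ?_
    rw [← smul_sub]; congr 1; abel
  have hlim : Tendsto (fun n => (N n * δ n) * ‖(δ n)⁻¹ • (E n - F n)‖
      * Real.exp ((‖A‖ + 1) * (N n * δ n))) atTop (𝓝 0) := by
    have := (hN.mul hdiff.norm).mul
      ((Real.continuous_exp.tendsto _).comp (hN.const_mul (‖A‖ + 1)))
    simpa using this
  refine squeeze_zero_norm' ?_ hlim
  filter_upwards [hδ, key hE, key hF] with n hn h1 h2
  refine (norm_pow_sub_pow_le (Real.one_le_exp (by positivity)) h1 h2 (N n)).trans (le_of_eq ?_)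
  rw [← Real.exp_nat_mul, norm_smul, norm_inv, Real.norm_of_nonneg hn.le]
  field_simp

/-- Euler's approximation of the exponential, along step sizes `δ n → 0` and numbers of steps
`N n` with `N n * δ n → w`. -/
theorem tendsto_pow_exp [NormedAlgebra ℝ 𝔸] [CompleteSpace 𝔸] {E : ℕ → 𝔸} {A : 𝔸} {δ : ℕ → ℝ}
    {N : ℕ → ℕ} {w : ℝ} (hδ : ∀ᶠ n in atTop, 0 < δ n) (hδ0 : Tendsto δ atTop (𝓝 0))
    (hE : Tendsto (fun n => (δ n)⁻¹ • (E n - 1)) atTop (𝓝 A))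
    (hN : Tendsto (fun n => N n * δ n) atTop (𝓝 w)) :
    Tendsto (fun n => E n ^ N n) atTop (𝓝 (NormedSpace.exp (w • A))) := by
  have hd := (hasDerivAt_exp_smul_const A (0 : ℝ))
  have hF : Tendsto (fun n => (δ n)⁻¹ • (NormedSpace.exp (δ n • A) - 1)) atTop (𝓝 A) := by
    have h1 := hd.tendsto_slope_zero
    simp only [zero_smul, NormedSpace.exp_zero, one_mul, zero_add] at h1
    exact h1.comp (tendsto_nhdsWithin_iff.2 ⟨hδ0, hδ.mono fun n h => h.ne'⟩)
  have hlim : Tendsto (fun n => NormedSpace.exp (δ n • A) ^ N n) atTop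
      (𝓝 (NormedSpace.exp (w • A))) := by
    have hc : Continuous fun v : ℝ => NormedSpace.exp (v • A) :=
      continuous_iff_continuousAt.2 fun v => (hasDerivAt_exp_smul_const A v).continuousAt
    refine ((hc.tendsto w).comp hN).congr fun n => ?_
    let : NormedAlgebra ℚ 𝔸 := NormedAlgebra.restrictScalars ℚ ℝ 𝔸
    simp only [Function.comp]
    rw [← NormedSpace.exp_nsmul, mul_smul, Nat.cast_smul_eq_nsmul]
  simpa using (tendsto_pow_sub_pow hδ hE hF hN).add hlim

end PowLimit

/-! ### The filter between and at observed jumps -/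

section Flow

attribute [local instance] Matrix.linftyOpNormedRing Matrix.linftyOpNormedAlgebra

theorem levelInd_mul_of_supp {I O : Type*} [DecidableEq O] {h : I → O} {a : O} {x : I → ℝ} (hx : ∀ i, h i ≠ a → x i = 0) :
    levelInd h a * x = x := by
  ext i
  by_cases hi : h i = a
  · simp [levelInd, hi]
  · simp [levelInd, hi, hx i hi]

variable {I O : Type*} [Fintype I]

/-- Division of a vector by its total mass (the zero vector if the total mass vanishes). -/
noncomputable def normalizeVec (v : I → ℝ) : I → ℝ := (∑ i, v i)⁻¹ • v

theorem normalizeVec_smul {c : ℝ} (hc : c ≠ 0) (v : I → ℝ) :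
    normalizeVec (c • v) = normalizeVec v := by
  have h : ∑ i, (c • v) i = c * ∑ i, v i := by simp [Finset.mul_sum]
  rw [normalizeVec, normalizeVec, h, smul_smul, mul_inv, mul_right_comm, inv_mul_cancel₀ hc,
    one_mul]

theorem normalizeVec_mem_face {h : I → O} {a : O} {v : I → ℝ} (h0 : ∀ i, 0 ≤ v i)
    (hs : ∀ i, h i ≠ a → v i = 0) (hm : 0 < ∑ i, v i) : normalizeVec v ∈ face h a := by
  refine ⟨⟨fun i => mul_nonneg (inv_nonneg.2 hm.le) (h0 i), ?_⟩, fun i hi => ?_⟩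
  · simp only [normalizeVec, Pi.smul_apply, smul_eq_mul, ← Finset.mul_sum]
    exact inv_mul_cancel₀ hm.ne'
  · simp [normalizeVec, hs i hi]

theorem measurable_normalizeVec : Measurable (normalizeVec : (I → ℝ) → I → ℝ) := by
  unfold normalizeVec
  fun_prop

theorem exists_pos_of_mem_stdSimplex {x : I → ℝ} (hx : x ∈ stdSimplex ℝ I) : ∃ i, 0 < x i := by
  by_contra hcon
  push Not at hcon
  have : ∑ i, x i ≤ 0 := Finset.sum_nonpos fun i _ => hcon i
  linarith [hx.2]

variable [DecidableEq O]

theorem dotProduct_levelInd (h : I → O) (a : O) (v : I → ℝ) :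
    v ⬝ᵥ levelInd h a = ∑ i, (levelInd h a * v) i := by
  simp [dotProduct, mul_comm]

theorem condOp_of_ne_zero {h : I → O} (d : O → I → ℝ) {a : O} {v : I → ℝ}
    (hv : v ⬝ᵥ levelInd h a ≠ 0) : condOp h d a v = normalizeVec (levelInd h a * v) := by
  rw [condOp, if_pos hv, dotProduct_levelInd, normalizeVec]

theorem condOp_mem_face {h : I → O} {d : O → I → ℝ} (hd : ∀ a, d a ∈ face h a) {a : O} {v : I → ℝ}
    (hv : ∀ i, h i = a → 0 ≤ v i) : condOp h d a v ∈ face h a := by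
  by_cases h0 : v ⬝ᵥ levelInd h a = 0
  · rw [condOp, if_neg (not_not.2 h0)]; exact hd a
  · rw [condOp_of_ne_zero d h0]
    have hnn : ∀ i, 0 ≤ (levelInd h a * v) i := fun i => by
      by_cases hi : h i = a
      · simpa [levelInd, hi] using hv i hi
      · simp [levelInd, hi]
    refine normalizeVec_mem_face hnn (fun i hi => by simp [levelInd, hi]) ?_
    rw [dotProduct_levelInd] at h0
    exact lt_of_le_of_ne (Finset.sum_nonneg fun i _ => hnn i) (Ne.symm h0)

theorem condOp_of_mem_face {h : I → O} (d : O → I → ℝ) {a : O} {x : I → ℝ} (hx : x ∈ face h a) :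
    condOp h d a x = x := by
  have h1 : x ⬝ᵥ levelInd h a = 1 := by
    rw [dotProduct_levelInd, levelInd_mul_of_supp hx.2, hx.1.2]
  rw [condOp, if_pos (by simp [h1]), h1, levelInd_mul_of_supp hx.2, inv_one, one_smul]

/-- The rate matrix killed outside the level set `h⁻¹(a)`. -/
def levelGen (Λ : Matrix I I ℝ) (h : I → O) (a : O) : Matrix I I ℝ :=
  fun i j => if h i = a ∧ h j = a then Λ i j else 0

theorem levelGen_offDiag {Λ : Matrix I I ℝ} [DecidableEq I] (hΛ : IsRateMatrix Λ) (h : I → O)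
    (a : O) (i j : I) (hij : i ≠ j) : 0 ≤ levelGen Λ h a i j := by
  unfold levelGen
  split_ifs
  · exact hΛ.offDiag_nonneg i j hij
  · exact le_rfl

theorem vecMul_levelGen {h : I → O} (Λ : Matrix I I ℝ) {a : O} {x : I → ℝ}
    (hx : ∀ i, h i ≠ a → x i = 0) : x ᵥ* levelGen Λ h a = levelInd h a * (x ᵥ* Λ) := by
  ext j
  simp only [vecMul, dotProduct, Pi.mul_apply, Finset.mul_sum]
  refine Finset.sum_congr rfl fun i _ => ?_
  by_cases hi : h i = a <;> by_cases hj : h j = a <;> simp [levelGen, levelInd, hi, hj, hx]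

theorem measurable_condOp (h : I → O) (d : O → I → ℝ) (a : O) : Measurable (condOp h d a) := by
  have h1 : Measurable fun v : I → ℝ => v ⬝ᵥ levelInd h a := by
    unfold dotProduct; fun_prop
  have h2 : Measurable fun v : I → ℝ => levelInd h a * v := by
    refine measurable_pi_iff.2 fun i => ?_
    simp only [Pi.mul_apply]; fun_prop
  refine Measurable.ite (h1 (measurableSet_singleton 0).compl) (h1.inv.smul h2) measurable_const

theorem measurable_vecMul (Λ : Matrix I I ℝ) : Measurable fun v : I → ℝ => v ᵥ* Λ := by
  refine measurable_pi_iff.2 fun j => ?_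
  simp only [vecMul, dotProduct]; fun_prop

variable [DecidableEq I]

/-- The unnormalized filter after a time `u` without observed jump in the level `a`, started
from `x`. -/
noncomputable def rawFlow (Λ : Matrix I I ℝ) (h : I → O) (a : O) (u : ℝ) (x : I → ℝ) : I → ℝ :=
  x ᵥ* NormedSpace.exp (u • levelGen Λ h a)

/-- The flow of the vector field `vecField Λ h a` on the face `face h a`: the killed
semigroup, normalized. -/
noncomputable def flow (Λ : Matrix I I ℝ) (h : I → O) (a : O) (u : ℝ) (x : I → ℝ) : I → ℝ :=
  normalizeVec (rawFlow Λ h a u x)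

/-- The killed semigroup acts as the identity outside of its level. -/
theorem exp_levelGen_apply (Λ : Matrix I I ℝ) (h : I → O) {a : O} (u : ℝ) (i : I) {j : I}
    (hj : h j ≠ a) :
    NormedSpace.exp (u • levelGen Λ h a) i j = (1 : Matrix I I ℝ) i j := by
  have h0 : (u • levelGen Λ h a) * diagonal (1 - levelInd h a) = 0 := by
    ext k l
    rw [mul_diagonal]
    by_cases hl : h l = a <;> simp [levelGen, levelInd, hl]
  have h1 := congrFun (congrFun (exp_mul_of_mul_eq_zero h0) i) j
  rw [mul_diagonal] at h1
  simp only [levelInd, Pi.sub_apply, Pi.one_apply, if_neg hj, sub_zero, mul_one] at h1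
  rw [h1, diagonal_apply, one_apply]
  split_ifs with hij
  · subst hij; simp [levelInd, hj]
  · rfl

theorem rawFlow_supp (Λ : Matrix I I ℝ) {h : I → O} {a : O} (u : ℝ) {x : I → ℝ}
    (hx : ∀ i, h i ≠ a → x i = 0) (j : I) (hj : h j ≠ a) : rawFlow Λ h a u x j = 0 := by
  have : rawFlow Λ h a u x j = (x ᵥ* (1 : Matrix I I ℝ)) j := by
    simp only [rawFlow, vecMul, dotProduct, exp_levelGen_apply Λ h u _ hj]
  rw [this, vecMul_one, hx j hj]

theorem rawFlow_zero (Λ : Matrix I I ℝ) (h : I → O) (a : O) (x : I → ℝ) :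
    rawFlow Λ h a 0 x = x := by
  simp [rawFlow, NormedSpace.exp_zero]

theorem rawFlow_add (Λ : Matrix I I ℝ) (h : I → O) (a : O) (u v : ℝ) (x : I → ℝ) :
    rawFlow Λ h a (u + v) x = rawFlow Λ h a v (rawFlow Λ h a u x) := by
  rw [rawFlow, rawFlow, rawFlow, vecMul_vecMul, exp_add_smul]

theorem rawFlow_smul (Λ : Matrix I I ℝ) (h : I → O) (a : O) (u c : ℝ) (x : I → ℝ) :
    rawFlow Λ h a u (c • x) = c • rawFlow Λ h a u x := by
  rw [rawFlow, rawFlow, smul_vecMul]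

theorem hasDerivAt_rawFlow (Λ : Matrix I I ℝ) (h : I → O) (a : O) (u : ℝ) {x : I → ℝ}
    (hx : ∀ i, h i ≠ a → x i = 0) :
    HasDerivAt (fun u => rawFlow Λ h a u x) (levelInd h a * (rawFlow Λ h a u x ᵥ* Λ)) u := by
  rw [← vecMul_levelGen Λ (rawFlow_supp Λ u hx)]
  exact hasDerivAt_vecMul_exp _ x u

theorem flow_zero (Λ : Matrix I I ℝ) {h : I → O} {a : O} {x : I → ℝ} (hx : x ∈ face h a) :
    flow Λ h a 0 x = x := by
  rw [flow, rawFlow_zero, normalizeVec, hx.1.2, inv_one, one_smul]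

section RateMatrix

variable {Λ : Matrix I I ℝ} {h : I → O} {a : O} {u : ℝ}

theorem rawFlow_nonneg (hΛ : IsRateMatrix Λ) (hu : 0 ≤ u) {x : I → ℝ} (hx : ∀ i, 0 ≤ x i) (j : I) :
    0 ≤ rawFlow Λ h a u x j :=
  Finset.sum_nonneg fun i _ =>
    mul_nonneg (hx i) (exp_entry_nonneg (levelGen_offDiag hΛ h a) hu i j)

theorem rawFlow_pos_of_entry (hΛ : IsRateMatrix Λ) (hu : 0 ≤ u) {x : I → ℝ} (hx : ∀ i, 0 ≤ x i)
    {i j : I} (hi : 0 < x i) (hij : 0 < NormedSpace.exp (u • levelGen Λ h a) i j) :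
    0 < rawFlow Λ h a u x j :=
  Finset.sum_pos' (fun i _ =>
    mul_nonneg (hx i) (exp_entry_nonneg (levelGen_offDiag hΛ h a) hu i j))
    ⟨i, Finset.mem_univ i, mul_pos hi hij⟩

theorem rawFlow_pos (hΛ : IsRateMatrix Λ) (hu : 0 ≤ u) {x : I → ℝ} (hx : ∀ i, 0 ≤ x i)
    {i : I} (hi : 0 < x i) : 0 < rawFlow Λ h a u x i :=
  rawFlow_pos_of_entry hΛ hu hx hi (exp_diag_pos (levelGen_offDiag hΛ h a) hu i)

theorem rawFlow_pos_of_rate_pos (hΛ : IsRateMatrix Λ) (hu : 0 < u) {x : I → ℝ}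
    (hx : ∀ i, 0 ≤ x i) {i j : I} (hi : 0 < x i) (hia : h i = a) (hja : h j = a) (hij : i ≠ j)
    (hr : 0 < Λ i j) : 0 < rawFlow Λ h a u x j :=
  rawFlow_pos_of_entry hΛ hu.le hx hi
    (exp_entry_pos (levelGen_offDiag hΛ h a) hu hij (by simpa [levelGen, hia, hja] using hr))

theorem rawFlow_mass_pos (hΛ : IsRateMatrix Λ) (hu : 0 ≤ u) {x : I → ℝ}
    (hx : x ∈ stdSimplex ℝ I) : 0 < ∑ i, rawFlow Λ h a u x i := by
  obtain ⟨i, hi⟩ := exists_pos_of_mem_stdSimplex hx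
  exact Finset.sum_pos' (fun j _ => rawFlow_nonneg hΛ hu hx.1 j)
    ⟨i, Finset.mem_univ i, rawFlow_pos hΛ hu hx.1 hi⟩

theorem flow_mem_face (hΛ : IsRateMatrix Λ) (hu : 0 ≤ u) {x : I → ℝ} (hx : x ∈ face h a) :
    flow Λ h a u x ∈ face h a :=
  normalizeVec_mem_face (rawFlow_nonneg hΛ hu hx.1.1) (rawFlow_supp Λ u hx.2)
    (rawFlow_mass_pos hΛ hu hx.1)

theorem flow_add (hΛ : IsRateMatrix Λ) (hu : 0 ≤ u) (v : ℝ) {x : I → ℝ} (hx : x ∈ face h a) :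
    flow Λ h a (u + v) x = flow Λ h a v (flow Λ h a u x) := by
  have := inv_ne_zero (rawFlow_mass_pos (h := h) (a := a) hΛ hu hx.1).ne'
  conv_rhs => rw [flow, flow, normalizeVec.eq_1 (rawFlow Λ h a u x), rawFlow_smul,
    normalizeVec_smul this, ← rawFlow_add]
  rfl

/-- The normalized killed semigroup solves the filtering equation between observed jumps: the
derivative of the normalizing mass produces the quadratic term of the vector field. -/
theorem hasDerivAt_flow (hΛ : IsRateMatrix Λ) (hu : 0 ≤ u) {x : I → ℝ} (hx : x ∈ face h a) :
    HasDerivAt (fun u => flow Λ h a u x) (vecField Λ h a (flow Λ h a u x)) u := by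
  have hm := (rawFlow_mass_pos (h := h) (a := a) hΛ hu hx.1).ne'
  have h1 := hasDerivAt_rawFlow Λ h a u hx.2
  have h2 : HasDerivAt (fun u => ∑ i, rawFlow Λ h a u x i)
      (∑ i, (levelInd h a * (rawFlow Λ h a u x ᵥ* Λ)) i) u :=
    HasDerivAt.fun_sum fun i _ => (hasDerivAt_pi.1 h1) i
  have h3 := (h2.inv hm).smul h1
  refine h3.congr_deriv ?_
  set q := rawFlow Λ h a u x with hq
  set m := ∑ i, q i
  have hf : flow Λ h a u x = m⁻¹ • q := rfl
  rw [hf, vecField, smul_vecMul, ← dotProduct_levelInd, smul_dotProduct, smul_smul, mul_smul_comm,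
    Pi.inv_apply, smul_eq_mul]
  rw [sub_eq_add_neg, ← neg_smul]
  congr 2
  change -(_) / m ^ 2 = _
  field_simp

end RateMatrix

theorem measurable_flow (Λ : Matrix I I ℝ) (h : I → O) (a : O) :
    Measurable fun z : ℝ × (I → ℝ) => flow Λ h a z.1 z.2 := by
  refine measurable_normalizeVec.comp (measurable_pi_iff.2 fun j => ?_)
  have hc := continuous_exp_smul (levelGen Λ h a)
  have hc' : ∀ i j, Continuous fun u : ℝ => NormedSpace.exp (u • levelGen Λ h a) i j :=
    fun i j => (continuous_apply j).comp ((continuous_apply i).comp hc)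
  simp only [rawFlow, vecMul, dotProduct]
  exact Finset.measurable_sum _ fun i _ => (by fun_prop : Measurable fun z : ℝ × (I → ℝ) => z.2 i).mul
    ((hc' i j).measurable.comp measurable_fst)

/-- The filter at the end of a time interval of length `u` on which the observation has the
value `a`, when its value at the right endpoint is `b`. -/
noncomputable def stepMap (Λ : Matrix I I ℝ) (h : I → O) (d : O → I → ℝ) (a b : O) (u : ℝ)
    (x : I → ℝ) : I → ℝ :=
  if b = a then flow Λ h a u x else condOp h d b (flow Λ h a u x ᵥ* Λ)

/-- At a jump between different levels only off-diagonal rates enter, so the vector to be conditioned is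
nonnegative on the new level. -/
theorem stepMap_mem_face {Λ : Matrix I I ℝ} (hΛ : IsRateMatrix Λ) {h : I → O} {d : O → I → ℝ}
    (hd : ∀ a, d a ∈ face h a) {a : O} (b : O) {u : ℝ} (hu : 0 ≤ u) {x : I → ℝ}
    (hx : x ∈ face h a) : stepMap Λ h d a b u x ∈ face h b := by
  have hf := flow_mem_face hΛ hu hx
  unfold stepMap
  split_ifs with hab
  · rwa [hab]
  · refine condOp_mem_face hd fun j hj => Finset.sum_nonneg fun i _ => ?_
    by_cases hi : h i = a
    · refine mul_nonneg (hf.1.1 i) (hΛ.offDiag_nonneg i j fun hij => hab ?_)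
      rw [← hj, ← hij, hi]
    · rw [hf.2 i hi, zero_mul]

theorem stepMap_add {Λ : Matrix I I ℝ} (hΛ : IsRateMatrix Λ) {h : I → O} (d : O → I → ℝ)
    {a : O} (b : O) {u : ℝ} (hu : 0 ≤ u) (v : ℝ) {x : I → ℝ}
    (hx : x ∈ face h a) :
    stepMap Λ h d a b (u + v) x = stepMap Λ h d a b v (flow Λ h a u x) := by
  unfold stepMap
  rw [flow_add hΛ hu v hx]

theorem measurable_stepMap (Λ : Matrix I I ℝ) (h : I → O) (d : O → I → ℝ) (a b : O) :
    Measurable fun z : ℝ × (I → ℝ) => stepMap Λ h d a b z.1 z.2 := by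
  unfold stepMap
  split_ifs
  · exact measurable_flow Λ h a
  · exact (measurable_condOp h d b).comp ((measurable_vecMul Λ).comp (measurable_flow Λ h a))

end Flow

/-! ### Piecewise constant paths -/

section Paths

variable {I O : Type*}

theorem exists_gt_of_eventually_nhdsGT {Pr : ℝ≥0 → Prop} {t : ℝ≥0} (h : ∀ᶠ s in 𝓝[>] t, Pr s) :
    ∃ s, t < s ∧ ∀ v, t < v → v ≤ s → Pr v := by
  obtain ⟨s, hs, hv⟩ := mem_nhdsGT_iff_exists_Ioc_subset.1 h
  exact ⟨s, hs, fun v h1 h2 => hv ⟨h1, h2⟩⟩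

theorem exists_lt_of_eventually_nhdsLT {Pr : ℝ≥0 → Prop} {t : ℝ≥0} (ht : 0 < t)
    (h : ∀ᶠ s in 𝓝[<] t, Pr s) : ∃ s, s < t ∧ ∀ v, s ≤ v → v < t → Pr v := by
  obtain ⟨l, hl, hv⟩ := (mem_nhdsLT_iff_exists_Ioo_subset' ht).1 h
  obtain ⟨s, hls, hst⟩ := exists_between (show l < t from hl)
  exact ⟨s, hst, fun v h1 h2 => hv ⟨hls.trans_le h1, h2⟩⟩

/-- The path `y` is constant on `[u, s)`. -/
def ConstOn (y : Path O) (u s : ℝ≥0) : Prop := ∀ v, u ≤ v → v < s → X v y = X u y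

theorem ConstOn.mono {y : Path O} {u s u' s' : ℝ≥0} (h : ConstOn y u s) (hu : u ≤ u') (hs : s' ≤ s)
    (hus : u' < s) : ConstOn y u' s' := fun v h1 h2 => by
  rw [h v (hu.trans h1) (h2.trans_le hs), h u' hu hus]

theorem Path.exists_right_const (y : Path O) (t : ℝ≥0) :
    ∃ s, t < s ∧ ∀ v, t ≤ v → v ≤ s → X v y = X t y := by
  obtain ⟨s, hs, hv⟩ := exists_gt_of_eventually_nhdsGT (y.2 t).1
  refine ⟨s, hs, fun v h1 h2 => ?_⟩
  rcases h1.eq_or_lt with rfl | h1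
  · rfl
  · exact hv v h1 h2

theorem Path.exists_left_const (y : Path O) {t : ℝ≥0} (ht : 0 < t) :
    ∃ u, u < t ∧ ConstOn y u t := by
  obtain ⟨i, hi⟩ := (y.2 t).2
  obtain ⟨s, hs, hv⟩ := exists_lt_of_eventually_nhdsLT ht hi
  exact ⟨s, hs, fun v h1 h2 => (hv v h1 h2).trans (hv s le_rfl hs).symm⟩

/-- Induction on `ℝ≥0`: a property that holds at `0`, extends to the right of every point, and passes to
the limit from the left holds everywhere. -/
theorem cadlag_induction {Pr : ℝ≥0 → Prop} (h0 : Pr 0)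
    (hr : ∀ s, Pr s → ∃ s', s < s' ∧ ∀ r, s < r → r ≤ s' → Pr r)
    (hl : ∀ s, 0 < s → (∀ r < s, Pr r) → Pr s) (t : ℝ≥0) : Pr t := by
  by_contra ht
  set S := {t | ¬ Pr t}
  have hne : S.Nonempty := ⟨t, ht⟩
  have hlt : ∀ r < sInf S, Pr r := fun r hr => not_not.1 (notMem_of_lt_csInf' hr)
  have hm : Pr (sInf S) := by
    rcases eq_zero_or_pos (sInf S) with h | h
    · rwa [h]
    · exact hl _ h hlt
  obtain ⟨s', hs', h⟩ := hr _ hm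
  obtain ⟨r, hrS, hrs⟩ := (csInf_lt_iff (OrderBot.bddBelow S) hne).1 hs'
  rcases (csInf_le' hrS).eq_or_lt with h1 | h1
  · exact hrS (h1 ▸ hm)
  · exact hrS (h r h1 hrs.le)

/-- To prove a property of all times, it is enough to prove it at time `0` and to propagate it
from the left to the right endpoint of intervals `[u, s)` of constancy of the path. -/
theorem Path.induction (y : Path O) {Pr : ℝ≥0 → Prop} (h0 : Pr 0)
    (step : ∀ u s, u < s → ConstOn y u s → Pr u → Pr s) (t : ℝ≥0) : Pr t := by
  refine cadlag_induction h0 (fun s hs => ?_) (fun s hs h => ?_) t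
  · obtain ⟨s', h1, h2⟩ := y.exists_right_const s
    exact ⟨s', h1, fun r hr hrs => step s r hr (fun v hv hvr => h2 v hv (hvr.le.trans hrs)) hs⟩
  · obtain ⟨u, hu, huc⟩ := y.exists_left_const hs
    exact step u s hu huc (h u hu)

/-- The image of a path under a map of the state spaces. -/
def Path.map (h : I → O) (ω : Path I) : Path O :=
  ⟨fun t => h (ω.1 t), fun t => ⟨(ω.2 t).1.mono fun _ hs => congrArg h hs,
    (ω.2 t).2.imp' h fun _ hi => hi.mono fun _ hs => congrArg h hs⟩⟩

/-- The shifted path `s ↦ ω (t + s)`. -/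
def Path.shift (t : ℝ≥0) (ω : Path I) : Path I :=
  ⟨fun s => ω.1 (t + s), fun s => by
    have hc : Tendsto (fun r : ℝ≥0 => t + r) (𝓝 s) (𝓝 (t + s)) :=
      (continuous_const.add continuous_id).tendsto s
    have h1 : Tendsto (fun r : ℝ≥0 => t + r) (𝓝[>] s) (𝓝[>] (t + s)) :=
      tendsto_nhdsWithin_of_tendsto_nhds_of_eventually_within _ (hc.mono_left nhdsWithin_le_nhds)
        (eventually_nhdsWithin_of_forall fun r hr => add_lt_add_right hr t)
    have h2 : Tendsto (fun r : ℝ≥0 => t + r) (𝓝[<] s) (𝓝[<] (t + s)) :=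
      tendsto_nhdsWithin_of_tendsto_nhds_of_eventually_within _ (hc.mono_left nhdsWithin_le_nhds)
        (eventually_nhdsWithin_of_forall fun r hr => add_lt_add_right hr t)
    exact ⟨h1.eventually (ω.2 (t + s)).1, (ω.2 (t + s)).2.imp fun i hi => h2.eventually hi⟩⟩

/-- The path stopped at time `t`. -/
def Path.stopped (t : ℝ≥0) (ω : Path I) : Path I :=
  ⟨fun s => ω.1 (min s t), fun s => by
    refine ⟨?_, ?_⟩
    · rcases lt_or_ge s t with hs | hs
      · filter_upwards [(ω.2 s).1, (eventually_lt_nhds hs).filter_mono nhdsWithin_le_nhds] with r h1 h2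
        rw [min_eq_left h2.le, min_eq_left hs.le, h1]
      · filter_upwards [self_mem_nhdsWithin] with r hr
        rw [min_eq_right hs, min_eq_right (hs.trans (le_of_lt hr))]
    · rcases le_or_gt s t with hs | hs
      · refine (ω.2 s).2.imp fun i hi => ?_
        filter_upwards [hi, self_mem_nhdsWithin] with r hr h2
        rw [min_eq_left ((le_of_lt h2).trans hs), hr]
      · refine ⟨ω.1 t, ?_⟩
        filter_upwards [(eventually_gt_nhds hs).filter_mono nhdsWithin_le_nhds] with r h2
        rw [min_eq_right h2.le]⟩

@[simp] theorem X_map (h : I → O) (t : ℝ≥0) (ω : Path I) : X t (ω.map h) = Y h t ω := rfl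

@[simp] theorem X_shift (s t : ℝ≥0) (ω : Path I) : X s (ω.shift t) = X (t + s) ω := rfl

@[simp] theorem X_stopped (s t : ℝ≥0) (ω : Path I) : X s (ω.stopped t) = X (min s t) ω := rfl

end Paths

/-! ### Solving the filtering equation along a path -/

section PiecewiseFlow

variable {I O : Type*} [Fintype I] [DecidableEq I] [DecidableEq O]

/-- The trajectory `p` starts at `x`, follows the flow of the filter while the observed path `y` is
constant, and jumps according to `stepMap` when `y` jumps. -/
structure IsPiecewiseFlow (Λ : Matrix I I ℝ) (h : I → O) (d : O → I → ℝ) (x : I → ℝ) (y : Path O)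
    (p : ℝ≥0 → I → ℝ) : Prop where
  zero : p 0 = x
  step : ∀ u s, u < s → ConstOn y u s →
    p s = stepMap Λ h d (X u y) (X s y) ((s : ℝ) - u) (p u)

variable {Λ : Matrix I I ℝ} {h : I → O} {d : O → I → ℝ} {x : I → ℝ} {y : Path O}
  {p : ℝ≥0 → I → ℝ}

theorem sub_nonneg_of_lt_nnreal {u s : ℝ≥0} (hus : u < s) : (0 : ℝ) ≤ (s : ℝ) - u :=
  sub_nonneg.2 (NNReal.coe_le_coe.2 hus.le)

theorem IsPiecewiseFlow.mem_face (hΛ : IsRateMatrix Λ) (hd : ∀ a, d a ∈ face h a)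
    (hx : x ∈ face h (X 0 y)) (hp : IsPiecewiseFlow Λ h d x y p) (t : ℝ≥0) :
    p t ∈ face h (X t y) := by
  refine y.induction (Pr := fun t => p t ∈ face h (X t y)) ?_ (fun u s hus hc hu => ?_) t
  · rwa [hp.zero]
  · rw [hp.step u s hus hc]
    exact stepMap_mem_face hΛ hd _ (sub_nonneg_of_lt_nnreal hus) hu

/-- Piecewise flows depend only on the past of the observed path. -/
theorem IsPiecewiseFlow.eq_of_eqOn {y' : Path O} {p' : ℝ≥0 → I → ℝ} {t : ℝ≥0}
    (hy : ∀ s ≤ t, X s y = X s y')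
    (hp : IsPiecewiseFlow Λ h d x y p) (hp' : IsPiecewiseFlow Λ h d x y' p') : p t = p' t := by
  refine y.induction (Pr := fun s => s ≤ t → p s = p' s) (fun _ => ?_)
    (fun u s hus hc hu hst => ?_) t le_rfl
  · rw [hp.zero, hp'.zero]
  · have hc' : ConstOn y' u s := fun v h1 h2 => by
      rw [← hy v (h2.le.trans hst), ← hy u (hus.le.trans hst), hc v h1 h2]
    rw [hp.step u s hus hc, hp'.step u s hus hc', hu (hus.le.trans hst), hy s hst,
      hy u (hus.le.trans hst)]

/-- A piecewise flow, seen from time `t` on, is a piecewise flow of the shifted path. -/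
theorem IsPiecewiseFlow.shift (hp : IsPiecewiseFlow Λ h d x y p) (t : ℝ≥0) :
    IsPiecewiseFlow Λ h d (p t) (y.shift t) fun s => p (t + s) := by
  refine ⟨by simp, fun u s hus hc => ?_⟩
  have hc' : ConstOn y (t + u) (t + s) := fun v h1 h2 => by
    obtain ⟨w, rfl⟩ := exists_add_of_le ((le_self_add).trans h1)
    exact hc w (le_of_add_le_add_left h1) (lt_of_add_lt_add_left h2)
  rw [hp.step (t + u) (t + s) (add_lt_add_right hus t) hc']
  simp

/-- Piecewise flows on bounded intervals are extended across intervals of constancy of the path, and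
glued together by uniqueness. -/
theorem exists_isPiecewiseFlow (hΛ : IsRateMatrix Λ) (hd : ∀ a, d a ∈ face h a)
    (hx : x ∈ face h (X 0 y)) : ∃ p, IsPiecewiseFlow Λ h d x y p := by
  let Sol : ℝ≥0 → (ℝ≥0 → I → ℝ) → Prop := fun t p => p 0 = x ∧ (∀ s ≤ t, p s ∈ face h (X s y)) ∧
    ∀ u s, u < s → s ≤ t → ConstOn y u s →
      p s = stepMap Λ h d (X u y) (X s y) ((s : ℝ) - u) (p u)
  have uniq : ∀ {t t' p p'}, Sol t p → Sol t' p' → ∀ s, s ≤ t → s ≤ t' → p s = p' s := by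
    intro t t' p p' hp hp' s
    refine y.induction (Pr := fun s => s ≤ t → s ≤ t' → p s = p' s) (fun _ _ => ?_)
      (fun u s hus hc hu h1 h2 => ?_) s
    · rw [hp.1, hp'.1]
    · rw [hp.2.2 u s hus h1 hc, hp'.2.2 u s hus h2 hc, hu (hus.le.trans h1) (hus.le.trans h2)]
  have exist : ∀ t, ∃ p, Sol t p := by
    refine y.induction ⟨fun _ => x, rfl, fun s hs => ?_, fun u s hus hs => ?_⟩ ?_
    · rwa [nonpos_iff_eq_zero.1 hs]
    · exact absurd (hus.trans_le hs) not_lt_zero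
    rintro u s hus hc ⟨p, hp0, hpf, hps⟩
    refine ⟨fun v => if v ≤ u then p v else stepMap Λ h d (X u y) (X v y) ((v : ℝ) - u) (p u),
      ?_, fun v _ => ?_, fun u' s' hus' hs' hc' => ?_⟩
    · simp [hp0]
    · dsimp only
      split_ifs with hv
      · exact hpf v hv
      · exact stepMap_mem_face hΛ hd _ (sub_nonneg_of_lt_nnreal (not_le.1 hv)) (hpf u le_rfl)
    · dsimp only
      by_cases hs'u : s' ≤ u
      · rw [if_pos hs'u, if_pos (hus'.le.trans hs'u)]
        exact hps u' s' hus' hs'u hc'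
      rw [if_neg hs'u]
      rw [not_le] at hs'u
      by_cases hu'u : u' ≤ u
      · rw [if_pos hu'u]
        rcases hu'u.eq_or_lt with rfl | hlt
        · rfl
        have hy : X u y = X u' y := hc' u hu'u hs'u
        have h1 : p u = flow Λ h (X u' y) ((u : ℝ) - u') (p u') := by
          rw [hps u' u hlt le_rfl (hc'.mono le_rfl hs'u.le hus'), hy, stepMap, if_pos rfl]
        have h2 : (s' : ℝ) - u' = ((u : ℝ) - u') + (s' - u) := by ring
        rw [hy, h1, h2, stepMap_add hΛ d _ (sub_nonneg_of_lt_nnreal hlt) _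
          (hpf u' hu'u)]
      · rw [if_neg hu'u]
        rw [not_le] at hu'u
        have hy : X u' y = X u y := hc u' hu'u.le (hus'.trans_le hs')
        have h1 : stepMap Λ h d (X u y) (X u' y) ((u' : ℝ) - u) (p u)
            = flow Λ h (X u y) ((u' : ℝ) - u) (p u) := by
          rw [stepMap, if_pos hy]
        have h2 : (s' : ℝ) - u = ((u' : ℝ) - u) + (s' - u') := by ring
        rw [h1, h2, stepMap_add hΛ d _ (sub_nonneg_of_lt_nnreal hu'u) _ (hpf u le_rfl), hy]
  choose q hq using exist
  refine ⟨fun t => q t t, (hq 0).1, fun u s hus hc => ?_⟩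
  rw [(hq s).2.2 u s hus le_rfl hc, uniq (hq s) (hq u) u hus.le le_rfl]

end PiecewiseFlow

/-! ### The filtering equation: existence and uniqueness -/

section FilterEquation

variable {I O : Type*} {h : I → O} {ω : Path I}

theorem not_mem_jumpTimes_of_constOn {u s v t : ℝ≥0} (hc : ConstOn (ω.map h) u s) (huv : u < v)
    (hvs : v < s) : v ∉ jumpTimes h ω t := by
  intro hv
  refine hv.2.2 ?_
  filter_upwards [self_mem_nhdsWithin, (eventually_gt_nhds huv).filter_mono nhdsWithin_le_nhds]
    with r h1 h2
  have h3 := hc r h2.le (lt_trans h1 hvs)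
  have h4 := hc v huv.le hvs
  simp only [X_map] at h3 h4
  rw [h3, h4]

/-- After an interval `[u, s)` of constancy, `s` is a jump time exactly if the value at `s` is new. -/
theorem mem_jumpTimes_right_iff {u s : ℝ≥0} (hus : u < s) (hc : ConstOn (ω.map h) u s) :
    s ∈ jumpTimes h ω s ↔ Y h s ω ≠ Y h u ω := by
  have hev : ∀ᶠ r in 𝓝[<] s, Y h r ω = Y h u ω := by
    filter_upwards [self_mem_nhdsWithin, (eventually_gt_nhds hus).filter_mono nhdsWithin_le_nhds]
      with r h1 h2
    exact hc r h2.le h1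
  have : (𝓝[<] s).NeBot := nhdsLT_neBot_of_exists_lt ⟨u, hus⟩
  constructor
  · intro hs heq
    exact hs.2.2 (hev.mono fun r hr => by rw [hr, heq])
  · refine fun hne => ⟨pos_of_gt hus, le_rfl, fun hcon => hne ?_⟩
    obtain ⟨r, h1, h2⟩ := (hev.and hcon).exists
    rw [← h2, h1]

theorem jumpTimes_subset_of_le {u s : ℝ≥0} (hus : u ≤ s) : jumpTimes h ω u ⊆ jumpTimes h ω s :=
  fun _ hv => ⟨hv.1, hv.2.1.trans hus, hv.2.2⟩

/-- The sum over the jumps up to the end `s` of an interval `[u, s)` of constancy. -/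
theorem sum_jumpTimes_of_constOn [DecidableEq O] (f : ℝ≥0 → I → ℝ) {u s : ℝ≥0} (hus : u < s)
    (hc : ConstOn (ω.map h) u s) :
    ∑ v ∈ (jumpTimes_finite h ω s).toFinset, f v
      = (if Y h s ω = Y h u ω then 0 else f s) + ∑ v ∈ (jumpTimes_finite h ω u).toFinset, f v := by
  classical
  have hs : s ∉ (jumpTimes_finite h ω u).toFinset := fun hs =>
    absurd ((Set.Finite.mem_toFinset _).1 hs).2.1 (not_le.2 hus)
  have hcases : ∀ v, v ∈ jumpTimes h ω s → v ≠ s → v ∈ jumpTimes h ω u := by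
    intro v hv hvs
    have hvs' := lt_of_le_of_ne hv.2.1 hvs
    by_cases huv : u < v
    · exact absurd hv (not_mem_jumpTimes_of_constOn hc huv hvs')
    · exact ⟨hv.1, not_lt.1 huv, hv.2.2⟩
  have hiff := mem_jumpTimes_right_iff hus hc
  split_ifs with heq
  · rw [zero_add]
    refine Finset.sum_congr (Finset.ext fun v => ?_) fun _ _ => rfl
    simp only [Set.Finite.mem_toFinset]
    refine ⟨fun hv => hcases v hv ?_, fun hv => jumpTimes_subset_of_le hus.le hv⟩
    rintro rfl
    exact hiff.1 hv heq
  · rw [← Finset.sum_insert hs]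
    refine Finset.sum_congr (Finset.ext fun v => ?_) fun _ _ => rfl
    simp only [Set.Finite.mem_toFinset, Finset.mem_insert]
    refine ⟨fun hv => or_iff_not_imp_left.2 (hcases v hv), ?_⟩
    rintro (rfl | hv)
    · exact hiff.2 heq
    · exact jumpTimes_subset_of_le hus.le hv

variable [Fintype I] [DecidableEq O] {Λ : Matrix I I ℝ} {d : O → I → ℝ} {x : I → ℝ}
  {p q : ℝ≥0 → I → ℝ}

theorem continuous_vecField (a : O) : Continuous (vecField Λ h a) := by
  unfold vecField
  refine continuous_pi fun i => ?_
  simp only [Pi.sub_apply, Pi.mul_apply, Pi.smul_apply, vecMul, dotProduct, smul_eq_mul]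
  fun_prop

theorem contDiff_vecField (a : O) : ContDiff ℝ 1 (vecField Λ h a) := by
  unfold vecField
  refine contDiff_pi.2 fun i => ?_
  simp only [Pi.sub_apply, Pi.mul_apply, Pi.smul_apply, vecMul, dotProduct, smul_eq_mul]
  fun_prop

/-- Two solutions of the equation that agree at time `s` agree on a right neighbourhood of `s`:
there the distance of the two solutions is at most half of its supremum. -/
theorem eq_right_of_integral_eq {F : (I → ℝ) → I → ℝ} (hF : ContDiff ℝ 1 F) {s t : ℝ≥0}
    (hst : s < t) (hp : ContinuousWithinAt p (Set.Ioi s) s)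
    (hq : ContinuousWithinAt q (Set.Ioi s) s) (hs : p s = q s)
    (hpq : ∀ r, s ≤ r → r ≤ t →
      p r - q r = ∫ v in (s : ℝ)..r, (F (p v.toNNReal) - F (q v.toNNReal))) :
    ∃ s', s < s' ∧ ∀ r, s < r → r ≤ s' → p r = q r := by
  obtain ⟨K, U, hU, hK⟩ := (hF.contDiffAt (x := p s)).exists_lipschitzOnWith
  have hpU : ∀ᶠ r in 𝓝[>] s, p r ∈ U := hp.eventually hU
  have hqU : ∀ᶠ r in 𝓝[>] s, q r ∈ U := hq.eventually (hs ▸ hU)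
  have hb : ∀ᶠ r in 𝓝[>] s, ‖p r - q r‖ ≤ 1 := by
    have : Tendsto (fun r => ‖p r - q r‖) (𝓝[>] s) (𝓝 0) := by
      simpa [hs] using (Tendsto.sub hp hq).norm
    exact this.eventually (ge_mem_nhds one_pos)
  have hsm : ∀ᶠ r : ℝ≥0 in 𝓝[>] s, K * ((r : ℝ) - s) ≤ 1 / 2 := by
    have : Tendsto (fun r : ℝ≥0 => (K : ℝ) * ((r : ℝ) - s)) (𝓝[>] s) (𝓝 (K * ((s : ℝ) - s))) :=
      ((by fun_prop : Continuous fun r : ℝ≥0 => (K : ℝ) * ((r : ℝ) - s)).tendsto s).mono_left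
        nhdsWithin_le_nhds
    rw [sub_self, mul_zero] at this
    exact this.eventually (ge_mem_nhds (by norm_num))
  have hle : ∀ᶠ r in 𝓝[>] s, r ≤ t :=
    (eventually_le_nhds hst).filter_mono nhdsWithin_le_nhds
  obtain ⟨s', hs', hall⟩ := exists_gt_of_eventually_nhdsGT
    (hpU.and (hqU.and (hb.and (hsm.and hle))))
  -- each use of the integral equation gains a factor `1 / 2`
  have hhalf : ∀ n : ℕ, ∀ r, s < r → r ≤ s' → ‖p r - q r‖ ≤ (1 / 2) ^ n := by
    intro n
    induction n with
    | zero => intro r h1 h2; simpa using (hall r h1 h2).2.2.1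
    | succ n ih =>
      intro r h1 h2
      obtain ⟨-, -, -, hr4, hr5⟩ := hall r h1 h2
      have hsr : (s : ℝ) ≤ r := NNReal.coe_le_coe.2 h1.le
      rw [hpq r h1.le hr5]
      have hbound : ∀ v ∈ Set.uIoc (s : ℝ) r,
          ‖F (p v.toNNReal) - F (q v.toNNReal)‖ ≤ K * (1 / 2) ^ n := by
        intro v hv
        rw [Set.uIoc_of_le hsr] at hv
        have hv1 : s < v.toNNReal := by
          rw [← NNReal.coe_lt_coe, Real.coe_toNNReal _ (s.2.trans hv.1.le)]; exact hv.1
        have hv2 : v.toNNReal ≤ s' := by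
          refine le_trans ?_ h2
          rw [← NNReal.coe_le_coe, Real.coe_toNNReal _ (s.2.trans hv.1.le)]; exact hv.2
        obtain ⟨hv3, hv4, -⟩ := hall _ hv1 hv2
        exact (hK.norm_sub_le hv3 hv4).trans (by gcongr; exact ih _ hv1 hv2)
      refine (intervalIntegral.norm_integral_le_of_norm_le_const hbound).trans ?_
      rw [abs_of_nonneg (by linarith), pow_succ]
      have : (0 : ℝ) ≤ (1 / 2) ^ n := by positivity
      nlinarith
  refine ⟨s', hs', fun r h1 h2 => sub_eq_zero.1 (norm_le_zero_iff.1 ?_)⟩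
  exact ge_of_tendsto' (tendsto_pow_atTop_nhds_zero_of_lt_one (by norm_num) (by norm_num))
    fun n => hhalf n r h1 h2

/-- Uniqueness for the filtering equation, without restriction on the values of the solutions. -/
theorem IsFilterSolution.eq (hp : IsFilterSolution Λ h d x ω p)
    (hq : IsFilterSolution Λ h d x ω q) : p = q := by
  funext t
  refine cadlag_induction (Pr := fun t => p t = q t) ?_ (fun s hs => ?_) (fun s hs hlt => ?_) t
  · have h0 : jumpTimes h ω 0 = ∅ := Set.eq_empty_of_forall_notMem fun v hv =>
      absurd (hv.1.trans_le hv.2.1) (lt_irrefl _)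
    rw [hp.equation 0, hq.equation 0]
    simp [h0]
  · obtain ⟨t, hst, hc⟩ := (ω.map h).exists_right_const s
    refine eq_right_of_integral_eq (contDiff_vecField (Λ := Λ) (h := h) (Y h s ω)) hst
      (hp.right_cont s) (hq.right_cont s) hs fun r h1 h2 => ?_
    rcases h1.eq_or_lt with rfl | hsr
    · simp [hs]
    have hcr : ConstOn (ω.map h) s r := fun v hv1 hv2 => hc v hv1 (hv2.le.trans h2)
    have hYr : Y h r ω = Y h s ω := hc r h1 h2
    have incr : ∀ {p}, IsFilterSolution Λ h d x ω p →
        IntervalIntegrable (fun v : ℝ => vecField Λ h (Y h s ω) (p v.toNNReal)) volume s r ∧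
        p r = p s + ∫ v in (s : ℝ)..r, vecField Λ h (Y h s ω) (p v.toNNReal) := by
      intro p hp
      have hsr' : (s : ℝ) ≤ r := NNReal.coe_le_coe.2 h1
      have hI := (hp.intervalIntegrable s).symm.trans (hp.intervalIntegrable r)
      have hcongr : Set.EqOn (fun v : ℝ => vecField Λ h (Y h v.toNNReal ω) (p v.toNNReal))
          (fun v : ℝ => vecField Λ h (Y h s ω) (p v.toNNReal)) (Set.uIoc (s : ℝ) r) := by
        intro v hv
        rw [Set.uIoc_of_le hsr'] at hv
        have hv1 : s ≤ v.toNNReal := by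
          rw [← NNReal.coe_le_coe, Real.coe_toNNReal _ (s.2.trans hv.1.le)]; exact hv.1.le
        have hv2 : v.toNNReal ≤ t := by
          refine le_trans ?_ h2
          rw [← NNReal.coe_le_coe, Real.coe_toNNReal _ (s.2.trans hv.1.le)]; exact hv.2
        have hY : Y h v.toNNReal ω = Y h s ω := hc _ hv1 hv2
        simp only [hY]
      refine ⟨hI.congr hcongr, ?_⟩
      rw [hp.equation r, hp.equation s, sum_jumpTimes_of_constOn _ hsr hcr, if_pos hYr, zero_add,
        ← intervalIntegral.integral_congr_ae (ae_of_all _ fun v hv => hcongr hv),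
        ← intervalIntegral.integral_add_adjacent_intervals (hp.intervalIntegrable s) hI]
      abel
    obtain ⟨hpi, hpe⟩ := incr hp
    obtain ⟨hqi, hqe⟩ := incr hq
    rw [intervalIntegral.integral_sub hpi hqi, hpe, hqe, hs]
    abel
  · obtain ⟨u, hu, huc⟩ := (ω.map h).exists_left_const hs
    have hll : ∀ v, 0 < v → v ≤ s → Function.leftLim p v = Function.leftLim q v := by
      intro v hv hvs
      have : (𝓝[<] v).NeBot := nhdsLT_neBot_of_exists_lt ⟨0, hv⟩
      obtain ⟨l, hl⟩ := hp.left_lim v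
      rw [leftLim_eq_of_tendsto hl]
      refine (leftLim_eq_of_tendsto (hl.congr' ?_)).symm
      filter_upwards [self_mem_nhdsWithin] with r hr
      exact hlt r (lt_of_lt_of_le hr hvs)
    rw [hp.equation s, hq.equation s]
    congr 1
    · congr 1
      refine intervalIntegral.integral_congr_ae ?_
      have hne : ∀ᵐ v : ℝ, v ≠ s := by simp [ae_iff]
      filter_upwards [hne] with v hvs hv
      rw [Set.uIoc_of_le s.coe_nonneg] at hv
      have : v.toNNReal < s := by
        rw [← NNReal.coe_lt_coe, Real.coe_toNNReal _ hv.1.le]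
        exact lt_of_le_of_ne hv.2 hvs
      rw [hlt _ this]
    · refine Finset.sum_congr rfl fun v hv => ?_
      rw [Set.Finite.mem_toFinset] at hv
      rw [hll v hv.1 hv.2.1]

variable [DecidableEq I]

theorem IsPiecewiseFlow.eq_flow {y : Path O} (hp : IsPiecewiseFlow Λ h d x y p) {u s v : ℝ≥0}
    (hc : ConstOn y u s) (hu : p u ∈ face h (X u y)) (huv : u ≤ v) (hvs : v < s) :
    p v = flow Λ h (X u y) ((v : ℝ) - u) (p u) := by
  rcases huv.eq_or_lt with rfl | huv
  · rw [sub_self, flow_zero Λ hu]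
  · rw [hp.step u v huv (hc.mono le_rfl hvs.le (huv.trans hvs)), stepMap, if_pos (hc v huv.le hvs)]

theorem tendsto_flow_sub (hΛ : IsRateMatrix Λ) {a : O} (hx : x ∈ face h a) {u s : ℝ≥0}
    (hus : u ≤ s) {S : Set ℝ≥0} :
    Tendsto (fun v : ℝ≥0 => flow Λ h a ((v : ℝ) - u) x) (𝓝[S] s)
      (𝓝 (flow Λ h a ((s : ℝ) - u) x)) := by
  have h1 := (hasDerivAt_flow hΛ (sub_nonneg.2 (NNReal.coe_le_coe.2 hus)) hx).continuousAt
  have h2 : Tendsto (fun v : ℝ≥0 => (v : ℝ) - u) (𝓝 s) (𝓝 ((s : ℝ) - u)) :=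
    (by fun_prop : Continuous fun v : ℝ≥0 => (v : ℝ) - u).tendsto s
  exact (h1.tendsto.comp h2).mono_left nhdsWithin_le_nhds

theorem IsPiecewiseFlow.tendsto_left {y : Path O} (hΛ : IsRateMatrix Λ)
    (hp : IsPiecewiseFlow Λ h d x y p) {u s : ℝ≥0}
    (hus : u < s) (hc : ConstOn y u s) (hu : p u ∈ face h (X u y)) :
    Tendsto p (𝓝[<] s) (𝓝 (flow Λ h (X u y) ((s : ℝ) - u) (p u))) := by
  refine (tendsto_flow_sub hΛ hu hus.le).congr' ?_
  filter_upwards [self_mem_nhdsWithin, (eventually_gt_nhds hus).filter_mono nhdsWithin_le_nhds]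
    with r h1 h2
  exact (hp.eq_flow hc hu h2.le h1).symm

/-- The fundamental theorem of calculus on an interval of constancy. The value at the right endpoint,
where the path may jump, does not affect the integral. -/
theorem IsPiecewiseFlow.integral_eq (hΛ : IsRateMatrix Λ)
    (hp : IsPiecewiseFlow Λ h d x (ω.map h) p) {u s : ℝ≥0}
    (hus : u < s) (hc : ConstOn (ω.map h) u s) (hu : p u ∈ face h (Y h u ω)) :
    IntervalIntegrable (fun v : ℝ => vecField Λ h (Y h v.toNNReal ω) (p v.toNNReal)) volume u s ∧
      ∫ v in (u : ℝ)..s, vecField Λ h (Y h v.toNNReal ω) (p v.toNNReal)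
        = flow Λ h (Y h u ω) ((s : ℝ) - u) (p u) - p u := by
  have hus' : (u : ℝ) ≤ s := NNReal.coe_le_coe.2 hus.le
  set f : ℝ → I → ℝ := fun v => flow Λ h (Y h u ω) (v - u) (p u) with hf
  have hderiv : ∀ v ∈ Set.uIcc (u : ℝ) s, HasDerivAt f (vecField Λ h (Y h u ω) (f v)) v := by
    intro v hv
    rw [Set.uIcc_of_le hus'] at hv
    exact (hasDerivAt_flow hΛ (sub_nonneg.2 hv.1) hu).comp_sub_const v u
  have hint : IntervalIntegrable (fun v => vecField Λ h (Y h u ω) (f v)) volume u s :=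
    ContinuousOn.intervalIntegrable ((continuous_vecField _).comp_continuousOn
      fun v hv => (hderiv v hv).continuousAt.continuousWithinAt)
  have hcongr : ∀ᵐ v : ℝ, v ∈ Set.uIoc (u : ℝ) s → vecField Λ h (Y h u ω) (f v) =
      vecField Λ h (Y h v.toNNReal ω) (p v.toNNReal) := by
    have hne : ∀ᵐ v : ℝ, v ≠ s := by simp [ae_iff]
    filter_upwards [hne] with v hvs hv
    rw [Set.uIoc_of_le hus'] at hv
    have hv0 := Real.coe_toNNReal v (u.2.trans hv.1.le)
    have h1 : u ≤ v.toNNReal := by rw [← NNReal.coe_le_coe, hv0]; exact hv.1.le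
    have h2 : v.toNNReal < s := by
      rw [← NNReal.coe_lt_coe, hv0]; exact lt_of_le_of_ne hv.2 hvs
    have hY : Y h v.toNNReal ω = Y h u ω := hc _ h1 h2
    rw [hp.eq_flow hc hu h1 h2, hY, hv0]
    rfl
  refine ⟨hint.congr_ae ((ae_restrict_iff' measurableSet_uIoc).2 hcongr), ?_⟩
  rw [← intervalIntegral.integral_congr_ae hcongr,
    intervalIntegral.integral_eq_sub_of_hasDerivAt hderiv hint, hf]
  simp only [sub_self]
  rw [flow_zero Λ hu]

/-- Piecewise flows solve the filtering equation. -/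
theorem IsPiecewiseFlow.isFilterSolution (hΛ : IsRateMatrix Λ) (hd : ∀ a, d a ∈ face h a)
    (hx : x ∈ face h (Y h 0 ω)) (hp : IsPiecewiseFlow Λ h d x (ω.map h) p) :
    IsFilterSolution Λ h d x ω p := by
  have hmem : ∀ t, p t ∈ face h (Y h t ω) := hp.mem_face hΛ hd hx
  have hI : ∀ t : ℝ≥0, IntervalIntegrable
      (fun s : ℝ => vecField Λ h (Y h s.toNNReal ω) (p s.toNNReal)) volume 0 t := by
    refine (ω.map h).induction (by simp) fun u s hus hc hu => ?_
    exact hu.trans (hp.integral_eq hΛ hus hc (hmem u)).1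
  refine ⟨fun t => ?_, fun t => ?_, hI, ?_⟩
  · obtain ⟨s, hs, hc⟩ := (ω.map h).exists_right_const t
    have hc' : ConstOn (ω.map h) t s := fun v h1 h2 => hc v h1 h2.le
    have h1 := tendsto_flow_sub (S := Set.Ioi t) hΛ (hmem t) (le_refl t)
    rw [sub_self, flow_zero Λ (hmem t)] at h1
    refine h1.congr' ?_
    filter_upwards [self_mem_nhdsWithin, (eventually_lt_nhds hs).filter_mono nhdsWithin_le_nhds]
      with r h2 h3
    exact (hp.eq_flow hc' (hmem t) (le_of_lt h2) h3).symm
  · rcases eq_zero_or_pos t with rfl | ht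
    · refine ⟨0, ?_⟩
      have : (𝓝[<] (0 : ℝ≥0)) = ⊥ := by
        rw [show Set.Iio (0 : ℝ≥0) = ∅ from Set.eq_empty_of_forall_notMem fun v hv =>
          not_lt_zero (show v < 0 from hv),
          nhdsWithin_empty]
      rw [this]
      exact tendsto_bot
    · obtain ⟨u, hut, hc⟩ := (ω.map h).exists_left_const ht
      exact ⟨_, hp.tendsto_left hΛ hut hc (hmem u)⟩
  · refine (ω.map h).induction ?_ fun u s hus hc hu => ?_
    · have h0 : jumpTimes h ω 0 = ∅ := Set.eq_empty_of_forall_notMem fun v hv =>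
        absurd (hv.1.trans_le hv.2.1) (lt_irrefl _)
      simp [h0, hp.zero]
    · obtain ⟨hi, he⟩ := hp.integral_eq hΛ hus hc (hmem u)
      have hne : (𝓝[<] s).NeBot := nhdsLT_neBot_of_exists_lt ⟨u, hus⟩
      have hll := leftLim_eq_of_tendsto (hp.tendsto_left hΛ hus hc (hmem u))
      have hstep := hp.step u s hus hc
      simp only [X_map] at hll hstep
      rw [sum_jumpTimes_of_constOn _ hus hc,
        ← intervalIntegral.integral_add_adjacent_intervals (hI u) hi, he, hll, hstep, stepMap]
      split_ifs
      · rw [hu]; abel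
      · rw [hu]; abel

theorem filterProcess_eq (hΛ : IsRateMatrix Λ) (hd : ∀ a, d a ∈ face h a) {μ : I → ℝ}
    (hμ : condOp h d (Y h 0 ω) μ ∈ face h (Y h 0 ω))
    (hp : IsPiecewiseFlow Λ h d (condOp h d (Y h 0 ω) μ) (ω.map h) p) (t : ℝ≥0) :
    filterProcess Λ h d μ t ω = p t := by
  have hs := hp.isFilterSolution hΛ hd hμ
  exact congrFun (IsFilterSolution.eq (Classical.epsilon_spec ⟨p, hs⟩) hs) t

end FilterEquation

/-! ### Measurability on the path space -/

section PathMeasurability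

variable {α I O : Type*}

/-- A map into the path space is measurable if its evaluations are, for the discrete `σ`-algebra on the
state space. -/
theorem measurable_path {m : MeasurableSpace α} {f : α → Path I}
    (hf : ∀ t (B : Set I), MeasurableSet ((fun a => X t (f a)) ⁻¹' B)) : Measurable f := by
  rw [measurable_iff_comap_le]
  change MeasurableSpace.comap f (⨆ s : ℝ≥0, MeasurableSpace.comap (X s) ⊤) ≤ m
  rw [MeasurableSpace.comap_iSup]
  refine iSup_le fun s => ?_
  rw [MeasurableSpace.comap_comp]
  rintro _ ⟨B, -, rfl⟩
  exact hf s B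

theorem measurableSet_X_preimage (t : ℝ≥0) (B : Set I) : MeasurableSet (X t ⁻¹' B) :=
  le_iSup (fun s : ℝ≥0 => MeasurableSpace.comap (X (I := I) s) ⊤) t _ ⟨B, trivial, rfl⟩

theorem measurable_X [MeasurableSpace I] (t : ℝ≥0) : Measurable (X t : Path I → I) :=
  fun B _ => measurableSet_X_preimage t B

theorem measurableSet_stateFiltration {s t : ℝ≥0} (hst : s ≤ t) (B : Set I) :
    MeasurableSet[stateFiltration I t] (X s ⁻¹' B) :=
  le_iSup₂ (f := fun s (_ : s ≤ t) => MeasurableSpace.comap (X (I := I) s) ⊤) s hst _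
    ⟨B, trivial, rfl⟩

theorem measurableSet_obsFiltration (h : I → O) {s t : ℝ≥0} (hst : s ≤ t) (B : Set O) :
    MeasurableSet[obsFiltration h t] (Y h s ⁻¹' B) :=
  le_iSup₂ (f := fun s (_ : s ≤ t) => MeasurableSpace.comap (Y h s) ⊤) s hst _
    ⟨B, trivial, rfl⟩

theorem obsFiltration_le_stateFiltration (h : I → O) (t : ℝ≥0) :
    obsFiltration h t ≤ stateFiltration I t := by
  refine iSup₂_le fun s hs => ?_
  rintro _ ⟨B, -, rfl⟩
  exact measurableSet_stateFiltration hs (h ⁻¹' B)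

theorem measurable_shift (t : ℝ≥0) : Measurable (Path.shift t : Path I → Path I) :=
  measurable_path fun s B => measurableSet_X_preimage (t + s) B

theorem measurable_map (h : I → O) : Measurable (Path.map h : Path I → Path O) :=
  measurable_path fun s B => measurableSet_X_preimage s (h ⁻¹' B)

theorem measurable_map_stopped (h : I → O) (t : ℝ≥0) :
    Measurable[obsFiltration h t] fun ω : Path I => (ω.map h).stopped t :=
  measurable_path (m := obsFiltration h t) fun s B =>
    measurableSet_obsFiltration h (min_le_right s t) B

/-- Right-continuity, for sequences of times that approach `t` from the right. -/
theorem Path.eventually_eq_of_tendsto (y : Path O) {t : ℝ≥0} {s : ℕ → ℝ≥0}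
    (hs : Tendsto s atTop (𝓝 t)) (hts : ∀ᶠ n in atTop, t ≤ s n) :
    ∀ᶠ n in atTop, X (s n) y = X t y := by
  obtain ⟨t', ht', hc⟩ := y.exists_right_const t
  filter_upwards [hs.eventually (eventually_le_nhds ht'), hts] with n h1 h2
  exact hc _ h2 h1

theorem tendsto_floor_add_one_div (t : ℝ≥0) :
    Tendsto (fun n : ℕ => ((⌊(n + 1) * t⌋₊ + 1 : ℕ) : ℝ≥0) / (n + 1)) atTop (𝓝 t) := by
  have h1 : Tendsto (fun n : ℕ => t + 1 / ((n : ℝ≥0) + 1)) atTop (𝓝 (t + 0)) :=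
    tendsto_const_nhds.add tendsto_one_div_add_atTop_nhds_zero_nat
  rw [add_zero] at h1
  refine tendsto_of_tendsto_of_tendsto_of_le_of_le tendsto_const_nhds h1 (fun n => ?_) fun n => ?_
  · have hn : (0 : ℝ≥0) < n + 1 := by positivity
    change t ≤ _
    rw [le_div_iff₀ hn, mul_comm]
    push_cast
    exact (Nat.lt_floor_add_one _).le
  · have hn : (0 : ℝ≥0) < n + 1 := by positivity
    change _ ≤ t + 1 / ((n : ℝ≥0) + 1)
    rw [div_le_iff₀ hn, add_mul t, one_div, inv_mul_cancel₀ hn.ne', mul_comm t]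
    push_cast
    gcongr
    exact Nat.floor_le zero_le

/-- Right-continuity makes the evaluation jointly measurable. -/
theorem measurable_eval [Countable O] [MeasurableSpace O] [DiscreteMeasurableSpace O] :
    Measurable fun z : ℝ≥0 × Path O => X z.1 z.2 := by
  classical
  refine measurable_to_countable' fun a => ?_
  let σ : ℕ → ℝ≥0 → ℝ≥0 := fun n t => ((⌊(n + 1) * t⌋₊ + 1 : ℕ) : ℝ≥0) / (n + 1)
  have hmeas : ∀ n : ℕ, Measurable fun z : ℝ≥0 × Path O =>
      if X (σ n z.1) z.2 = a then (1 : ℝ) else 0 := by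
    intro n
    have h1 : Measurable fun z : ℕ × Path O =>
        if X (((z.1 + 1 : ℕ) : ℝ≥0) / (n + 1)) z.2 = a then (1 : ℝ) else 0 :=
      measurable_from_prod_countable_right fun k =>
        Measurable.ite (measurableSet_X_preimage (((k + 1 : ℕ) : ℝ≥0) / (n + 1)) {a})
          measurable_const measurable_const
    have h2 : Measurable fun z : ℝ≥0 × Path O => (⌊(n + 1) * z.1⌋₊, z.2) :=
      (Nat.measurable_floor.comp (by fun_prop)).prodMk measurable_snd
    exact h1.comp h2
  have hlim : Measurable fun z : ℝ≥0 × Path O => if X z.1 z.2 = a then (1 : ℝ) else 0 := by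
    refine measurable_of_tendsto_metrizable hmeas (tendsto_pi_nhds.2 fun z => ?_)
    have hev := z.2.eventually_eq_of_tendsto (tendsto_floor_add_one_div z.1)
      (Eventually.of_forall fun n => by
        rw [le_div_iff₀ (by positivity), mul_comm]
        push_cast
        exact (Nat.lt_floor_add_one _).le)
    refine tendsto_const_nhds.congr' ?_
    filter_upwards [hev] with n hn
    simp only [σ, hn]
  have : (fun z : ℝ≥0 × Path O => X z.1 z.2) ⁻¹' {a}
      = (fun z : ℝ≥0 × Path O => if X z.1 z.2 = a then (1 : ℝ) else 0) ⁻¹' {1} := by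
    ext z; simp
  rw [this]
  exact hlim (measurableSet_singleton 1)

/-- The first time after `σ` at which the path differs from its value at `σ`, or `t` if that is
smaller. The point `t` keeps the set nonempty, so that its infimum is not a junk value. -/
noncomputable def nextJump (t σ : ℝ≥0) (y : Path O) : ℝ≥0 :=
  sInf ({s | σ < s ∧ X s y ≠ X σ y} ∪ {t})

theorem nextJump_le (t σ : ℝ≥0) (y : Path O) : nextJump t σ y ≤ t :=
  csInf_le' (Or.inr rfl)

theorem le_nextJump {t σ r : ℝ≥0} {y : Path O} (hrt : r ≤ t) (hc : ConstOn y σ r) :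
    r ≤ nextJump t σ y := by
  refine le_csInf ⟨t, Or.inr rfl⟩ ?_
  rintro s (⟨h1, h2⟩ | rfl)
  · by_contra hs
    exact h2 (hc s h1.le (not_le.1 hs))
  · exact hrt

theorem constOn_nextJump (t σ : ℝ≥0) (y : Path O) : ConstOn y σ (nextJump t σ y) := by
  intro v h1 h2
  rcases h1.eq_or_lt with rfl | h1
  · rfl
  by_contra hne
  exact absurd (csInf_le' (show v ∈ {s | σ < s ∧ X s y ≠ X σ y} ∪ {t} from Or.inl ⟨h1, hne⟩))
    (not_le.2 h2)

theorem measurable_nextJump [Countable O] [MeasurableSpace O] [DiscreteMeasurableSpace O]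
    (t : ℝ≥0) : Measurable fun z : ℝ≥0 × Path O => nextJump t z.1 z.2 := by
  refine measurable_of_Iio fun c => ?_
  obtain ⟨D, hDc, hD⟩ := TopologicalSpace.exists_countable_dense ℝ≥0
  have hset : (fun z : ℝ≥0 × Path O => nextJump t z.1 z.2) ⁻¹' Set.Iio c
      = {z | t < c} ∪ ⋃ r ∈ D, {z | r < c ∧ z.1 < r ∧ X r z.2 ≠ X z.1 z.2} := by
    ext ⟨σ, y⟩
    simp only [Set.mem_preimage, Set.mem_Iio, Set.mem_union, Set.mem_iUnion, Set.mem_ofPred_eq,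
      exists_prop]
    constructor
    · intro hlt
      obtain ⟨s, hs, hsc⟩ := (csInf_lt_iff (OrderBot.bddBelow _) ⟨t, Or.inr rfl⟩).1 hlt
      rcases hs with ⟨h1, h2⟩ | rfl
      · obtain ⟨s', hs', hc⟩ := y.exists_right_const s
        obtain ⟨r, hrD, hr1, hr2⟩ := hD.exists_between (lt_min hs' hsc)
        refine Or.inr ⟨r, hrD, hr2.trans_le (min_le_right _ _), h1.trans hr1, ?_⟩
        rw [hc r hr1.le (hr2.le.trans (min_le_left _ _))]
        exact h2
      · exact Or.inl hsc
    · rintro (htc | ⟨r, -, h1, h2, h3⟩)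
      · exact (nextJump_le t σ y).trans_lt htc
      · exact (csInf_le' (show r ∈ {s | σ < s ∧ X s y ≠ X σ y} ∪ {t} from
          Or.inl ⟨h2, h3⟩)).trans_lt h1
  rw [hset]
  refine (MeasurableSet.const _).union (MeasurableSet.biUnion hDc fun r _ => ?_)
  refine (MeasurableSet.const _).inter ((measurableSet_lt measurable_fst measurable_const).inter ?_)
  exact (measurableSet_eq_fun ((measurable_X r).comp measurable_snd) measurable_eval).compl

/-- The successive jump times of a path, truncated at `t`. -/
noncomputable def jumpSeq (t : ℝ≥0) (y : Path O) : ℕ → ℝ≥0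
  | 0 => 0
  | n + 1 => nextJump t (jumpSeq t y n) y

theorem jumpSeq_le (t : ℝ≥0) (y : Path O) (n : ℕ) : jumpSeq t y n ≤ t := by
  cases n with
  | zero => exact zero_le
  | succ n => exact nextJump_le _ _ _

theorem jumpSeq_le_succ (t : ℝ≥0) (y : Path O) (n : ℕ) :
    jumpSeq t y n ≤ jumpSeq t y (n + 1) :=
  le_nextJump (jumpSeq_le t y n) fun _ h1 h2 => absurd h2 (not_lt.2 h1)

/-- There are only finitely many jumps before `t`, so the truncated sequence of jump times reaches `t`. -/
theorem eventually_jumpSeq_eq (t : ℝ≥0) (y : Path O) : ∀ᶠ n in atTop, jumpSeq t y n = t := by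
  have h1 : ∃ n, t ≤ jumpSeq t y n := by
    refine y.induction (Pr := fun s => s ≤ t → ∃ n, s ≤ jumpSeq t y n) (fun _ => ⟨0, zero_le⟩)
      (fun u s hus hc hu hst => ?_) t le_rfl
    obtain ⟨n, hn⟩ := hu (hus.le.trans hst)
    rcases le_or_gt s (jumpSeq t y n) with h | h
    · exact ⟨n, h⟩
    · exact ⟨n + 1, le_nextJump hst (hc.mono hn le_rfl h)⟩
  obtain ⟨n, hn⟩ := h1
  filter_upwards [eventually_ge_atTop n] with m hm
  exact le_antisymm (jumpSeq_le t y m) (hn.trans (monotone_nat_of_le_succ (jumpSeq_le_succ t y) hm))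

theorem measurable_jumpSeq [Countable O] [MeasurableSpace O] [DiscreteMeasurableSpace O]
    (t : ℝ≥0) (n : ℕ) : Measurable fun y : Path O => jumpSeq t y n := by
  induction n with
  | zero => exact measurable_const
  | succ n ih => exact (measurable_nextJump t).comp (ih.prodMk measurable_id)

end PathMeasurability

/-! ### The filter as a measurable function of the initial law and the observed path -/

section PathFilter

variable {I O : Type*} [Fintype I] [DecidableEq I] [DecidableEq O]
  {Λ : Matrix I I ℝ} {h : I → O} {d : O → I → ℝ} {μ : I → ℝ}

/-- The filter at time `t` along the observed path `y`, for the initial law `μ` of the chain. -/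
noncomputable def pathFilter (Λ : Matrix I I ℝ) (h : I → O) (d : O → I → ℝ) (t : ℝ≥0) (μ : I → ℝ)
    (y : Path O) : I → ℝ :=
  Classical.epsilon (IsPiecewiseFlow Λ h d (condOp h d (X 0 y) μ) y) t

theorem isPiecewiseFlow_pathFilter (hΛ : IsRateMatrix Λ) (hd : ∀ a, d a ∈ face h a)
    (hμ : μ ∈ stdSimplex ℝ I) (y : Path O) :
    IsPiecewiseFlow Λ h d (condOp h d (X 0 y) μ) y fun t => pathFilter Λ h d t μ y :=
  Classical.epsilon_spec
    (exists_isPiecewiseFlow hΛ hd (condOp_mem_face hd fun i _ => hμ.1 i))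

theorem pathFilter_zero (hΛ : IsRateMatrix Λ) (hd : ∀ a, d a ∈ face h a)
    (hμ : μ ∈ stdSimplex ℝ I) (y : Path O) :
    pathFilter Λ h d 0 μ y = condOp h d (X 0 y) μ :=
  (isPiecewiseFlow_pathFilter hΛ hd hμ y).zero

theorem pathFilter_mem_face (hΛ : IsRateMatrix Λ) (hd : ∀ a, d a ∈ face h a)
    (hμ : μ ∈ stdSimplex ℝ I) (y : Path O) (t : ℝ≥0) :
    pathFilter Λ h d t μ y ∈ face h (X t y) :=
  (isPiecewiseFlow_pathFilter hΛ hd hμ y).mem_face hΛ hd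
    (condOp_mem_face hd fun i _ => hμ.1 i) t

theorem filterProcess_eq_pathFilter (hΛ : IsRateMatrix Λ) (hd : ∀ a, d a ∈ face h a)
    (hμ : μ ∈ stdSimplex ℝ I) (t : ℝ≥0) (ω : Path I) :
    filterProcess Λ h d μ t ω = pathFilter Λ h d t μ (ω.map h) :=
  filterProcess_eq hΛ hd (condOp_mem_face hd fun i _ => hμ.1 i)
    (isPiecewiseFlow_pathFilter hΛ hd hμ (ω.map h)) t

theorem pathFilter_congr (hΛ : IsRateMatrix Λ) (hd : ∀ a, d a ∈ face h a)
    (hμ : μ ∈ stdSimplex ℝ I) {y y' : Path O} {t : ℝ≥0} (hy : ∀ s ≤ t, X s y = X s y') :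
    pathFilter Λ h d t μ y = pathFilter Λ h d t μ y' := by
  have h' := isPiecewiseFlow_pathFilter hΛ hd hμ y'
  rw [← hy 0 zero_le] at h'
  exact (isPiecewiseFlow_pathFilter hΛ hd hμ y).eq_of_eqOn hy h'

/-- The flow property: the filter restarts from its current value. -/
theorem pathFilter_add (hΛ : IsRateMatrix Λ) (hd : ∀ a, d a ∈ face h a)
    (hμ : μ ∈ stdSimplex ℝ I) (y : Path O) (t s : ℝ≥0) :
    pathFilter Λ h d (t + s) μ y
      = pathFilter Λ h d s (pathFilter Λ h d t μ y) (y.shift t) := by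
  have hmem := pathFilter_mem_face hΛ hd hμ y t
  have h1 := (isPiecewiseFlow_pathFilter hΛ hd hμ y).shift t
  have h2 := isPiecewiseFlow_pathFilter hΛ hd hmem.1 (y.shift t)
  have h3 : X 0 (y.shift t) = X t y := by simp
  rw [h3, condOp_of_mem_face d hmem] at h2
  exact h1.eq_of_eqOn (fun _ _ => rfl) h2

/-- The values of the filter at the truncated jump times of the observed path. -/
noncomputable def jumpFilter (Λ : Matrix I I ℝ) (h : I → O) (d : O → I → ℝ) (t : ℝ≥0)
    (μ : I → ℝ) (y : Path O) : ℕ → I → ℝ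
  | 0 => condOp h d (X 0 y) μ
  | n + 1 => stepMap Λ h d (X (jumpSeq t y n) y) (X (jumpSeq t y (n + 1)) y)
      ((jumpSeq t y (n + 1) : ℝ) - jumpSeq t y n) (jumpFilter Λ h d t μ y n)

theorem jumpFilter_eq (hΛ : IsRateMatrix Λ) (hd : ∀ a, d a ∈ face h a)
    (hμ : μ ∈ stdSimplex ℝ I) (y : Path O) (t : ℝ≥0) (n : ℕ) :
    jumpFilter Λ h d t μ y n = pathFilter Λ h d (jumpSeq t y n) μ y := by
  induction n with
  | zero => exact (pathFilter_zero hΛ hd hμ y).symm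
  | succ n ih =>
    rw [jumpFilter, ih]
    rcases (jumpSeq_le_succ t y n).eq_or_lt with heq | hlt
    · rw [← heq, sub_self, stepMap, if_pos rfl, flow_zero Λ (pathFilter_mem_face hΛ hd hμ y _)]
    · exact ((isPiecewiseFlow_pathFilter hΛ hd hμ y).step _ _ hlt
        (constOn_nextJump t _ y)).symm

variable [Fintype O]

theorem measurable_jumpFilter (Λ : Matrix I I ℝ) (h : I → O) (d : O → I → ℝ) (t : ℝ≥0) (n : ℕ) :
    Measurable fun z : (I → ℝ) × Path O => jumpFilter Λ h d t z.1 z.2 n := by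
  let _ : MeasurableSpace O := ⊤
  have _ : DiscreteMeasurableSpace O := ⟨fun _ => trivial⟩
  have hτ : ∀ n, Measurable fun z : (I → ℝ) × Path O => jumpSeq t z.2 n := fun n =>
    (measurable_jumpSeq t n).comp measurable_snd
  have hX : ∀ n, Measurable fun z : (I → ℝ) × Path O => X (jumpSeq t z.2 n) z.2 := fun n =>
    measurable_eval.comp ((hτ n).prodMk measurable_snd)
  induction n with
  | zero =>
    have h1 : Measurable fun z : O × (I → ℝ) => condOp h d z.1 z.2 :=
      measurable_from_prod_countable_right fun a => measurable_condOp h d a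
    exact h1.comp ((hX 0).prodMk measurable_fst)
  | succ n ih =>
    have h1 : Measurable fun z : (O × O) × (ℝ × (I → ℝ)) =>
        stepMap Λ h d z.1.1 z.1.2 z.2.1 z.2.2 :=
      measurable_from_prod_countable_right fun a => measurable_stepMap Λ h d a.1 a.2
    exact h1.comp (((hX n).prodMk (hX (n + 1))).prodMk
      (((hτ (n + 1)).coe_nnreal_real.sub (hτ n).coe_nnreal_real).prodMk ih))

/-- The filter at time `t` is the limit of its values at the truncated jump times, which depend
measurably on the initial law and the path. -/
theorem measurable_pathFilter (hΛ : IsRateMatrix Λ) (hd : ∀ a, d a ∈ face h a) (t : ℝ≥0) :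
    Measurable fun z : {μ : I → ℝ // μ ∈ stdSimplex ℝ I} × Path O =>
      pathFilter Λ h d t z.1.1 z.2 := by
  refine measurable_of_tendsto_metrizable (fun n => (measurable_jumpFilter Λ h d t n).comp
    ((measurable_subtype_coe.comp measurable_fst).prodMk measurable_snd))
    (tendsto_pi_nhds.2 fun z => tendsto_const_nhds.congr' ?_)
  filter_upwards [eventually_jumpSeq_eq t z.2] with n hn
  change _ = jumpFilter Λ h d t z.1.1 z.2 n
  rw [jumpFilter_eq hΛ hd z.1.2, hn]

/-- Adaptedness: the filter at time `t` is a measurable function of the observed path stopped at `t`. -/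
theorem measurable_filterProcess (hΛ : IsRateMatrix Λ) (hd : ∀ a, d a ∈ face h a)
    (hμ : μ ∈ stdSimplex ℝ I) (t : ℝ≥0) :
    Measurable[obsFiltration h t] fun ω => filterProcess Λ h d μ t ω := by
  have h1 : ∀ ω : Path I, filterProcess Λ h d μ t ω
      = pathFilter Λ h d t μ ((ω.map h).stopped t) := fun ω => by
    rw [filterProcess_eq_pathFilter hΛ hd hμ]
    exact pathFilter_congr hΛ hd hμ fun s hs => by rw [X_stopped, min_eq_left hs]
  simp only [h1]
  have h2 : Measurable fun y : Path O => pathFilter Λ h d t μ y :=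
    (measurable_pathFilter hΛ hd t).comp
      (measurable_const (a := (⟨μ, hμ⟩ : {μ : I → ℝ // μ ∈ stdSimplex ℝ I})) |>.prodMk
        measurable_id)
  exact h2.comp (measurable_map_stopped h t)

end PathFilter

/-! ### Grids on a time interval -/

section Grid

variable {O : Type*} {t : ℝ≥0}

/-- The mesh of the division of `[0, t]` into `n + 1` equal parts. -/
noncomputable def mesh (t : ℝ≥0) (n : ℕ) : ℝ≥0 := t / (n + 1)

/-- The index of the first point of the grid of mesh `mesh t n` that is not before `s`. -/
noncomputable def gridCeil (t : ℝ≥0) (n : ℕ) (s : ℝ≥0) : ℕ := ⌈s / mesh t n⌉₊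

theorem mesh_pos (ht : 0 < t) (n : ℕ) : 0 < mesh t n := by unfold mesh; positivity

theorem succ_mul_mesh (t : ℝ≥0) (n : ℕ) : ((n + 1 : ℕ) : ℝ≥0) * mesh t n = t := by
  have : ((n + 1 : ℕ) : ℝ≥0) = n + 1 := by push_cast; rfl
  rw [mesh, this, mul_div_cancel₀ _ (by positivity)]

theorem tendsto_mesh (t : ℝ≥0) : Tendsto (mesh t) atTop (𝓝 0) := by
  have := (tendsto_one_div_add_atTop_nhds_zero_nat (𝕜 := ℝ≥0)).const_mul t
  rw [mul_zero] at this
  refine this.congr fun n => ?_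
  rw [mul_one_div]; rfl

theorem le_gridCeil_mul (ht : 0 < t) (n : ℕ) (s : ℝ≥0) : s ≤ gridCeil t n s * mesh t n :=
  (div_le_iff₀ (mesh_pos ht n)).1 (Nat.le_ceil _)

theorem gridCeil_mul_lt (ht : 0 < t) (n : ℕ) (s : ℝ≥0) :
    gridCeil t n s * mesh t n < s + mesh t n := by
  have h := mesh_pos ht n
  have := mul_lt_mul_of_pos_right (Nat.ceil_lt_add_one (zero_le (a := s / mesh t n))) h
  rwa [add_mul, one_mul, div_mul_cancel₀ _ h.ne'] at this

theorem mul_mesh_lt_of_lt_gridCeil (ht : 0 < t) {n j : ℕ} {s : ℝ≥0} (hj : j < gridCeil t n s) :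
    j * mesh t n < s :=
  (lt_div_iff₀ (mesh_pos ht n)).1 (Nat.lt_ceil.1 hj)

theorem le_mul_mesh_of_gridCeil_le (ht : 0 < t) {n j : ℕ} {s : ℝ≥0} (hj : gridCeil t n s ≤ j) :
    s ≤ j * mesh t n :=
  (div_le_iff₀ (mesh_pos ht n)).1 (Nat.ceil_le.1 hj)

theorem gridCeil_le_succ (ht : 0 < t) (n : ℕ) {s : ℝ≥0} (hs : s ≤ t) : gridCeil t n s ≤ n + 1 := by
  refine Nat.ceil_le.2 ((div_le_iff₀ (mesh_pos ht n)).2 ?_)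
  rwa [succ_mul_mesh]

theorem gridCeil_self (ht : 0 < t) (n : ℕ) : gridCeil t n t = n + 1 := by
  have : t / mesh t n = ((n + 1 : ℕ) : ℝ≥0) := by
    rw [div_eq_iff (mesh_pos ht n).ne', succ_mul_mesh]
  rw [gridCeil, this, Nat.ceil_natCast]

theorem gridCeil_zero (t : ℝ≥0) (n : ℕ) : gridCeil t n 0 = 0 := by simp [gridCeil]

theorem tendsto_gridCeil_mul (ht : 0 < t) (s : ℝ≥0) :
    Tendsto (fun n => (gridCeil t n s : ℝ≥0) * mesh t n) atTop (𝓝 s) := by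
  have h1 : Tendsto (fun n => s + mesh t n) atTop (𝓝 (s + 0)) :=
    tendsto_const_nhds.add (tendsto_mesh t)
  rw [add_zero] at h1
  exact tendsto_of_tendsto_of_tendsto_of_le_of_le tendsto_const_nhds h1
    (fun n => le_gridCeil_mul ht n s) fun n => (gridCeil_mul_lt ht n s).le

theorem Path.eventually_gridCeil_eq (y : Path O) (ht : 0 < t) (s : ℝ≥0) :
    ∀ᶠ n in atTop, X (gridCeil t n s * mesh t n) y = X s y :=
  y.eventually_eq_of_tendsto (tendsto_gridCeil_mul ht s)
    (Eventually.of_forall fun n => le_gridCeil_mul ht n s)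

theorem eventually_gridCeil_lt (ht : 0 < t) {u s : ℝ≥0} (hus : u < s) :
    ∀ᶠ n in atTop, gridCeil t n u < gridCeil t n s := by
  filter_upwards [(tendsto_gridCeil_mul ht u).eventually (eventually_lt_nhds hus)] with n hn
  have h1 := hn.trans_le (le_gridCeil_mul ht n s)
  exact_mod_cast lt_of_mul_lt_mul_right h1 zero_le

theorem ConstOn.grid_eq {y : Path O} {u s : ℝ≥0} (hc : ConstOn y u s) (ht : 0 < t) {n j : ℕ}
    (h1 : gridCeil t n u ≤ j) (h2 : j < gridCeil t n s) : X (j * mesh t n) y = X u y :=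
  hc _ (le_mul_mesh_of_gridCeil_le ht h1) (mul_mesh_lt_of_lt_gridCeil ht h2)

end Grid

/-! ### Cylinder sets -/

section Cylinders

variable {Ω ι O : Type*}

/-- The event that finitely many of the variables `Z s` take prescribed values. -/
def cylinderEvent (Z : ι → Ω → O) (F : Finset ι) (x : ι → O) : Set Ω := {ω | ∀ s ∈ F, Z s ω = x s}

theorem isPiSystem_cylinderEvent (Z : ι → Ω → O) (T : Set ι) :
    IsPiSystem {S | ∃ F : Finset ι, ↑F ⊆ T ∧ ∃ x, S = cylinderEvent Z F x} := by
  classical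
  rintro _ ⟨F, hF, x, rfl⟩ _ ⟨F', hF', x', rfl⟩ ⟨ω₀, h1, h2⟩
  refine ⟨F ∪ F', by simp [hF, hF'], fun s => Z s ω₀, ?_⟩
  ext ω
  simp only [cylinderEvent, Set.mem_inter_iff, Set.mem_ofPred_eq, Finset.mem_union] at *
  constructor
  · rintro ⟨h3, h4⟩ s (hs | hs)
    · rw [h3 s hs, h1 s hs]
    · rw [h4 s hs, h2 s hs]
  · intro h3
    exact ⟨fun s hs => by rw [h3 s (Or.inl hs), h1 s hs],
      fun s hs => by rw [h3 s (Or.inr hs), h2 s hs]⟩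

theorem generateFrom_cylinderEvent [Finite O] (Z : ι → Ω → O) (T : Set ι) :
    ⨆ s ∈ T, MeasurableSpace.comap (Z s) ⊤ =
      MeasurableSpace.generateFrom
        {S | ∃ F : Finset ι, ↑F ⊆ T ∧ ∃ x, S = cylinderEvent Z F x} := by
  refine le_antisymm (iSup₂_le fun s hs => ?_) (MeasurableSpace.generateFrom_le ?_)
  · rintro _ ⟨B, -, rfl⟩
    have : Z s ⁻¹' B = ⋃ a ∈ B, cylinderEvent Z {s} fun _ => a := by
      ext ω; simp [cylinderEvent]
    rw [this]
    exact MeasurableSet.biUnion B.to_countable fun a _ =>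
      MeasurableSpace.measurableSet_generateFrom ⟨{s}, by simpa using hs, _, rfl⟩
  · rintro _ ⟨F, hF, x, rfl⟩
    have : cylinderEvent Z F x = ⋂ s ∈ F, Z s ⁻¹' {x s} := by
      ext ω; simp [cylinderEvent]
    rw [this]
    exact Finset.measurableSet_biInter F fun s hs =>
      le_iSup₂ (f := fun s (_ : s ∈ T) => MeasurableSpace.comap (Z s) ⊤) s (hF hs) _
        ⟨_, trivial, rfl⟩

end Cylinders

/-! ### Markov chains on the path space -/

section Chain

variable {I : Type*} [Fintype I]

theorem measurableSet_shift_preimage {I : Type*} {t r : ℝ≥0} {D : Set (Path I)}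
    (hD : MeasurableSet[stateFiltration I r] D) :
    MeasurableSet[stateFiltration I (t + r)] (Path.shift t ⁻¹' D) := by
  have : stateFiltration I r ≤ (stateFiltration I (t + r)).map (Path.shift t) := by
    refine iSup₂_le fun s hs => ?_
    rintro _ ⟨B, -, rfl⟩
    exact measurableSet_stateFiltration (add_le_add_right hs t) B
  exact this D hD

theorem setIntegral_comp_X {Q : Measure (Path I)} [IsFiniteMeasure Q] (C : Set (Path I)) (t : ℝ≥0)
    (f : I → ℝ) : ∫ ω in C, f (X t ω) ∂Q = ∑ i, Q.real (C ∩ X t ⁻¹' {i}) * f i := by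
  let _ : MeasurableSpace I := ⊤
  have _ : DiscreteMeasurableSpace I := ⟨fun _ => trivial⟩
  have hX : Measurable (X t : Path I → I) := measurable_X t
  rw [← integral_map (φ := X t) (f := f) hX.aemeasurable
    (measurable_of_countable f).aestronglyMeasurable,
    integral_fintype (Integrable.of_finite)]
  refine Finset.sum_congr rfl fun i _ => ?_
  rw [map_measureReal_apply hX (measurableSet_singleton i),
    measureReal_restrict_apply (measurableSet_X_preimage t {i}), Set.inter_comm, smul_eq_mul]

variable [DecidableEq I] {Λ : Matrix I I ℝ}

/-- The finite measure `Q` on the path space, not necessarily of mass one, makes the canonical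
process a Markov process with generator `Λ`. -/
structure IsMarkovMeasure (Λ : Matrix I I ℝ) (Q : Measure (Path I)) : Prop where
  isFiniteMeasure : IsFiniteMeasure Q
  transition : ∀ (t s : ℝ≥0) (C : Set (Path I)), MeasurableSet[stateFiltration I t] C → ∀ j,
    Q.real (C ∩ X (t + s) ⁻¹' {j})
      = ∑ i, Q.real (C ∩ X t ⁻¹' {i}) * NormedSpace.exp ((s : ℝ) • Λ) i j

theorem IsChainLaw.isMarkovMeasure {μ : I → ℝ} {P : Measure (Path I)} (hP : IsChainLaw Λ μ P) :
    IsMarkovMeasure Λ P := by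
  have hpr := hP.isProbabilityMeasure
  refine ⟨inferInstance, fun t s C hC j => ?_⟩
  have hCm := (stateFiltration I).le t C hC
  have h1 := setIntegral_comp_X (Q := P) C (t + s) (Pi.single j 1)
  have h2 := setIntegral_comp_X (Q := P) C t (NormedSpace.exp ((s : ℝ) • Λ) *ᵥ Pi.single j 1)
  simp only [mulVec_single_one, col_apply] at h2
  have hint : Integrable (fun ω => (Pi.single j 1 : I → ℝ) (X (t + s) ω)) P := by
    let _ : MeasurableSpace I := ⊤
    have _ : DiscreteMeasurableSpace I := ⟨fun _ => trivial⟩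
    exact Integrable.comp_measurable (g := (Pi.single j 1 : I → ℝ)) Integrable.of_finite
      (measurable_X (t + s))
  have h3 := setIntegral_condExp ((stateFiltration I).le t) hint hC
  rw [setIntegral_congr_ae hCm ((hP.markov t s (Pi.single j 1)).mono fun ω hω _ => hω)] at h3
  simp only [mulVec_single_one, col_apply] at h3
  rw [← h2, h3, h1]
  simp [Pi.single_apply]

/-- A Markov measure is determined by its initial law. -/
theorem IsMarkovMeasure.ext {Q Q' : Measure (Path I)} (hQ : IsMarkovMeasure Λ Q)
    (hQ' : IsMarkovMeasure Λ Q') (h0 : ∀ i, Q.real (X 0 ⁻¹' {i}) = Q'.real (X 0 ⁻¹' {i})) :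
    Q = Q' := by
  have _ := hQ.isFiniteMeasure
  have _ := hQ'.isFiniteMeasure
  have key : ∀ F : Finset ℝ≥0, ∀ (x : ℝ≥0 → I) (u : ℝ≥0), (∀ s ∈ F, s ≤ u) → ∀ j,
      Q.real (cylinderEvent X F x ∩ X u ⁻¹' {j}) = Q'.real (cylinderEvent X F x ∩ X u ⁻¹' {j}) := by
    intro F x
    induction F using Finset.induction_on_max with
    | empty =>
      intro u _ j
      have h1 := hQ.transition 0 u Set.univ MeasurableSet.univ j
      have h2 := hQ'.transition 0 u Set.univ MeasurableSet.univ j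
      simp only [Set.univ_inter, zero_add] at h1 h2
      simp only [cylinderEvent, Finset.notMem_empty, false_imp_iff, implies_true, Set.univ_inter,
        Set.ofPred_true, h1, h2, h0]
    | insert m F hF ih =>
      intro u hu j
      obtain ⟨w, rfl⟩ := exists_add_of_le (hu m (Finset.mem_insert_self m F))
      have hC : cylinderEvent X (insert m F) x = cylinderEvent X F x ∩ X m ⁻¹' {x m} := by
        ext ω; simp [cylinderEvent, and_comm]
      have hCm : MeasurableSet[stateFiltration I m] (cylinderEvent X (insert m F) x) := by
        have : cylinderEvent X (insert m F) x = ⋂ s ∈ insert m F, X s ⁻¹' {x s} := by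
          ext ω; simp [cylinderEvent]
        rw [this]
        exact Finset.measurableSet_biInter _ fun s hs => measurableSet_stateFiltration (by
          rcases Finset.mem_insert.1 hs with rfl | hs
          · exact le_rfl
          · exact (hF s hs).le) _
      rw [hQ.transition m w _ hCm j, hQ'.transition m w _ hCm j]
      refine Finset.sum_congr rfl fun i _ => ?_
      congr 1
      rw [hC, Set.inter_assoc, ← Set.preimage_inter]
      by_cases hi : i = x m
      · rw [hi, Set.inter_self]
        exact ih m (fun s hs => (hF s hs).le) _
      · rw [Set.singleton_inter_eq_empty.2 (by simpa using Ne.symm hi)]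
        simp
  have hmass : ∀ (F : Finset ℝ≥0) (x : ℝ≥0 → I),
      Q (cylinderEvent X F x) = Q' (cylinderEvent X F x) := by
    intro F x
    let _ : MeasurableSpace I := ⊤
    have _ : DiscreteMeasurableSpace I := ⟨fun _ => trivial⟩
    obtain ⟨u, hu⟩ := F.exists_le
    have h1 := setIntegral_comp_X (Q := Q) (cylinderEvent X F x) u fun _ => 1
    have h2 := setIntegral_comp_X (Q := Q') (cylinderEvent X F x) u fun _ => 1
    rw [Finset.sum_congr rfl fun j _ => by rw [key F x u hu j], ← h2] at h1
    simp only [setIntegral_const, smul_eq_mul, mul_one] at h1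
    exact (measureReal_eq_measureReal_iff).1 h1
  refine ext_of_generate_finite _ ?_ (isPiSystem_cylinderEvent (X : ℝ≥0 → Path I → I) Set.univ)
    ?_ ?_
  · rw [← generateFrom_cylinderEvent]
    simp only [Set.mem_univ, iSup_pos]
    rfl
  · rintro _ ⟨F, -, x, rfl⟩
    exact hmass F x
  · by_cases hI : IsEmpty (Path I)
    · simp [Set.univ_eq_empty_iff.2 hI]
    · obtain ⟨ω⟩ := not_isEmpty_iff.1 hI
      simpa [cylinderEvent] using hmass ∅ fun _ => X 0 ω

theorem IsMarkovMeasure.smul {Q : Measure (Path I)} (hQ : IsMarkovMeasure Λ Q) {c : ℝ≥0∞}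
    (hc : c ≠ ∞) : IsMarkovMeasure Λ (c • Q) := by
  have _ := hQ.isFiniteMeasure
  refine ⟨Q.smul_finite hc, fun t s C hC j => ?_⟩
  simp only [measureReal_ennreal_smul_apply, hQ.transition t s C hC j, Finset.mul_sum, mul_assoc]

theorem IsMarkovMeasure.sum {κ : Type*} {Q : κ → Measure (Path I)} (s : Finset κ)
    (hQ : ∀ k ∈ s, IsMarkovMeasure Λ (Q k)) : IsMarkovMeasure Λ (∑ k ∈ s, Q k) := by
  refine Finset.sum_induction Q (IsMarkovMeasure Λ) (fun Q Q' hQ hQ' => ?_) ?_ hQ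
  · have _ := hQ.isFiniteMeasure
    have _ := hQ'.isFiniteMeasure
    refine ⟨inferInstance, fun t s C hC j => ?_⟩
    rw [measureReal_add_apply, hQ.transition t s C hC j, hQ'.transition t s C hC j,
      ← Finset.sum_add_distrib]
    refine Finset.sum_congr rfl fun i _ => ?_
    rw [measureReal_add_apply]
    exact (add_mul _ _ _).symm
  · refine ⟨inferInstance, fun t s C hC j => ?_⟩
    rw [measureReal_zero_apply]
    refine (Finset.sum_eq_zero fun i _ => ?_).symm
    rw [measureReal_zero_apply]
    exact zero_mul _

/-- The law of the shifted path, restricted to an event of the past, is again Markov. -/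
theorem IsMarkovMeasure.map_shift_restrict {Q : Measure (Path I)} (hQ : IsMarkovMeasure Λ Q)
    {t : ℝ≥0} {C : Set (Path I)} (hC : MeasurableSet[stateFiltration I t] C) :
    IsMarkovMeasure Λ ((Q.restrict C).map (Path.shift t)) := by
  have _ := hQ.isFiniteMeasure
  have hreal : ∀ D, MeasurableSet D →
      ((Q.restrict C).map (Path.shift t)).real D = Q.real (Path.shift t ⁻¹' D ∩ C) := fun D hD => by
    rw [map_measureReal_apply (measurable_shift t) hD,
      measureReal_restrict_apply (measurable_shift t hD)]
  refine ⟨inferInstance, fun r s D hD j => ?_⟩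
  have hDm := (stateFiltration I).le r D hD
  have hD' := measurableSet_shift_preimage (t := t) hD
  have hCD : MeasurableSet[stateFiltration I (t + r)] (Path.shift t ⁻¹' D ∩ C) :=
    hD'.inter ((stateFiltration I).mono le_self_add _ hC)
  have hset : ∀ r' i, Path.shift t ⁻¹' (D ∩ X r' ⁻¹' {i}) ∩ C
      = (Path.shift t ⁻¹' D ∩ C) ∩ X (t + r') ⁻¹' {i} := fun r' i => by
    rw [Set.preimage_inter, Set.inter_right_comm]; rfl
  have h1 := hQ.transition (t + r) s _ hCD j
  rw [hreal _ (hDm.inter (measurableSet_X_preimage _ _)), hset, ← add_assoc, h1]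
  refine Finset.sum_congr rfl fun i _ => ?_
  rw [hreal _ (hDm.inter (measurableSet_X_preimage _ _)), hset]

variable {P : (I → ℝ) → Measure (Path I)}

/-- The Markov property on the path space: after time `t`, and on an event `C` of the past,
the chain starts afresh from its current state. -/
theorem map_shift_restrict_eq (hP : ∀ μ ∈ stdSimplex ℝ I, IsChainLaw Λ μ (P μ)) {μ : I → ℝ}
    (hμ : μ ∈ stdSimplex ℝ I) {t : ℝ≥0} {C : Set (Path I)}
    (hC : MeasurableSet[stateFiltration I t] C) :
    ((P μ).restrict C).map (Path.shift t)
      = ∑ i, P μ (C ∩ X t ⁻¹' {i}) • P (Pi.single i 1) := by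
  have hs : ∀ i, (Pi.single i 1 : I → ℝ) ∈ stdSimplex ℝ I := fun i => single_mem_stdSimplex ℝ i
  have hpr := (hP μ hμ).isProbabilityMeasure
  have hpr' := fun i => (hP _ (hs i)).isProbabilityMeasure
  refine ((hP μ hμ).isMarkovMeasure.map_shift_restrict hC).ext
    (IsMarkovMeasure.sum _ fun i _ => (hP _ (hs i)).isMarkovMeasure.smul (measure_ne_top _ _))
    fun j => ?_
  rw [map_measureReal_apply (measurable_shift t) (measurableSet_X_preimage 0 {j}),
    measureReal_restrict_apply (measurable_shift t (measurableSet_X_preimage 0 {j}))]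
  have hsum : ∀ B : Set (Path I), (∑ i, P μ (C ∩ X t ⁻¹' {i}) • P (Pi.single i 1)).real B
      = ∑ i, (P μ (C ∩ X t ⁻¹' {i}) • P (Pi.single i 1)).real B := fun B => by
    simp only [measureReal_def, Measure.finsetSum_apply]
    exact ENNReal.toReal_sum fun i _ => ENNReal.mul_ne_top (measure_ne_top _ _) (measure_ne_top _ _)
  rw [hsum]
  have hinit : ∀ i, (P (Pi.single i 1)).real (X 0 ⁻¹' {j}) = (Pi.single i 1 : I → ℝ) j := fun i => by
    have := (hP _ (hs i)).initial j
    rw [measureReal_def]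
    change (P (Pi.single i 1) {ω | X 0 ω = j}).toReal = _
    rw [this, ENNReal.toReal_ofReal ((hs i).1 j)]
  simp only [measureReal_ennreal_smul_apply, hinit, Pi.single_apply]
  simp only [mul_ite, mul_one, mul_zero, Finset.sum_ite_eq, Finset.mem_univ, if_true]
  rw [measureReal_def, Set.inter_comm]
  congr 3
  ext ω; simp

/-- The law of the chain is linear in the initial law. -/
theorem law_eq_sum (hP : ∀ μ ∈ stdSimplex ℝ I, IsChainLaw Λ μ (P μ)) {μ : I → ℝ}
    (hμ : μ ∈ stdSimplex ℝ I) :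
    P μ = ∑ i, ENNReal.ofReal (μ i) • P (Pi.single i 1) := by
  have h := map_shift_restrict_eq hP hμ (t := 0) (C := Set.univ) MeasurableSet.univ
  have h0 : (Path.shift 0 : Path I → Path I) = id := by
    funext ω
    refine Subtype.ext (funext fun s => ?_)
    change ω.1 (0 + s) = ω.1 s
    rw [zero_add]
  rw [h0, Measure.map_id, Measure.restrict_univ] at h
  rw [h]
  refine Finset.sum_congr rfl fun i _ => ?_
  rw [Set.univ_inter]
  congr 1
  exact (hP μ hμ).initial i

end Chain

/-! ### The filter for discrete observation times -/

section Directions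

variable {I O : Type*}

theorem levelInd_nonneg [DecidableEq O] (h : I → O) (a : O) (i : I) : 0 ≤ levelInd h a i := by
  unfold levelInd; positivity

theorem ConstOn.map {ω : Path I} {u s : ℝ≥0} (hc : ConstOn ω u s) (h : I → O) :
    ConstOn (ω.map h) u s := fun v h1 h2 => congrArg h (hc v h1 h2)

theorem tendsto_levelInd_mul [DecidableEq O] (h : I → O) (b : O) {v : ℕ → I → ℝ} {x : I → ℝ}
    (hv : Tendsto v atTop (𝓝 x)) :
    Tendsto (fun n => levelInd h b * v n) atTop (𝓝 (levelInd h b * x)) :=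
  hv.const_mul _

variable [Fintype I]

theorem normalizeVec_apply_mem_Icc {v : I → ℝ} (hv : ∀ i, 0 ≤ v i) (i : I) :
    normalizeVec v i ∈ Set.Icc (0 : ℝ) 1 := by
  have h1 : v i ≤ ∑ j, v j := Finset.single_le_sum (fun j _ => hv j) (Finset.mem_univ i)
  have h0 : 0 ≤ ∑ j, v j := (hv i).trans h1
  refine ⟨mul_nonneg (inv_nonneg.2 h0) (hv i), ?_⟩
  change (∑ j, v j)⁻¹ * v i ≤ 1
  rw [inv_mul_eq_div]
  exact div_le_one_of_le₀ h1 h0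

theorem tendsto_vecMul {v : ℕ → I → ℝ} {x : I → ℝ} {M : ℕ → Matrix I I ℝ} {A : Matrix I I ℝ}
    (hv : Tendsto v atTop (𝓝 x)) (hM : Tendsto M atTop (𝓝 A)) :
    Tendsto (fun n => v n ᵥ* M n) atTop (𝓝 (x ᵥ* A)) :=
  ((by fun_prop : Continuous fun z : (I → ℝ) × Matrix I I ℝ => z.1 ᵥ* z.2).tendsto (x, A)).comp
    (hv.prodMk_nhds hM)

theorem tendsto_normalizeVec {v : ℕ → I → ℝ} {x : I → ℝ} (hx : ∑ i, x i ≠ 0)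
    (hv : Tendsto v atTop (𝓝 x)) :
    Tendsto (fun n => normalizeVec (v n)) atTop (𝓝 (normalizeVec x)) := by
  refine Tendsto.smul (Tendsto.inv₀ ?_ hx) hv
  exact tendsto_finsetSum _ fun i _ => (tendsto_pi_nhds.1 hv) i

/-- Convergence of the sequence of vectors `v n` to the positive direction of `x`, after rescaling
by positive factors. -/
def TendstoDirection (v : ℕ → I → ℝ) (x : I → ℝ) : Prop :=
  ∃ c : ℕ → ℝ, (∀ᶠ n in atTop, 0 < c n) ∧ Tendsto (fun n => c n • v n) atTop (𝓝 x)

theorem TendstoDirection.normalizeVec_right {v : ℕ → I → ℝ} {x : I → ℝ}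
    (hv : TendstoDirection v x) (hx : 0 < ∑ i, x i) : TendstoDirection v (normalizeVec x) := by
  obtain ⟨c, hc, hlim⟩ := hv
  refine ⟨fun n => (∑ i, x i)⁻¹ * c n, hc.mono fun n hn => mul_pos (inv_pos.2 hx) hn, ?_⟩
  refine (hlim.const_smul (∑ i, x i)⁻¹).congr fun n => ?_
  rw [smul_smul]

theorem TendstoDirection.tendsto_normalizeVec {v : ℕ → I → ℝ} {x : I → ℝ}
    (hv : TendstoDirection v x) (hx : ∑ i, x i = 1) :
    Tendsto (fun n => normalizeVec (v n)) atTop (𝓝 x) := by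
  obtain ⟨c, hc, hlim⟩ := hv
  have h1 := NoiseFreeFilter.tendsto_normalizeVec (by rw [hx]; exact one_ne_zero) hlim
  have h2 : normalizeVec x = x := by rw [normalizeVec, hx, inv_one, one_smul]
  rw [h2] at h1
  refine h1.congr' (hc.mono fun n hn => ?_)
  rw [normalizeVec_smul hn.ne']

/-- At an observed jump from the level `a` to the level `b`, the unnormalized filter remains
nonnegative, and it charges the new state of a chain that makes a jump of positive rate. -/
theorem jump_nonneg_and_pos [DecidableEq O] {Λ : Matrix I I ℝ} {h : I → O}
    (hΛ : IsRateMatrix Λ) {a b : O} {q : I → ℝ}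
    (hq : ∀ i, 0 ≤ q i) (hqs : ∀ i, h i ≠ a → q i = 0) (hab : b ≠ a) {i j : I} (hi : 0 < q i)
    (hj : h j = b) (hij : 0 < Λ i j) :
    (∀ j, 0 ≤ (levelInd h b * (q ᵥ* Λ)) j) ∧ 0 < (levelInd h b * (q ᵥ* Λ)) j := by
  have hterm : ∀ j, h j = b → ∀ i, 0 ≤ q i * Λ i j := fun j hj i => by
    by_cases hia : h i = a
    · refine mul_nonneg (hq i) (hΛ.offDiag_nonneg i j fun hij => hab ?_)
      rw [← hj, ← hij, hia]
    · rw [hqs i hia, zero_mul]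
  refine ⟨fun j => ?_, ?_⟩
  · by_cases hj : h j = b
    · exact mul_nonneg (levelInd_nonneg h b j) (Finset.sum_nonneg fun i _ => hterm j hj i)
    · simp [levelInd, hj]
  · have h1 : levelInd h b j = 1 := by simp [levelInd, hj]
    rw [Pi.mul_apply, h1, one_mul]
    exact Finset.sum_pos' (fun i _ => hterm j hj i) ⟨i, Finset.mem_univ i, mul_pos hi hij⟩

end Directions

section GridFilter

attribute [local instance] Matrix.linftyOpNormedRing Matrix.linftyOpNormedAlgebra

variable {I O : Type*} [Fintype I] [DecidableEq I] [DecidableEq O] {Λ : Matrix I I ℝ} {h : I → O}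
  {μ : I → ℝ}

/-- The unnormalized filter for the observations `a 0, a 1, …` at the times `0, δ, 2δ, …`: its
`i`-th coordinate after `k` steps is the probability of observing `a 0, …, a k` and being in `i`
at time `k δ`. -/
noncomputable def gridFilter (Λ : Matrix I I ℝ) (h : I → O) (μ : I → ℝ) (δ : ℝ≥0) (a : ℕ → O) :
    ℕ → I → ℝ
  | 0 => levelInd h (a 0) * μ
  | k + 1 => levelInd h (a (k + 1)) * (gridFilter Λ h μ δ a k ᵥ* NormedSpace.exp ((δ : ℝ) • Λ))

theorem gridFilter_supp (δ : ℝ≥0) (a : ℕ → O) (k : ℕ) (i : I) (hi : h i ≠ a k) :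
    gridFilter Λ h μ δ a k i = 0 := by
  cases k <;> simp [gridFilter, levelInd, hi]

theorem gridFilter_congr (δ : ℝ≥0) {a a' : ℕ → O} {k : ℕ} (ha : ∀ j ≤ k, a j = a' j) :
    gridFilter Λ h μ δ a k = gridFilter Λ h μ δ a' k := by
  induction k with
  | zero => rw [gridFilter, gridFilter, ha 0 le_rfl]
  | succ k ih => rw [gridFilter, gridFilter, ha (k + 1) le_rfl, ih fun j hj => ha j (hj.trans k.le_succ)]

theorem gridFilter_nonneg (hΛ : IsRateMatrix Λ) (hμ : ∀ i, 0 ≤ μ i) (δ : ℝ≥0) (a : ℕ → O) (k : ℕ)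
    (i : I) : 0 ≤ gridFilter Λ h μ δ a k i := by
  induction k generalizing i with
  | zero => exact mul_nonneg (levelInd_nonneg h _ i) (hμ i)
  | succ k ih =>
    exact mul_nonneg (levelInd_nonneg h _ i) (Finset.sum_nonneg fun j _ =>
      mul_nonneg (ih j) (exp_entry_nonneg hΛ.offDiag_nonneg δ.2 j i))

/-- One step of the discrete filter without observed jump in the level `a`, extended by the
identity outside of the level. -/
noncomputable def levelStep (Λ : Matrix I I ℝ) (h : I → O) (a : O) (δ : ℝ) : Matrix I I ℝ :=
  1 + diagonal (levelInd h a) * (NormedSpace.exp (δ • Λ) - 1) * diagonal (levelInd h a)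

theorem vecMul_diagonal_levelInd (h : I → O) (a : O) (v : I → ℝ) :
    v ᵥ* diagonal (levelInd h a) = levelInd h a * v := by
  ext i
  rw [vecMul_diagonal, Pi.mul_apply, mul_comm]

theorem vecMul_levelStep {a : O} (δ : ℝ) {v : I → ℝ} (hv : ∀ i, h i ≠ a → v i = 0) :
    v ᵥ* levelStep Λ h a δ = levelInd h a * (v ᵥ* NormedSpace.exp (δ • Λ)) := by
  have h1 := levelInd_mul_of_supp hv
  rw [levelStep, vecMul_add, vecMul_one, ← vecMul_vecMul, ← vecMul_vecMul,
    vecMul_diagonal_levelInd, vecMul_diagonal_levelInd, h1, vecMul_sub, vecMul_one, mul_sub, h1]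
  abel

/-- As long as the observation does not change, the steps of the discrete filter are powers of
`levelStep`. -/
theorem gridFilter_add {δ : ℝ≥0} {a : ℕ → O} {b : O} {k N : ℕ}
    (ha : ∀ j, k ≤ j → j ≤ k + N → a j = b) :
    gridFilter Λ h μ δ a (k + N) = gridFilter Λ h μ δ a k ᵥ* levelStep Λ h b δ ^ N := by
  induction N with
  | zero => rw [pow_zero, vecMul_one, add_zero]
  | succ N ih =>
    have ih' := ih fun j h1 h2 => ha j h1 (h2.trans (by omega))
    have hs : ∀ i, h i ≠ b → gridFilter Λ h μ δ a (k + N) i = 0 := fun i hi =>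
      gridFilter_supp δ a (k + N) i (by rwa [ha (k + N) (by omega) (by omega)])
    rw [← add_assoc, gridFilter, ha (k + N + 1) (by omega) (by omega), ← vecMul_levelStep δ hs, ih',
      vecMul_vecMul, pow_succ]

theorem diagonal_mul_mul_diagonal_eq_levelGen (Λ : Matrix I I ℝ) (h : I → O) (a : O) :
    diagonal (levelInd h a) * Λ * diagonal (levelInd h a) = levelGen Λ h a := by
  ext i j
  rw [mul_diagonal, diagonal_mul]
  by_cases hi : h i = a <;> by_cases hj : h j = a <;> simp [levelInd, levelGen, hi, hj]

theorem tendsto_exp_sub_one (Λ : Matrix I I ℝ) {δ : ℕ → ℝ} (hδ : ∀ n, 0 < δ n)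
    (hδ0 : Tendsto δ atTop (𝓝 0)) :
    Tendsto (fun n => (δ n)⁻¹ • (NormedSpace.exp (δ n • Λ) - 1)) atTop (𝓝 Λ) := by
  have h1 := (hasDerivAt_exp_smul_const Λ (0 : ℝ)).tendsto_slope_zero
  simp only [zero_smul, NormedSpace.exp_zero, one_mul, zero_add] at h1
  exact h1.comp (tendsto_nhdsWithin_iff.2 ⟨hδ0, Eventually.of_forall fun n => (hδ n).ne'⟩)

/-- Over a time span tending to `w`, the steps without observed jump converge to the killed
semigroup. -/
theorem tendsto_levelStep_pow [Nonempty I] (Λ : Matrix I I ℝ) (h : I → O) (a : O) {δ : ℕ → ℝ}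
    (hδ : ∀ n, 0 < δ n) (hδ0 : Tendsto δ atTop (𝓝 0)) {N : ℕ → ℕ} {w : ℝ}
    (hN : Tendsto (fun n => N n * δ n) atTop (𝓝 w)) :
    Tendsto (fun n => levelStep Λ h a (δ n) ^ N n) atTop
      (𝓝 (NormedSpace.exp (w • levelGen Λ h a))) := by
  refine tendsto_pow_exp (Eventually.of_forall hδ) hδ0 ?_ hN
  have h1 := ((tendsto_exp_sub_one Λ hδ hδ0).const_mul (diagonal (levelInd h a))).mul_const
    (diagonal (levelInd h a))
  rw [diagonal_mul_mul_diagonal_eq_levelGen] at h1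
  refine h1.congr fun n => ?_
  rw [levelStep, add_sub_cancel_left, mul_smul_comm, smul_mul_assoc]

end GridFilter

section Convergence

attribute [local instance] Matrix.linftyOpNormedRing Matrix.linftyOpNormedAlgebra

variable {I O : Type*} [Fintype I] [DecidableEq I] [DecidableEq O] {Λ : Matrix I I ℝ} {h : I → O}
  {d : O → I → ℝ} {μ : I → ℝ}

/-- Propagation of the convergence of the discrete filters along an interval `[u, s)` of constancy
of the path. -/
theorem tendstoDirection_step (hΛ : IsRateMatrix Λ) {t : ℝ≥0} (ht : 0 < t) (ω : Path I)
    {u s : ℝ≥0} (hus : u < s) (hc : ConstOn ω u s) (hrate : X s ω ≠ X u ω → 0 < Λ (X u ω) (X s ω))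
    {x : I → ℝ} (hx : x ∈ face h (Y h u ω)) (hpos : 0 < x (X u ω))
    (hlim : TendstoDirection (fun n => gridFilter Λ h μ (mesh t n)
      (fun j => Y h (j * mesh t n) ω) (gridCeil t n u)) x) :
    TendstoDirection (fun n => gridFilter Λ h μ (mesh t n)
        (fun j => Y h (j * mesh t n) ω) (gridCeil t n s))
      (stepMap Λ h d (Y h u ω) (Y h s ω) ((s : ℝ) - u) x) ∧
    0 < stepMap Λ h d (Y h u ω) (Y h s ω) ((s : ℝ) - u) x (X s ω) := by
  have : Nonempty I := ⟨X 0 ω⟩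
  obtain ⟨c, hcpos, hclim⟩ := hlim
  set a := Y h u ω with ha
  set b := Y h s ω with hb
  set δ : ℕ → ℝ := fun n => (mesh t n : ℝ) with hδdef
  set G : ℕ → ℕ → I → ℝ := fun n k => gridFilter Λ h μ (mesh t n) (fun j => Y h (j * mesh t n) ω) k
    with hG
  have hw : (0 : ℝ) < (s : ℝ) - u := sub_pos.2 (NNReal.coe_lt_coe.2 hus)
  have hδ : ∀ n, 0 < δ n := fun n => NNReal.coe_pos.2 (mesh_pos ht n)
  have hδ0 : Tendsto δ atTop (𝓝 0) := by
    have := tendsto_mesh t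
    rw [← NNReal.tendsto_coe] at this
    exact this
  set q := rawFlow Λ h a ((s : ℝ) - u) x with hq
  have hq0 : ∀ i, 0 ≤ q i := rawFlow_nonneg hΛ hw.le hx.1.1
  have hqs : ∀ i, h i ≠ a → q i = 0 := rawFlow_supp Λ _ hx.2
  have hqpos : 0 < q (X u ω) := rawFlow_pos hΛ hw.le hx.1.1 hpos
  have hqmass : 0 < ∑ i, q i := rawFlow_mass_pos hΛ hw.le hx.1
  have hlt := eventually_gridCeil_lt ht hus
  have hYgrid : ∀ n j, gridCeil t n u ≤ j → j < gridCeil t n s → Y h (j * mesh t n) ω = a :=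
    fun n j h1 h2 => (hc.map h).grid_eq ht h1 h2
  -- the convergence at the last grid point before `s`
  have hpre : Tendsto (fun n => c n • G n (gridCeil t n s - 1)) atTop (𝓝 q) := by
    have hN : Tendsto (fun n => ((gridCeil t n s - 1 - gridCeil t n u : ℕ) : ℝ) * δ n) atTop
        (𝓝 ((s : ℝ) - u)) := by
      have h1 : ∀ r, Tendsto (fun n => (gridCeil t n r : ℝ) * δ n) atTop (𝓝 (r : ℝ)) := fun r => by
        have := tendsto_gridCeil_mul ht r
        rw [← NNReal.tendsto_coe] at this
        simpa using this
      have h2 := ((h1 s).sub hδ0).sub (h1 u)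
      rw [sub_zero] at h2
      refine h2.congr' (hlt.mono fun n hn => ?_)
      have h3 : gridCeil t n s = (gridCeil t n s - 1 - gridCeil t n u) + gridCeil t n u + 1 := by
        omega
      have h4 : (gridCeil t n s : ℝ)
          = ((gridCeil t n s - 1 - gridCeil t n u : ℕ) : ℝ) + gridCeil t n u + 1 := by
        exact_mod_cast h3
      rw [h4]
      ring
    refine (tendsto_vecMul hclim (tendsto_levelStep_pow Λ h a hδ hδ0 hN)).congr'
      (hlt.mono fun n hn => ?_)
    have h1 : gridCeil t n s - 1 = gridCeil t n u + (gridCeil t n s - 1 - gridCeil t n u) := by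
      omega
    rw [smul_vecMul, hG]
    dsimp only
    conv_rhs => rw [h1]
    rw [gridFilter_add (b := a) fun j h1 h2 => hYgrid n j h1 (by omega)]
  have hlast : ∀ᶠ n in atTop, G n (gridCeil t n s)
      = levelInd h b * (G n (gridCeil t n s - 1) ᵥ* NormedSpace.exp (δ n • Λ)) := by
    filter_upwards [hlt, (ω.map h).eventually_gridCeil_eq ht s] with n hn hYs
    obtain ⟨k, hk⟩ : ∃ k, gridCeil t n s = k + 1 := ⟨gridCeil t n s - 1, by omega⟩
    have hY' : Y h ((k + 1 : ℕ) * mesh t n) ω = b := by rw [← hk]; exact hYs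
    rw [hk, Nat.add_sub_cancel, hG]
    dsimp only
    rw [gridFilter, hY']
  by_cases hab : b = a
  · have hstep : stepMap Λ h d a b ((s : ℝ) - u) x = normalizeVec q := by
      rw [stepMap, if_pos hab]; rfl
    have hqs' : 0 < q (X s ω) := by
      by_cases hXs : X s ω = X u ω
      · rwa [hXs]
      · exact rawFlow_pos_of_rate_pos hΛ hw hx.1.1 hpos rfl hab (Ne.symm hXs) (hrate hXs)
    rw [hstep]
    refine ⟨TendstoDirection.normalizeVec_right ⟨c, hcpos, ?_⟩ hqmass,
      mul_pos (inv_pos.2 hqmass) hqs'⟩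
    have hE : Tendsto (fun n => NormedSpace.exp (δ n • Λ)) atTop (𝓝 1) := by
      have := ((continuous_exp_smul Λ).tendsto 0).comp hδ0
      rw [zero_smul, NormedSpace.exp_zero] at this
      exact this
    have h1 := tendsto_levelInd_mul h b (tendsto_vecMul hpre hE)
    rw [vecMul_one, hab, levelInd_mul_of_supp hqs] at h1
    refine h1.congr' (hlast.mono fun n hn => ?_)
    change _ = c n • G n (gridCeil t n s)
    rw [hn, smul_vecMul, mul_smul_comm, hab]
  · have hXs : X s ω ≠ X u ω := fun hX => hab (by rw [hb, ha, Y, Y, hX])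
    obtain ⟨hr0, hrpos⟩ := jump_nonneg_and_pos (h := h) hΛ hq0 hqs hab hqpos rfl (hrate hXs)
    set r := levelInd h b * (q ᵥ* Λ) with hr
    have hrmass : 0 < ∑ i, r i := Finset.sum_pos' (fun i _ => hr0 i) ⟨_, Finset.mem_univ _, hrpos⟩
    have hstep : stepMap Λ h d a b ((s : ℝ) - u) x = normalizeVec r := by
      have h1 : levelInd h b * (flow Λ h a ((s : ℝ) - u) x ᵥ* Λ) = (∑ i, q i)⁻¹ • r := by
        rw [flow, ← hq, normalizeVec, smul_vecMul, mul_smul_comm]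
      have h2 : (flow Λ h a ((s : ℝ) - u) x ᵥ* Λ) ⬝ᵥ levelInd h b ≠ 0 := by
        rw [dotProduct_levelInd, h1]
        simp only [Pi.smul_apply, smul_eq_mul, ← Finset.mul_sum]
        exact (mul_pos (inv_pos.2 hqmass) hrmass).ne'
      rw [stepMap, if_neg hab, condOp_of_ne_zero d h2, h1,
        normalizeVec_smul (inv_pos.2 hqmass).ne']
    rw [hstep]
    refine ⟨TendstoDirection.normalizeVec_right ⟨fun n => c n * (δ n)⁻¹,
      hcpos.mono fun n hn => mul_pos hn (inv_pos.2 (hδ n)), ?_⟩ hrmass,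
      mul_pos (inv_pos.2 hrmass) hrpos⟩
    have h1 := tendsto_levelInd_mul h b (tendsto_vecMul hpre (tendsto_exp_sub_one Λ hδ hδ0))
    refine h1.congr' ?_
    filter_upwards [hlast, hlt] with n hn hn'
    -- the probability of a jump in a grid interval is of order `δ n`, whence the additional factor
    change _ = (c n * (δ n)⁻¹) • G n (gridCeil t n s)
    -- the vector before the jump does not charge the level `b`
    have hzero : levelInd h b * G n (gridCeil t n s - 1) = 0 := by
      ext i
      by_cases hi : h i = b
      · have : G n (gridCeil t n s - 1) i = 0 := gridFilter_supp _ _ _ i (by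
          rw [hYgrid n _ (by omega) (by omega), hi]; exact hab)
        simp [this]
      · simp [levelInd, hi]
    rw [hn, vecMul_smul, vecMul_sub, vecMul_one, mul_smul_comm, mul_sub, smul_vecMul,
      mul_smul_comm, mul_smul_comm, hzero, smul_zero, sub_zero, smul_smul, mul_comm]

/-- Along every path that starts in the support of `μ` and makes only jumps of positive rate, the
normalized discrete filters converge to the solution of the filtering equation. -/
theorem tendsto_gridFilter (hΛ : IsRateMatrix Λ) (hd : ∀ a, d a ∈ face h a)
    (hμ : μ ∈ stdSimplex ℝ I) (t : ℝ≥0) (ω : Path I) (h0 : 0 < μ (X 0 ω))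
    (hrate : ∀ u s, u < s → s ≤ t → ConstOn ω u s → X s ω ≠ X u ω → 0 < Λ (X u ω) (X s ω)) :
    Tendsto (fun n => normalizeVec (gridFilter Λ h μ (mesh t n)
      (fun j => Y h (j * mesh t n) ω) (n + 1))) atTop (𝓝 (pathFilter Λ h d t μ (ω.map h))) := by
  have hinit0 : ∀ i, 0 ≤ (levelInd h (Y h 0 ω) * μ) i := fun i =>
    mul_nonneg (levelInd_nonneg h _ i) (hμ.1 i)
  have hinitpos : 0 < (levelInd h (Y h 0 ω) * μ) (X 0 ω) := by
    have : levelInd h (Y h 0 ω) (X 0 ω) = 1 := by simp [levelInd, Y]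
    rwa [Pi.mul_apply, this, one_mul]
  have hinitmass : 0 < ∑ i, (levelInd h (Y h 0 ω) * μ) i :=
    Finset.sum_pos' (fun i _ => hinit0 i) ⟨_, Finset.mem_univ _, hinitpos⟩
  have hcond : condOp h d (Y h 0 ω) μ = normalizeVec (levelInd h (Y h 0 ω) * μ) :=
    condOp_of_ne_zero d (by rw [dotProduct_levelInd]; exact hinitmass.ne')
  have hflow := isPiecewiseFlow_pathFilter hΛ hd hμ (ω.map h)
  have hzero := pathFilter_zero hΛ hd hμ (ω.map h)
  have hmem := pathFilter_mem_face hΛ hd hμ (ω.map h)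
  rcases eq_zero_or_pos t with rfl | ht
  · have hmesh : ∀ n, mesh 0 n = 0 := fun n => by simp [mesh]
    have hconst : ∀ k, gridFilter Λ h μ 0 (fun j => Y h (j * 0) ω) k
        = levelInd h (Y h 0 ω) * μ := by
      intro k
      induction k with
      | zero => simp [gridFilter]
      | succ k ih =>
        rw [gridFilter, ih]
        simp only [mul_zero, NNReal.coe_zero, zero_smul, NormedSpace.exp_zero, vecMul_one]
        exact levelInd_mul_of_supp fun i hi => by simp [levelInd, hi]
    simp only [hmesh, hconst]
    rw [hzero, X_map, hcond]
    exact tendsto_const_nhds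
  · have key : ∀ s, s ≤ t → TendstoDirection (fun n => gridFilter Λ h μ (mesh t n)
        (fun j => Y h (j * mesh t n) ω) (gridCeil t n s)) (pathFilter Λ h d s μ (ω.map h)) ∧
        0 < pathFilter Λ h d s μ (ω.map h) (X s ω) := by
      refine ω.induction (fun _ => ?_) fun u s hus hc hu hst => ?_
      · rw [hzero, X_map, hcond]
        refine ⟨TendstoDirection.normalizeVec_right ⟨fun _ => 1, by simp, ?_⟩ hinitmass,
          mul_pos (inv_pos.2 hinitmass) hinitpos⟩
        simp [gridCeil_zero, gridFilter]
      · obtain ⟨h1, h2⟩ := hu (hus.le.trans hst)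
        have hs : pathFilter Λ h d s μ (ω.map h) = _ := hflow.step u s hus (hc.map h)
        rw [hs]
        exact tendstoDirection_step hΛ ht ω hus hc (hrate u s hus hst hc) (hmem u) h2 h1
    have h1 := (key t le_rfl).1.tendsto_normalizeVec (hmem t).1.2
    simpa only [gridCeil_self ht] using h1

end Convergence

/-! ### The filter computes the conditional law of the chain -/

section GridObservations

variable {I O : Type*} {h : I → O}

/-- The event that `Y` takes the values `a 0, …, a k` at the times `0, δ, …, k δ`. -/
def gridEvent (h : I → O) (δ : ℝ≥0) (k : ℕ) (a : ℕ → O) : Set (Path I) :=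
  {ω | ∀ j ≤ k, Y h (j * δ) ω = a j}

theorem measurableSet_gridEvent (h : I → O) (δ : ℝ≥0) (k : ℕ) (a : ℕ → O) :
    MeasurableSet[stateFiltration I (k * δ)] (gridEvent h δ k a) := by
  have : gridEvent h δ k a = ⋂ j ∈ Finset.range (k + 1), Y h (j * δ) ⁻¹' {a j} := by
    ext ω; simp [gridEvent]
  rw [this]
  refine Finset.measurableSet_biInter _ fun j hj =>
    obsFiltration_le_stateFiltration h _ _ (measurableSet_obsFiltration h ?_ _)
  have : j ≤ k := Nat.lt_succ_iff.1 (Finset.mem_range.1 hj)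
  gcongr

/-- The observations `Y 0, Y δ, …, Y (N δ)`. A finite tuple `a` of observations is read as the sequence
`fun j => a (Fin.ofNat (N + 1) j)`, whose values beyond `N` are irrelevant. -/
def gridObs (h : I → O) (δ : ℝ≥0) (N : ℕ) (ω : Path I) : Fin (N + 1) → O :=
  fun j => Y h ((j : ℕ) * δ) ω

theorem gridObs_ofNat (h : I → O) (δ : ℝ≥0) {N j : ℕ} (hj : j ≤ N) (ω : Path I) :
    gridObs h δ N ω (Fin.ofNat (N + 1) j) = Y h (j * δ) ω := by
  change Y h ((Fin.ofNat (N + 1) j : ℕ) * δ) ω = _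
  rw [Fin.val_ofNat, Nat.mod_eq_of_lt (Nat.lt_succ_of_le hj)]

theorem preimage_gridObs_singleton (h : I → O) (δ : ℝ≥0) (N : ℕ) (a : Fin (N + 1) → O) :
    gridObs h δ N ⁻¹' {a} = gridEvent h δ N fun j => a (Fin.ofNat (N + 1) j) := by
  ext ω
  simp only [Set.mem_preimage, Set.mem_singleton_iff, gridEvent, Set.mem_ofPred_eq]
  constructor
  · rintro rfl j hj
    exact (gridObs_ofNat h δ hj ω).symm
  · intro H
    funext j
    have h1 := H j (Nat.lt_succ_iff.1 j.2)
    rwa [Fin.ofNat_eq_cast, Fin.cast_val_eq_self] at h1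

theorem measurable_gridObs [MeasurableSpace O] (h : I → O) (δ : ℝ≥0) (N : ℕ) :
    Measurable (gridObs h δ N) :=
  measurable_pi_iff.2 fun j B _ => measurableSet_X_preimage ((j : ℕ) * δ) (h ⁻¹' B)

/-- For `t = 0` the mesh vanishes, and division by zero puts every time at the grid point `0`. -/
theorem gridCeil_zero_left (n : ℕ) (s : ℝ≥0) : gridCeil 0 n s = 0 := by
  simp [gridCeil, mesh]

/-- The observed events up to time `t` are limits of events that depend on the observations on the
grids of `[0, t]` only. -/
theorem eventually_mem_cylinder_iff (t : ℝ≥0) {F : Finset ℝ≥0} (hF : ↑F ⊆ Set.Iic t)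
    (x : ℝ≥0 → O) (ω : Path I) :
    ∀ᶠ n in atTop, (∀ s ∈ F, Y h (gridCeil t n s * mesh t n) ω = x s) ↔
      ω ∈ cylinderEvent (Y h) F x := by
  have h1 : ∀ᶠ n in atTop, ∀ s ∈ F, Y h (gridCeil t n s * mesh t n) ω = Y h s ω := by
    refine (Finset.eventually_all F).2 fun s hs => ?_
    rcases eq_zero_or_pos t with rfl | ht
    · have : s = 0 := nonpos_iff_eq_zero.1 (hF hs)
      simp [gridCeil_zero_left, this]
    · exact (ω.map h).eventually_gridCeil_eq ht s
  filter_upwards [h1] with n hn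
  exact forall₂_congr fun s hs => by rw [hn s hs]

end GridObservations

section FilterProperty

attribute [local instance] Matrix.linftyOpNormedRing Matrix.linftyOpNormedAlgebra

variable {I O : Type*} [Fintype I] [DecidableEq I] {Λ : Matrix I I ℝ} {h : I → O}
  {Q : Measure (Path I)}

theorem IsMarkovMeasure.transition_le (hΛ : IsRateMatrix Λ) (hQ : IsMarkovMeasure Λ Q) (t s : ℝ≥0)
    (i j : I) : Q.real (X t ⁻¹' {i} ∩ X (t + s) ⁻¹' {j})
      ≤ Q.real Set.univ * NormedSpace.exp ((s : ℝ) • Λ) i j := by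
  have _ := hQ.isFiniteMeasure
  rw [hQ.transition t s _ (measurableSet_stateFiltration le_rfl {i}) j]
  have hE := exp_entry_nonneg hΛ.offDiag_nonneg s.2
  rw [Finset.sum_eq_single i]
  · exact mul_le_mul_of_nonneg_right (measureReal_mono (Set.subset_univ _)) (hE i j)
  · intro k _ hk
    rw [← Set.preimage_inter, Set.singleton_inter_eq_empty.2 (by simpa using Ne.symm hk),
      Set.preimage_empty, measureReal_empty]
    exact zero_mul _
  · simp

/-- Almost surely, the chain makes no jump of rate zero: on a grid of mesh `δ` the probability to
see such a jump is of order `δ⁻¹ * o(δ)`. -/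
theorem IsMarkovMeasure.ae_rate_pos (hΛ : IsRateMatrix Λ) (hQ : IsMarkovMeasure Λ Q) (t : ℝ≥0) :
    ∀ᵐ ω ∂Q, ∀ u s, u < s → s ≤ t → ConstOn ω u s → X s ω ≠ X u ω → 0 < Λ (X u ω) (X s ω) := by
  have _ := hQ.isFiniteMeasure
  rcases eq_zero_or_pos t with rfl | ht
  · exact Eventually.of_forall fun ω u s hus hs => absurd (hus.trans_le hs) not_lt_zero
  let E : I → I → ℕ → Set (Path I) := fun i j n => ⋃ k ∈ Finset.range (n + 1),
    X (k * mesh t n) ⁻¹' {i} ∩ X (k * mesh t n + mesh t n) ⁻¹' {j}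
  have hE0 : ∀ i j, i ≠ j → Λ i j = 0 → Tendsto (fun n => Q.real (E i j n)) atTop (𝓝 0) := by
    intro i j hij hrate
    have hlim : Tendsto (fun n : ℕ => Q.real Set.univ * ((t : ℝ) *
        (((mesh t n : ℝ))⁻¹ • (NormedSpace.exp ((mesh t n : ℝ) • Λ) - 1)) i j)) atTop (𝓝 0) := by
      have hδ0 : Tendsto (fun n => (mesh t n : ℝ)) atTop (𝓝 0) := by
        have := tendsto_mesh t
        rw [← NNReal.tendsto_coe] at this
        exact this
      have h1 := tendsto_exp_sub_one Λ (fun n => NNReal.coe_pos.2 (mesh_pos ht n)) hδ0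
      have h2 := (tendsto_pi_nhds.1 ((tendsto_pi_nhds.1 h1) i)) j
      have h3 := (h2.const_mul (t : ℝ)).const_mul (Q.real Set.univ)
      rw [hrate, mul_zero, mul_zero] at h3
      exact h3
    refine squeeze_zero (fun _ => measureReal_nonneg) (fun n => ?_) hlim
    have h1 : Q.real (E i j n) ≤ ∑ k ∈ Finset.range (n + 1),
        Q.real (X (k * mesh t n) ⁻¹' {i} ∩ X (k * mesh t n + mesh t n) ⁻¹' {j}) :=
      measureReal_biUnion_finset_le _ _
    have h5 : ∀ k ∈ Finset.range (n + 1), _ := fun k _ =>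
      hQ.transition_le hΛ (k * mesh t n) (mesh t n) i j
    refine h1.trans ((Finset.sum_le_sum h5).trans (le_of_eq ?_))
    rw [Finset.sum_const, Finset.card_range, nsmul_eq_mul, mul_left_comm]
    congr 1
    have h2 : ((n + 1 : ℕ) : ℝ) * mesh t n = t := by exact_mod_cast succ_mul_mesh t n
    have h3 : (mesh t n : ℝ) ≠ 0 := (NNReal.coe_pos.2 (mesh_pos ht n)).ne'
    have h4 : (((mesh t n : ℝ))⁻¹ • (NormedSpace.exp ((mesh t n : ℝ) • Λ) - 1)) i j
        = (mesh t n : ℝ)⁻¹ * NormedSpace.exp ((mesh t n : ℝ) • Λ) i j := by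
      change (mesh t n : ℝ)⁻¹ * (NormedSpace.exp ((mesh t n : ℝ) • Λ) i j - (1 : Matrix I I ℝ) i j)
        = _
      rw [one_apply_ne hij, sub_zero]
    rw [h4, ← h2]
    field_simp
  have hnull : ∀ i j, i ≠ j → Λ i j = 0 → ∀ᵐ ω ∂Q, ¬ ∀ᶠ n in atTop, ω ∈ E i j n := by
    intro i j hij hrate
    have h1 : ∀ N, Q (⋂ n ≥ N, E i j n) = 0 := by
      intro N
      rw [← measureReal_eq_zero_iff]
      refine le_antisymm (ge_of_tendsto (hE0 i j hij hrate) ?_) measureReal_nonneg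
      filter_upwards [eventually_ge_atTop N] with n hn
      exact measureReal_mono (Set.biInter_subset_of_mem hn) (measure_ne_top _ _)
    rw [ae_iff]
    refine measure_mono_null (fun ω hω => ?_) (measure_iUnion_null h1)
    obtain ⟨N, hN⟩ := eventually_atTop.1 (not_not.1 hω)
    exact Set.mem_iUnion.2 ⟨N, Set.mem_iInter₂.2 hN⟩
  have hall : ∀ᵐ ω ∂Q, ∀ i j, i ≠ j → Λ i j = 0 → ¬ ∀ᶠ n in atTop, ω ∈ E i j n := by
    simp only [ae_all_iff, eventually_imp_distrib_left]
    exact fun i j => hnull i j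
  filter_upwards [hall] with ω hω u s hus hst hc hne
  refine lt_of_le_of_ne (hΛ.offDiag_nonneg _ _ (Ne.symm hne)) fun hzero =>
    hω _ _ (Ne.symm hne) hzero.symm ?_
  filter_upwards [eventually_gridCeil_lt ht hus, ω.eventually_gridCeil_eq ht s] with n h1 h2
  obtain ⟨k, hk⟩ : ∃ k, gridCeil t n s = k + 1 := ⟨gridCeil t n s - 1, by omega⟩
  have hkn := gridCeil_le_succ ht n hst
  refine Set.mem_iUnion₂.2 ⟨k, Finset.mem_range.2 (by omega), ?_, ?_⟩
  · exact hc.grid_eq ht (by omega) (by omega)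
  · rw [hk] at h2
    change X (k * mesh t n + mesh t n) ω = X s ω
    rw [← h2]
    congr 1
    push_cast
    ring

/-- Almost surely, the chain starts in the support of its initial law. -/
theorem IsChainLaw.ae_initial_pos {μ : I → ℝ} (hμ : μ ∈ stdSimplex ℝ I)
    (hQ : IsChainLaw Λ μ Q) : ∀ᵐ ω ∂Q, 0 < μ (X 0 ω) := by
  have h1 : ∀ᵐ ω ∂Q, ∀ i, μ i = 0 → X 0 ω ≠ i := by
    simp only [ae_all_iff, eventually_imp_distrib_left]
    intro i hi
    rw [ae_iff]
    simp only [not_not, hQ.initial i, hi, ENNReal.ofReal_zero]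
  filter_upwards [h1] with ω hω
  exact lt_of_le_of_ne (hμ.1 _) fun h0 => hω _ h0.symm rfl

variable [DecidableEq O]

/-- The probabilistic meaning of the unnormalized discrete filter. -/
theorem IsMarkovMeasure.measureReal_gridEvent {μ : I → ℝ} (hQ : IsMarkovMeasure Λ Q)
    (h0 : ∀ i, Q.real (X 0 ⁻¹' {i}) = μ i) (δ : ℝ≥0) (a : ℕ → O) (k : ℕ) (i : I) :
    Q.real (gridEvent h δ k a ∩ X (k * δ) ⁻¹' {i}) = gridFilter Λ h μ δ a k i := by
  have _ := hQ.isFiniteMeasure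
  induction k generalizing i with
  | zero =>
    rw [gridFilter, Pi.mul_apply, ← h0 i, levelInd]
    split_ifs with hi
    · rw [one_mul]
      congr 1
      ext ω
      simp only [gridEvent, Nat.le_zero, Nat.cast_zero, zero_mul, Set.mem_inter_iff,
        Set.mem_ofPred_eq, Set.mem_preimage, Set.mem_singleton_iff, forall_eq, Y, and_iff_right_iff_imp]
      rintro rfl
      exact hi
    · rw [zero_mul]
      convert measureReal_empty
      refine Set.eq_empty_of_forall_notMem fun ω hω => hi ?_
      have h1 : Y h ((0 : ℕ) * δ) ω = a 0 := hω.1 0 le_rfl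
      have h2 : X ((0 : ℕ) * δ) ω = i := hω.2
      rw [← h1, ← h2, Y]
  | succ k ih =>
    have hkδ : ((k + 1 : ℕ) : ℝ≥0) * δ = k * δ + δ := by push_cast; ring
    rw [gridFilter, Pi.mul_apply, levelInd]
    split_ifs with hi
    · have hset : gridEvent h δ (k + 1) a ∩ X ((k + 1 : ℕ) * δ) ⁻¹' {i}
          = gridEvent h δ k a ∩ X (k * δ + δ) ⁻¹' {i} := by
        rw [← hkδ]
        ext ω
        simp only [gridEvent, Set.mem_inter_iff, Set.mem_ofPred_eq, Set.mem_preimage,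
          Set.mem_singleton_iff, and_congr_left_iff]
        intro hX
        refine ⟨fun H j hj => H j (hj.trans k.le_succ), fun H j hj => ?_⟩
        rcases Nat.le_succ_iff.1 hj with hj | rfl
        · exact H j hj
        · rw [Y, hX, hi]
      rw [hset, hQ.transition _ _ _ (measurableSet_gridEvent h δ k a) i, one_mul]
      exact Finset.sum_congr rfl fun j _ => by rw [ih]
    · rw [zero_mul]
      convert measureReal_empty
      refine Set.eq_empty_of_forall_notMem fun ω hω => hi ?_
      have h1 : Y h ((k + 1 : ℕ) * δ) ω = a (k + 1) := hω.1 (k + 1) le_rfl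
      have h2 : X ((k + 1 : ℕ) * δ) ω = i := hω.2
      rw [← h1, ← h2, Y]

variable {d : O → I → ℝ} {μ : I → ℝ}

theorem IsChainLaw.ae_tendsto_gridFilter (hΛ : IsRateMatrix Λ) (hd : ∀ a, d a ∈ face h a)
    (hμ : μ ∈ stdSimplex ℝ I) (hQ : IsChainLaw Λ μ Q) (t : ℝ≥0) :
    ∀ᵐ ω ∂Q, Tendsto (fun n => normalizeVec (gridFilter Λ h μ (mesh t n)
      (fun j => Y h (j * mesh t n) ω) (n + 1))) atTop (𝓝 (pathFilter Λ h d t μ (ω.map h))) := by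
  filter_upwards [hQ.ae_initial_pos hμ, hQ.isMarkovMeasure.ae_rate_pos hΛ t] with ω h1 h2
  exact tendsto_gridFilter hΛ hd hμ t ω h1 h2

variable [Fintype O]

/-- The discrete filter is the conditional law of the chain given the observations on the grid. -/
theorem IsMarkovMeasure.setIntegral_gridFilter (hQ : IsMarkovMeasure Λ Q)
    (h0 : ∀ i, Q.real (X 0 ⁻¹' {i}) = μ i) (δ : ℝ≥0) (N : ℕ) (S : Set (Fin (N + 1) → O)) (i : I) :
    ∫ ω in gridObs h δ N ⁻¹' S,
        normalizeVec (gridFilter Λ h μ δ (fun j => Y h (j * δ) ω) N) i ∂Q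
      = Q.real (gridObs h δ N ⁻¹' S ∩ X (N * δ) ⁻¹' {i}) := by
  classical
  have _ := hQ.isFiniteMeasure
  let _ : MeasurableSpace O := ⊤
  have _ : DiscreteMeasurableSpace O := ⟨fun _ => trivial⟩
  have hm := measurable_gridObs h δ N
  have hS : MeasurableSet S := S.to_countable.measurableSet
  let φ : (Fin (N + 1) → O) → ℝ := fun a =>
    normalizeVec (gridFilter Λ h μ δ (fun j => a (Fin.ofNat (N + 1) j)) N) i
  have hφ : ∀ ω, normalizeVec (gridFilter Λ h μ δ (fun j => Y h (j * δ) ω) N) i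
      = φ (gridObs h δ N ω) := fun ω => by
    have : gridFilter Λ h μ δ (fun j => Y h (j * δ) ω) N = gridFilter Λ h μ δ
        (fun j => gridObs h δ N ω (Fin.ofNat (N + 1) j)) N := gridFilter_congr δ fun j hj => by
      exact (gridObs_ofNat h δ hj ω).symm
    rw [this]
  have hatom : ∀ a, Q.real (gridObs h δ N ⁻¹' {a}) * φ a
      = Q.real (gridObs h δ N ⁻¹' {a} ∩ X (N * δ) ⁻¹' {i}) := by
    intro a
    rw [preimage_gridObs_singleton, hQ.measureReal_gridEvent h0]
    have hmass : Q.real (gridEvent h δ N fun j => a (Fin.ofNat (N + 1) j))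
        = ∑ i, gridFilter Λ h μ δ (fun j => a (Fin.ofNat (N + 1) j)) N i := by
      have h1 := setIntegral_comp_X (Q := Q) (gridEvent h δ N fun j => a (Fin.ofNat (N + 1) j))
        (N * δ) fun _ => 1
      simpa [hQ.measureReal_gridEvent h0] using h1
    change _ * ((∑ i, gridFilter Λ h μ δ (fun j => a (Fin.ofNat (N + 1) j)) N i)⁻¹ * _) = _
    rw [← hmass]
    -- on observations of probability zero, the unnormalized filter vanishes
    by_cases hz : Q.real (gridEvent h δ N fun j => a (Fin.ofNat (N + 1) j)) = 0
    · have hle : gridFilter Λ h μ δ (fun j => a (Fin.ofNat (N + 1) j)) N i ≤ 0 := by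
        rw [← hQ.measureReal_gridEvent h0, ← hz]
        exact measureReal_mono Set.inter_subset_left
      have hge : 0 ≤ gridFilter Λ h μ δ (fun j => a (Fin.ofNat (N + 1) j)) N i := by
        rw [← hQ.measureReal_gridEvent h0]; exact measureReal_nonneg
      rw [hz, zero_mul]
      exact le_antisymm hge hle
    · rw [mul_inv_cancel_left₀ hz]
  simp only [hφ]
  have h1 : ∫ ω in gridObs h δ N ⁻¹' S, φ (gridObs h δ N ω) ∂Q
      = ∫ a in S, φ a ∂(Q.map (gridObs h δ N)) :=
    (setIntegral_map hS (measurable_of_countable φ).aestronglyMeasurable hm.aemeasurable).symm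
  have h2 : Q.real (gridObs h δ N ⁻¹' S ∩ X (N * δ) ⁻¹' {i})
      = ∫ a in S, (1 : ℝ) ∂((Q.restrict (X (N * δ) ⁻¹' {i})).map (gridObs h δ N)) := by
    rw [setIntegral_const, smul_eq_mul, mul_one, map_measureReal_apply hm hS,
      measureReal_restrict_apply (hm hS)]
  rw [h1, h2, integral_fintype Integrable.of_finite, integral_fintype Integrable.of_finite]
  refine Finset.sum_congr rfl fun a _ => ?_
  rw [measureReal_restrict_apply (measurableSet_singleton a),
    measureReal_restrict_apply (measurableSet_singleton a)]
  by_cases ha : a ∈ S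
  · have hmeas := measurableSet_singleton a
    rw [Set.inter_eq_left.2 (Set.singleton_subset_iff.2 ha), map_measureReal_apply hm hmeas,
      map_measureReal_apply hm hmeas, measureReal_restrict_apply (hm hmeas), smul_eq_mul,
      smul_eq_mul, mul_one, hatom]
  · rw [Set.singleton_inter_eq_empty.2 ha]
    simp

/-- The solution of the filtering equation is the conditional law of the chain given the
observations: integrated form, on cylinder events. -/
theorem IsChainLaw.setIntegral_pathFilter_cylinder (hΛ : IsRateMatrix Λ)
    (hd : ∀ a, d a ∈ face h a) (hμ : μ ∈ stdSimplex ℝ I) (hQ : IsChainLaw Λ μ Q) (t : ℝ≥0)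
    {F : Finset ℝ≥0} (hF : ↑F ⊆ Set.Iic t) (x : ℝ≥0 → O) (i : I) :
    ∫ ω in cylinderEvent (Y h) F x, pathFilter Λ h d t μ (ω.map h) i ∂Q
      = Q.real (cylinderEvent (Y h) F x ∩ X t ⁻¹' {i}) := by
  classical
  have hpr := hQ.isProbabilityMeasure
  let _ : MeasurableSpace O := ⊤
  have _ : DiscreteMeasurableSpace O := ⟨fun _ => trivial⟩
  have h0 : ∀ i, Q.real (X 0 ⁻¹' {i}) = μ i := fun i => by
    rw [measureReal_def]
    change (Q {ω | X 0 ω = i}).toReal = _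
    rw [hQ.initial i, ENNReal.toReal_ofReal (hμ.1 i)]
  set D : Set (Path I) := cylinderEvent (Y h) F x with hDdef
  let S : (n : ℕ) → Set (Fin (n + 1 + 1) → O) := fun n =>
    {a | ∀ s ∈ F, a (Fin.ofNat (n + 1 + 1) (gridCeil t n s)) = x s}
  let C : ℕ → Set (Path I) := fun n => gridObs h (mesh t n) (n + 1) ⁻¹' S n
  have hceil : ∀ n, ∀ s ∈ F, gridCeil t n s ≤ n + 1 := fun n s hs => by
    rcases eq_zero_or_pos t with rfl | ht
    · simp [gridCeil_zero_left]
    · exact gridCeil_le_succ ht n (hF hs)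
  have hCiff : ∀ n ω, ω ∈ C n ↔ ∀ s ∈ F, Y h (gridCeil t n s * mesh t n) ω = x s := fun n ω => by
    refine forall₂_congr fun s hs => ?_
    rw [gridObs_ofNat h _ (hceil n s hs)]
  have hCmeas : ∀ n, MeasurableSet (C n) := fun n =>
    measurable_gridObs h (mesh t n) (n + 1) (S n).to_countable.measurableSet
  have hDmeas : MeasurableSet D := by
    have : D = ⋂ s ∈ F, Y h s ⁻¹' {x s} := by ext ω; simp [hDdef, cylinderEvent]
    rw [this]
    exact Finset.measurableSet_biInter _ fun s _ => measurableSet_X_preimage s (h ⁻¹' {x s})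
  have hev : ∀ ω, ∀ᶠ n in atTop, ω ∈ C n ↔ ω ∈ D := fun ω => by
    filter_upwards [eventually_mem_cylinder_iff t hF x ω] with n hn
    rw [hCiff, hn]
  have hgrid : ∀ n, ∫ ω in C n, normalizeVec (gridFilter Λ h μ (mesh t n)
      (fun j => Y h (j * mesh t n) ω) (n + 1)) i ∂Q = Q.real (C n ∩ X t ⁻¹' {i}) := fun n => by
    have := hQ.isMarkovMeasure.setIntegral_gridFilter (h := h) h0 (mesh t n) (n + 1) (S n) i
    rwa [succ_mul_mesh] at this
  let π : ℕ → Path I → ℝ := fun n ω => normalizeVec (gridFilter Λ h μ (mesh t n)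
      (fun j => Y h (j * mesh t n) ω) (n + 1)) i
  have hπmeas : ∀ n, Measurable (π n) := fun n => by
    let φ : (Fin (n + 1 + 1) → O) → ℝ := fun a => normalizeVec (gridFilter Λ h μ (mesh t n)
      (fun j => a (Fin.ofNat (n + 1 + 1) j)) (n + 1)) i
    have : π n = φ ∘ gridObs h (mesh t n) (n + 1) := by
      funext ω
      have h1 : gridFilter Λ h μ (mesh t n) (fun j => Y h (j * mesh t n) ω) (n + 1)
          = gridFilter Λ h μ (mesh t n)
            (fun j => gridObs h (mesh t n) (n + 1) ω (Fin.ofNat (n + 1 + 1) j)) (n + 1) :=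
        gridFilter_congr _ fun j hj => (gridObs_ofNat h _ hj ω).symm
      simp only [π, φ, Function.comp, h1]
    rw [this]
    exact (measurable_of_countable φ).comp (measurable_gridObs h _ _)
  have hπbound : ∀ n ω, ‖π n ω‖ ≤ 1 := fun n ω => by
    obtain ⟨h1, h2⟩ := normalizeVec_apply_mem_Icc
      (gridFilter_nonneg (h := h) hΛ hμ.1 (mesh t n) (fun j => Y h (j * mesh t n) ω) (n + 1)) i
    rw [Real.norm_of_nonneg h1]
    exact h2
  have hlimL : Tendsto (fun n => ∫ ω, (C n).indicator (π n) ω ∂Q) atTop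
      (𝓝 (∫ ω, D.indicator (fun ω => pathFilter Λ h d t μ (ω.map h) i) ω ∂Q)) := by
    refine tendsto_integral_of_dominated_convergence (fun _ => 1)
      (fun n => ((hπmeas n).indicator (hCmeas n)).aestronglyMeasurable) (integrable_const 1)
      (fun n => Eventually.of_forall fun ω => (norm_indicator_le_norm_self _ _).trans
        (hπbound n ω)) ?_
    filter_upwards [hQ.ae_tendsto_gridFilter hΛ hd hμ t] with ω hω
    have hω' := (tendsto_pi_nhds.1 hω) i
    by_cases hD : ω ∈ D
    · rw [Set.indicator_of_mem hD]
      refine hω'.congr' ((hev ω).mono fun n hn => ?_)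
      exact (Set.indicator_of_mem (hn.2 hD) (π n)).symm
    · rw [Set.indicator_of_notMem hD]
      refine tendsto_const_nhds.congr' ((hev ω).mono fun n hn => ?_)
      exact (Set.indicator_of_notMem (fun hC => hD (hn.1 hC)) (π n)).symm
  have hlimR : Tendsto (fun n => ∫ ω, (C n ∩ X t ⁻¹' {i}).indicator (fun _ => (1 : ℝ)) ω ∂Q) atTop
      (𝓝 (∫ ω, (D ∩ X t ⁻¹' {i}).indicator (fun _ => (1 : ℝ)) ω ∂Q)) := by
    refine tendsto_integral_of_dominated_convergence (fun _ => 1)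
      (fun n => (measurable_const.indicator
        ((hCmeas n).inter (measurableSet_X_preimage t {i}))).aestronglyMeasurable)
      (integrable_const 1) (fun n => Eventually.of_forall fun ω =>
        (norm_indicator_le_norm_self _ _).trans (by simp)) (Eventually.of_forall fun ω => ?_)
    refine tendsto_const_nhds.congr' ((hev ω).mono fun n hn => ?_)
    simp only [Set.indicator_apply, Set.mem_inter_iff, hn]
  simp only [integral_indicator (hCmeas _), integral_indicator hDmeas] at hlimL
  simp only [integral_indicator_const _ ((hCmeas _).inter (measurableSet_X_preimage t {i})),
    integral_indicator_const _ (hDmeas.inter (measurableSet_X_preimage t {i})), smul_eq_mul,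
    mul_one] at hlimR
  refine tendsto_nhds_unique hlimL (hlimR.congr fun n => (hgrid n).symm)

/-- The solution of the filtering equation is the conditional law of the chain given the
observations: integrated form. -/
theorem IsChainLaw.setLIntegral_filter (hΛ : IsRateMatrix Λ)
    (hd : ∀ a, d a ∈ face h a) (hμ : μ ∈ stdSimplex ℝ I) (hQ : IsChainLaw Λ μ Q) (t : ℝ≥0)
    {C : Set (Path I)} (hC : MeasurableSet[obsFiltration h t] C) (i : I) :
    ∫⁻ ω in C, ENNReal.ofReal (filterProcess Λ h d μ t ω i) ∂Q = Q (C ∩ X t ⁻¹' {i}) := by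
  have hpr := hQ.isProbabilityMeasure
  have hle := (obsFiltration h).le t
  have hmeas : Measurable fun ω => filterProcess Λ h d μ t ω i :=
    (measurable_pi_apply i).comp ((measurable_filterProcess hΛ hd hμ t).mono hle le_rfl)
  have hmem : ∀ ω, filterProcess Λ h d μ t ω ∈ stdSimplex ℝ I := fun ω => by
    rw [filterProcess_eq_pathFilter hΛ hd hμ]
    exact (pathFilter_mem_face hΛ hd hμ _ t).1
  have hint : Integrable (fun ω => filterProcess Λ h d μ t ω i) Q :=
    Integrable.of_bound hmeas.aestronglyMeasurable 1 (Eventually.of_forall fun ω => by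
      rw [Real.norm_of_nonneg ((hmem ω).1 i), ← (hmem ω).2]
      exact Finset.single_le_sum (fun j _ => (hmem ω).1 j) (Finset.mem_univ i))
  have hcyl : ∀ F : Finset ℝ≥0, ↑F ⊆ Set.Iic t → ∀ x : ℝ≥0 → O,
      ∫⁻ ω in cylinderEvent (Y h) F x, ENNReal.ofReal (filterProcess Λ h d μ t ω i) ∂Q
        = Q (cylinderEvent (Y h) F x ∩ X t ⁻¹' {i}) := by
    intro F hF x
    have h1 := hQ.setIntegral_pathFilter_cylinder hΛ hd hμ t hF x i
    simp only [← filterProcess_eq_pathFilter hΛ hd hμ] at h1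
    rw [← ofReal_integral_eq_lintegral_ofReal hint.integrableOn
      (Eventually.of_forall fun ω => (hmem ω).1 i), h1, ofReal_measureReal]
  -- two measures that agree on the cylinder events, which generate the observed past
  let m1 : Measure (Path I) :=
    Q.withDensity fun ω => ENNReal.ofReal (filterProcess Λ h d μ t ω i)
  let m2 : Measure (Path I) := Q.restrict (X t ⁻¹' {i})
  have hm2 : ∀ C, MeasurableSet C → m2 C = Q (C ∩ X t ⁻¹' {i}) := fun C hC =>
    Measure.restrict_apply hC
  have hm1 : ∀ C, MeasurableSet C →
      m1 C = ∫⁻ ω in C, ENNReal.ofReal (filterProcess Λ h d μ t ω i) ∂Q := fun C hC =>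
    withDensity_apply _ hC
  have hfin : IsFiniteMeasure m2 := inferInstance
  have heq : m2.trim hle = m1.trim hle := by
    have hgen := generateFrom_cylinderEvent (Y h : ℝ≥0 → Path I → O) (Set.Iic t)
    have hcm : ∀ S ∈ {S | ∃ F : Finset ℝ≥0, ↑F ⊆ Set.Iic t ∧ ∃ x, S = cylinderEvent (Y h) F x},
        MeasurableSet[obsFiltration h t] S := by
      intro S hS
      change MeasurableSet[⨆ s ∈ Set.Iic t, MeasurableSpace.comap (Y h s) ⊤] S
      rw [hgen]
      exact MeasurableSpace.measurableSet_generateFrom hS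
    have hagree : ∀ S ∈ {S | ∃ F : Finset ℝ≥0, ↑F ⊆ Set.Iic t ∧
        ∃ x, S = cylinderEvent (Y h) F x}, m2.trim hle S = m1.trim hle S := by
      intro S hS
      have hSm := hcm S hS
      rw [trim_measurableSet_eq hle hSm, trim_measurableSet_eq hle hSm, hm1 _ (hle _ hSm),
        hm2 _ (hle _ hSm)]
      obtain ⟨F, hF, x, rfl⟩ := hS
      exact (hcyl F hF x).symm
    refine ext_of_generate_finite _ hgen (isPiSystem_cylinderEvent (Y h) (Set.Iic t)) hagree ?_
    by_cases hI : IsEmpty (Path I)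
    · simp [Set.univ_eq_empty_iff.2 hI]
    · obtain ⟨ω⟩ := not_isEmpty_iff.1 hI
      have := hagree (cylinderEvent (Y h) ∅ fun _ => Y h 0 ω) ⟨∅, by simp, _, rfl⟩
      simpa [cylinderEvent] using this
  rw [← hm1 C (hle _ hC), ← hm2 C (hle _ hC), ← trim_measurableSet_eq hle hC,
    ← trim_measurableSet_eq hle hC, heq]

end FilterProperty

/-! ### The Markov property of the filter -/

section MarkovProperty

variable {I O : Type*} [Fintype I] {h : I → O}

theorem effectiveSimplex_subset (ν : effectiveSimplex h) : ν.1 ∈ stdSimplex ℝ I := by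
  obtain ⟨a, ha⟩ := Set.mem_iUnion.1 ν.2
  exact ha.1

variable [DecidableEq I] {Λ : Matrix I I ℝ} {P : (I → ℝ) → Measure (Path I)} {μ : I → ℝ}

/-- The laws of the chain form a kernel, since they depend linearly on the initial law. -/
theorem measurable_law (hP : ∀ μ ∈ stdSimplex ℝ I, IsChainLaw Λ μ (P μ)) :
    Measurable fun ν : effectiveSimplex h => P ν := by
  refine Measure.measurable_of_measurable_coe _ fun B _ => ?_
  have h1 : ∀ ν : effectiveSimplex h, P ν B
      = ∑ i, ENNReal.ofReal (ν.1 i) * P (Pi.single i 1) B := fun ν => by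
    rw [law_eq_sum hP (effectiveSimplex_subset ν), Measure.finsetSum_apply]
    rfl
  simp only [h1]
  exact Finset.measurable_sum _ fun i _ =>
    (((measurable_pi_apply i).comp measurable_subtype_coe).ennreal_ofReal).mul_const _

/-- The kernel of the laws of the chain, started in the effective simplex. -/
noncomputable def lawKernel (hP : ∀ μ ∈ stdSimplex ℝ I, IsChainLaw Λ μ (P μ)) :
    Kernel (effectiveSimplex h) (Path I) :=
  ⟨fun ν => P ν, measurable_law hP⟩

theorem isMarkovKernel_lawKernel (hP : ∀ μ ∈ stdSimplex ℝ I, IsChainLaw Λ μ (P μ)) :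
    IsMarkovKernel (lawKernel (h := h) hP) :=
  ⟨fun ν => (hP _ (effectiveSimplex_subset ν)).isProbabilityMeasure⟩

variable [DecidableEq O] {d : O → I → ℝ}

theorem filterProcess_mem (hΛ : IsRateMatrix Λ) (hd : ∀ a, d a ∈ face h a)
    (hμ : μ ∈ stdSimplex ℝ I) (t : ℝ≥0) (ω : Path I) :
    filterProcess Λ h d μ t ω ∈ effectiveSimplex h := by
  rw [filterProcess_eq_pathFilter hΛ hd hμ]
  exact Set.mem_iUnion.2 ⟨_, pathFilter_mem_face hΛ hd hμ _ t⟩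

/-- The filter as a variable with values in the effective simplex. -/
noncomputable def filterVar (hΛ : IsRateMatrix Λ) (hd : ∀ a, d a ∈ face h a)
    (hμ : μ ∈ stdSimplex ℝ I) (t : ℝ≥0) (ω : Path I) : effectiveSimplex h :=
  ⟨filterProcess Λ h d μ t ω, filterProcess_mem hΛ hd hμ t ω⟩

/-- The filter restarts from its current value along the shifted path. -/
theorem filterVar_add (hΛ : IsRateMatrix Λ) (hd : ∀ a, d a ∈ face h a)
    (hμ : μ ∈ stdSimplex ℝ I) (t s : ℝ≥0) (ω : Path I) :
    filterVar hΛ hd hμ (t + s) ω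
      = filterVar hΛ hd (effectiveSimplex_subset (filterVar hΛ hd hμ t ω)) s (ω.shift t) := by
  refine Subtype.ext ?_
  change filterProcess Λ h d μ (t + s) ω
    = filterProcess Λ h d (filterProcess Λ h d μ t ω) s (ω.shift t)
  have hmem : filterProcess Λ h d μ t ω ∈ stdSimplex ℝ I :=
    effectiveSimplex_subset (filterVar hΛ hd hμ t ω)
  rw [filterProcess_eq_pathFilter hΛ hd hmem, filterProcess_eq_pathFilter hΛ hd hμ,
    pathFilter_add hΛ hd hμ, filterProcess_eq_pathFilter hΛ hd hμ]
  rfl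

theorem filterTransition_eq (hΛ : IsRateMatrix Λ) (hd : ∀ a, d a ∈ face h a)
    (t : ℝ≥0) (ν : effectiveSimplex h) (A : Set (effectiveSimplex h)) :
    filterTransition Λ h d P t ν A
      = P ν (filterVar hΛ hd (effectiveSimplex_subset ν) t ⁻¹' A) := by
  rw [filterTransition]
  congr 1
  ext ω
  simp only [Set.mem_ofPred_eq, Set.mem_image, Set.mem_preimage]
  constructor
  · rintro ⟨ρ, hρ, he⟩
    rwa [show filterVar hΛ hd (effectiveSimplex_subset ν) t ω = ρ from Subtype.ext he.symm]
  · exact fun hA => ⟨_, hA, rfl⟩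

/-- Started from a law in the effective simplex, the filter does not move at time `0`. -/
theorem ae_filterVar_zero (hΛ : IsRateMatrix Λ) (hd : ∀ a, d a ∈ face h a)
    (hP : ∀ μ ∈ stdSimplex ℝ I, IsChainLaw Λ μ (P μ)) (ν : effectiveSimplex h) :
    ∀ᵐ ω ∂(P ν), filterVar hΛ hd (effectiveSimplex_subset ν) 0 ω = ν := by
  have hν := effectiveSimplex_subset ν
  obtain ⟨a, ha⟩ := Set.mem_iUnion.1 ν.2
  filter_upwards [(hP ν hν).ae_initial_pos hν] with ω hω
  have hY : Y h 0 ω = a := by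
    by_contra hne
    exact hω.ne' (ha.2 _ hne)
  refine Subtype.ext ?_
  change filterProcess Λ h d ν.1 0 ω = ν.1
  rw [filterProcess_eq_pathFilter hΛ hd hν, pathFilter_zero hΛ hd hν, X_map, hY,
    condOp_of_mem_face d ha]

variable [Fintype O]

theorem measurable_filterVar (hΛ : IsRateMatrix Λ) (hd : ∀ a, d a ∈ face h a)
    (hμ : μ ∈ stdSimplex ℝ I) (t : ℝ≥0) :
    Measurable[obsFiltration h t] (filterVar hΛ hd hμ t) :=
  Measurable.subtype_mk (measurable_filterProcess hΛ hd hμ t)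

theorem measurable_filterVar_prod (hΛ : IsRateMatrix Λ) (hd : ∀ a, d a ∈ face h a) (t : ℝ≥0) :
    Measurable fun z : effectiveSimplex h × Path I =>
      filterVar hΛ hd (effectiveSimplex_subset z.1) t z.2 := by
  refine Measurable.subtype_mk ?_
  simp only [fun z : effectiveSimplex h × Path I =>
    filterProcess_eq_pathFilter hΛ hd (effectiveSimplex_subset z.1) t z.2]
  have h1 : Measurable fun z : effectiveSimplex h × Path I =>
      ((⟨z.1.1, effectiveSimplex_subset z.1⟩ : {μ : I → ℝ // μ ∈ stdSimplex ℝ I}), z.2.map h) :=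
    (Measurable.subtype_mk (measurable_subtype_coe.comp measurable_fst)).prodMk
      ((measurable_map h).comp measurable_snd)
  exact (measurable_pathFilter hΛ hd t).comp h1

/-- The joint law of the filter at time `t` and of the future of the chain, on an event `C` of
the observed past: given the filter, the future is a chain with the filter as its initial law. -/
theorem map_filterVar_shift_eq (hΛ : IsRateMatrix Λ) (hd : ∀ a, d a ∈ face h a)
    (hP : ∀ μ ∈ stdSimplex ℝ I, IsChainLaw Λ μ (P μ)) (hμ : μ ∈ stdSimplex ℝ I) (t : ℝ≥0)
    {C : Set (Path I)} (hC : MeasurableSet[obsFiltration h t] C) :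
    ((P μ).restrict C).map (fun ω => (filterVar hΛ hd hμ t ω, ω.shift t))
      = (((P μ).restrict C).map (filterVar hΛ hd hμ t)) ⊗ₘ lawKernel hP := by
  have hpr := (hP μ hμ).isProbabilityMeasure
  have hker := isMarkovKernel_lawKernel (h := h) hP
  have hle := (obsFiltration h).le t
  have hZ := measurable_filterVar hΛ hd hμ t
  have hZ' : Measurable (filterVar hΛ hd hμ t) := hZ.mono hle le_rfl
  have hpair : Measurable fun ω => (filterVar hΛ hd hμ t ω, ω.shift t) :=
    hZ'.prodMk (measurable_shift t)
  refine Measure.ext_prod fun {A B} hA hB => ?_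
  have hCA : MeasurableSet[obsFiltration h t] (filterVar hΛ hd hμ t ⁻¹' A ∩ C) :=
    (hZ hA).inter hC
  have hL : ((P μ).restrict C).map (fun ω => (filterVar hΛ hd hμ t ω, ω.shift t)) (A ×ˢ B)
      = (((P μ).restrict (filterVar hΛ hd hμ t ⁻¹' A ∩ C)).map (Path.shift t)) B := by
    rw [Measure.map_apply hpair (hA.prod hB), Measure.map_apply (measurable_shift t) hB,
      Measure.restrict_apply (hpair (hA.prod hB)), Measure.restrict_apply (measurable_shift t hB)]
    congr 1
    ext ω
    simp only [Set.mem_inter_iff, Set.mem_preimage, Set.mem_prod]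
    tauto
  rw [hL, map_shift_restrict_eq hP hμ (obsFiltration_le_stateFiltration h t _ hCA),
    Measure.compProd_apply_prod hA hB,
    setLIntegral_map hA (Kernel.measurable_coe _ hB) hZ', Measure.restrict_restrict (hZ' hA),
    Measure.finsetSum_apply]
  have h1 : ∀ ω, lawKernel (h := h) hP (filterVar hΛ hd hμ t ω) B = ∑ i,
      ENNReal.ofReal (filterProcess Λ h d μ t ω i) * P (Pi.single i 1) B := fun ω => by
    change P (filterVar hΛ hd hμ t ω).1 B = _
    rw [law_eq_sum hP (effectiveSimplex_subset _), Measure.finsetSum_apply]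
    rfl
  have hm : ∀ i, Measurable fun ω => ENNReal.ofReal (filterProcess Λ h d μ t ω i) := fun i =>
    ((measurable_pi_apply i).comp (measurable_subtype_coe.comp hZ')).ennreal_ofReal
  simp only [h1]
  rw [lintegral_finsetSum _ fun i _ => (hm i).mul_const _]
  refine Finset.sum_congr rfl fun i _ => ?_
  rw [lintegral_mul_const _ (hm i), (hP μ hμ).setLIntegral_filter hΛ hd hμ t hCA i]
  rfl

/-- The Markov property of the filter, in integrated form. -/
theorem measure_filterVar_add (hΛ : IsRateMatrix Λ) (hd : ∀ a, d a ∈ face h a)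
    (hP : ∀ μ ∈ stdSimplex ℝ I, IsChainLaw Λ μ (P μ)) (hμ : μ ∈ stdSimplex ℝ I) (t s : ℝ≥0)
    {C : Set (Path I)} (hC : MeasurableSet[obsFiltration h t] C)
    {A : Set (effectiveSimplex h)} (hA : MeasurableSet A) :
    P μ (filterVar hΛ hd hμ (t + s) ⁻¹' A ∩ C)
      = ∫⁻ ω in C, filterTransition Λ h d P s (filterVar hΛ hd hμ t ω) A ∂(P μ) := by
  have hpr := (hP μ hμ).isProbabilityMeasure
  have hker := isMarkovKernel_lawKernel (h := h) hP
  have hle := (obsFiltration h).le t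
  have hZ' : Measurable (filterVar hΛ hd hμ t) := (measurable_filterVar hΛ hd hμ t).mono hle le_rfl
  have hpair : Measurable fun ω => (filterVar hΛ hd hμ t ω, ω.shift t) :=
    hZ'.prodMk (measurable_shift t)
  have hT := measurable_filterVar_prod hΛ hd s hA
  have h1 := congrArg (fun m => m ((fun z : effectiveSimplex h × Path I =>
    filterVar hΛ hd (effectiveSimplex_subset z.1) s z.2) ⁻¹' A))
    (map_filterVar_shift_eq hΛ hd hP hμ t hC)
  rw [Measure.map_apply hpair hT, Measure.restrict_apply (hpair hT), Measure.compProd_apply hT,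
    lintegral_map (Kernel.measurable_kernel_prodMk_left hT) hZ'] at h1
  simp only [filterTransition_eq hΛ hd]
  refine Eq.trans ?_ h1
  congr 2
  ext ω
  simp only [Set.mem_preimage, filterVar_add hΛ hd hμ t s ω]

/-- The transition kernel of the filter. -/
noncomputable def transitionKernel (hΛ : IsRateMatrix Λ) (hd : ∀ a, d a ∈ face h a)
    (hP : ∀ μ ∈ stdSimplex ℝ I, IsChainLaw Λ μ (P μ)) (t : ℝ≥0) :
    Kernel (effectiveSimplex h) (effectiveSimplex h) :=
  (Kernel.id ×ₖ lawKernel hP).map fun z => filterVar hΛ hd (effectiveSimplex_subset z.1) t z.2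

theorem transitionKernel_apply (hΛ : IsRateMatrix Λ) (hd : ∀ a, d a ∈ face h a)
    (hP : ∀ μ ∈ stdSimplex ℝ I, IsChainLaw Λ μ (P μ)) (t : ℝ≥0) (ν : effectiveSimplex h) :
    transitionKernel hΛ hd hP t ν
      = (P ν).map (filterVar hΛ hd (effectiveSimplex_subset ν) t) := by
  have hker := isMarkovKernel_lawKernel (h := h) hP
  have hm := measurable_filterVar_prod hΛ hd (h := h) t
  have hpr := (hP ν (effectiveSimplex_subset ν)).isProbabilityMeasure
  rw [transitionKernel, Kernel.map_apply _ hm, Kernel.prod_apply, Kernel.id_apply,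
    Measure.dirac_prod, Measure.map_map hm measurable_prodMk_left]
  rfl

theorem transitionKernel_apply_apply (hΛ : IsRateMatrix Λ) (hd : ∀ a, d a ∈ face h a)
    (hP : ∀ μ ∈ stdSimplex ℝ I, IsChainLaw Λ μ (P μ)) (t : ℝ≥0) (ν : effectiveSimplex h)
    {A : Set (effectiveSimplex h)} (hA : MeasurableSet A) :
    transitionKernel hΛ hd hP t ν A = filterTransition Λ h d P t ν A := by
  rw [transitionKernel_apply, filterTransition_eq hΛ hd, Measure.map_apply
    ((measurable_filterVar hΛ hd _ t).mono ((obsFiltration h).le t) le_rfl) hA]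

/-- The Chapman-Kolmogorov equation is the integrated Markov property on the whole space. -/
theorem isMarkovTransitionFunction_filterTransition (hΛ : IsRateMatrix Λ)
    (hd : ∀ a, d a ∈ face h a) (hP : ∀ μ ∈ stdSimplex ℝ I, IsChainLaw Λ μ (P μ)) :
    IsMarkovTransitionFunction (filterTransition Λ h d P) := by
  have hpr := fun ν : effectiveSimplex h => (hP ν (effectiveSimplex_subset ν)).isProbabilityMeasure
  have hmeas : ∀ t (ν : effectiveSimplex h),
      Measurable (filterVar hΛ hd (effectiveSimplex_subset ν) t) := fun t ν =>
    (measurable_filterVar hΛ hd _ t).mono ((obsFiltration h).le t) le_rfl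
  refine ⟨transitionKernel hΛ hd hP, fun t => ⟨fun ν => ?_⟩,
    fun t ν A hA => transitionKernel_apply_apply hΛ hd hP t ν hA, fun ν => ?_,
    fun s t ν A hA => ?_⟩
  · rw [transitionKernel_apply]
    exact Measure.isProbabilityMeasure_map (hmeas t ν).aemeasurable
  · rw [transitionKernel_apply, Measure.map_congr (ae_filterVar_zero hΛ hd hP ν),
      Measure.map_const, measure_univ, one_smul]
  · rw [transitionKernel_apply_apply hΛ hd hP _ _ hA, filterTransition_eq hΛ hd,
      ← Set.inter_univ (_ ⁻¹' A), measure_filterVar_add hΛ hd hP (effectiveSimplex_subset ν) s t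
        MeasurableSet.univ hA, Measure.restrict_univ, transitionKernel_apply,
      lintegral_map (Kernel.measurable_coe _ hA) (hmeas s ν)]
    simp only [transitionKernel_apply_apply hΛ hd hP _ _ hA]

/-- The Markov property of the filter, as an identity of conditional probabilities. -/
theorem condExp_filterVar_add (hΛ : IsRateMatrix Λ) (hd : ∀ a, d a ∈ face h a)
    (hP : ∀ μ ∈ stdSimplex ℝ I, IsChainLaw Λ μ (P μ)) (hμ : μ ∈ stdSimplex ℝ I) (t s : ℝ≥0)
    {A : Set (effectiveSimplex h)} (hA : MeasurableSet A) :
    (P μ)⟦filterVar hΛ hd hμ (t + s) ⁻¹' A | obsFiltration h t⟧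
      =ᵐ[P μ] fun ω => (filterTransition Λ h d P s (filterVar hΛ hd hμ t ω) A).toReal := by
  have hpr := (hP μ hμ).isProbabilityMeasure
  have hle := (obsFiltration h).le t
  have hprν := fun ν : effectiveSimplex h => (hP ν (effectiveSimplex_subset ν)).isProbabilityMeasure
  have hS : MeasurableSet (filterVar hΛ hd hμ (t + s) ⁻¹' A) :=
    ((measurable_filterVar hΛ hd hμ (t + s)).mono ((obsFiltration h).le _) le_rfl) hA
  have hle1 : ∀ ν, filterTransition Λ h d P s ν A ≤ 1 := fun ν => by
    rw [filterTransition_eq hΛ hd]; exact prob_le_one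
  have hRm : Measurable fun ν => filterTransition Λ h d P s ν A := by
    simp only [← transitionKernel_apply_apply hΛ hd hP s _ hA]
    exact Kernel.measurable_coe _ hA
  have hgm : Measurable[obsFiltration h t] fun ω =>
      filterTransition Λ h d P s (filterVar hΛ hd hμ t ω) A :=
    hRm.comp (measurable_filterVar hΛ hd hμ t)
  have hgm' := hgm.mono hle le_rfl
  have hgi : Integrable (fun ω => (filterTransition Λ h d P s (filterVar hΛ hd hμ t ω) A).toReal)
      (P μ) :=
    Integrable.of_bound hgm'.ennreal_toReal.aestronglyMeasurable 1 (Eventually.of_forall fun ω => by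
      rw [Real.norm_of_nonneg ENNReal.toReal_nonneg]
      exact ENNReal.toReal_mono ENNReal.one_ne_top (hle1 _))
  refine (ae_eq_condExp_of_forall_setIntegral_eq hle ((integrable_const (1 : ℝ)).indicator hS)
    (fun C _ _ => hgi.integrableOn) (fun C hC _ => ?_)
    hgm.ennreal_toReal.stronglyMeasurable.aestronglyMeasurable).symm
  rw [integral_toReal hgm'.aemeasurable
      (Eventually.of_forall fun ω => (hle1 _).trans_lt ENNReal.one_lt_top),
    ← measure_filterVar_add hΛ hd hP hμ t s hC hA, setIntegral_indicator hS, setIntegral_const,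
    smul_eq_mul, mul_one, Set.inter_comm]
  rfl

end MarkovProperty

end NoiseFreeFilter

theorem proposition3 {I O : Type*} [Fintype I] [DecidableEq I] [Fintype O] [DecidableEq O]
    (Λ : Matrix I I ℝ) (hΛ : NoiseFreeFilter.IsRateMatrix Λ)
    (h : I → O) (hh : Function.Surjective h)
    -- the arbitrary probabilities `ν_a` entering the operators `H_a`
    (d : O → I → ℝ) (hd : ∀ a, d a ∈ NoiseFreeFilter.face h a)
    -- the laws `P_μ` of the chain, one for each initial distribution `μ`
    (P : (I → ℝ) → Measure (NoiseFreeFilter.Path I))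
    (hP : ∀ μ ∈ stdSimplex ℝ I, NoiseFreeFilter.IsChainLaw Λ μ (P μ)) :
    NoiseFreeFilter.IsMarkovTransitionFunction (NoiseFreeFilter.filterTransition Λ h d P) ∧
    ∀ μ ∈ stdSimplex ℝ I,
      ∃ hmem : ∀ t ω, NoiseFreeFilter.filterProcess Λ h d μ t ω
          ∈ NoiseFreeFilter.effectiveSimplex h,
        (∀ t, Measurable[NoiseFreeFilter.obsFiltration h t]
          fun ω => (⟨NoiseFreeFilter.filterProcess Λ h d μ t ω, hmem t ω⟩ :
            NoiseFreeFilter.effectiveSimplex h)) ∧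
        ∀ (t s : ℝ≥0) (A : Set (NoiseFreeFilter.effectiveSimplex h)), MeasurableSet A →
          (P μ)⟦{ω | NoiseFreeFilter.filterProcess Λ h d μ (t + s) ω ∈ Subtype.val '' A} |
              NoiseFreeFilter.obsFiltration h t⟧
            =ᵐ[P μ] fun ω =>
              (NoiseFreeFilter.filterTransition Λ h d P s
                ⟨NoiseFreeFilter.filterProcess Λ h d μ t ω, hmem t ω⟩ A).toReal := by
  refine ⟨NoiseFreeFilter.isMarkovTransitionFunction_filterTransition hΛ hd hP, fun μ hμ =>
    ⟨NoiseFreeFilter.filterProcess_mem hΛ hd hμ, NoiseFreeFilter.measurable_filterVar hΛ hd hμ,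
      fun t s A hA => ?_⟩⟩
  have hset : {ω | NoiseFreeFilter.filterProcess Λ h d μ (t + s) ω ∈ Subtype.val '' A}
      = NoiseFreeFilter.filterVar hΛ hd hμ (t + s) ⁻¹' A := by
    ext ω
    constructor
    · rintro ⟨ρ, hρ, he⟩
      change NoiseFreeFilter.filterVar hΛ hd hμ (t + s) ω ∈ A
      rwa [show NoiseFreeFilter.filterVar hΛ hd hμ (t + s) ω = ρ from Subtype.ext he.symm]
    · exact fun hA => ⟨_, hA, rfl⟩
  rw [hset]
  exact NoiseFreeFilter.condExp_filterVar_add hΛ hd hP hμ t s hA
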